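/- \textbf{Conventions.} Manifolds are Hausdorff and without boundary; ``closed'' means compact. Let $F$ be a closed $C^\infty$ manifold and $M$ a $C^\infty$ manifold. A map $\pi\colon M\to B$ to a topological manifold is a \emph{continuous $F$-bundle with $C^1$ fibers} if every point of $B$ lies in an open set $U$ with a local trivialization $\tau\colon U\times F\to\pi^{-1}(U)$ such that each $\tau(u,\cdot)\colon F\to M$ is a $C^1$ embedding and the derivative of $\tau(u,\cdot)$ depends continuously on $u$ (jointly with the tangent vector of $F$). A map $\phi\colon M\to N$ to a $C^\infty$ manifold is \emph{uniformly $C^1$ along the fibers} if for all such $\tau$ the maps $\phi\circ\tau(u,\cdot)$ are $C^1$ with derivative depending continuously on $u$ in the same sense; a family $\phi_t$, $t\in[0,1]$, is so \emph{continuously in $t$} if this holds jointly in $(u,t)$. A homeomorphism is \emph{fibered} if it maps fibers onto fibers, covering a homeomorphism of the base. Given a $C^\infty$ Riemannian metric on $M$, the \emph{distortion} of a fibered homeomorphism $f$ of $M$ is $$D(f)=\sup_{x\in M}\max\{\|D_x(f|_{\pi^{-1}(\pi(x))})\|,\ \|D_x(f^{-1}|_{\pi^{-1}(\pi(x))})\|\}\in[0,\infty],$$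 the norms being $\infty$ where the restriction to the fiber is not differentiable. A $C^\infty$ $F$-bundle is one with $C^\infty$ local trivializations. \textbf{Lemma.} Let $M$ be a closed $C^\infty$ Riemannian manifold, $F$ a closed $C^\infty$ manifold, $B$ a topological manifold, and $\pi\colon M\to B$ a continuous $F$-bundle with $C^1$ fibers. Let $f\colon M\to M$ be a fibered homeomorphism, covering the homeomorphism $\bar f\colon B\to B$, that is uniformly $C^1$ along the fibers and satisfies $D(f)<\lambda$, where $\lambda>1$. Let $\hat B$ be a $C^\infty$ structure on $B$, let $\bar g\colon\hat B\to\hat B$ be a $C^\infty$ diffeomorphism, and let $h\colon B\to\hat B$ be a homeomorphism, homotopic to the identity, with $h\circ\bar f=\bar g\circ h$. Then there exist a $C^\infty$ manifold $\hat M$ with a $C^\infty$ $F$-bundle $\hat\pi\colon\hat M\to\hat B$, a $C^\infty$ Riemannian metric on $\hat M$, a homeomorphism $g\colon\hat M\to\hat M$, and homeomorphisms $\Phi,\Psi\colon M\to\hat M$ such that: \begin{enumerate} \item $\Phi$ is an isomorphism of continuous bundles with $C^1$ fibers over the identity of the base: $\hat\pi\circ\Phi=\pi$, and $\Phi$, $\Phi^{-1}$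 are uniformly $C^1$ along the fibers; \item $\hat\pi\circ g=\bar g\circ\hat\pi$, and $g$, $g^{-1}$ are uniformly $C^1$ along the fibers; \item $D(g)<\lambda$ with respect to the metric on $\hat M$; \item $g$ can be continuously deformed to $f$ through homeomorphisms, if $M$ is identified with $\hat M$ by $\Psi$: one has $\hat\pi\circ\Psi=h\circ\pi$, $\Psi$ and $\Psi^{-1}$ are uniformly $C^1$ along the fibers, and there is a homeomorphism $(x,t)\mapsto(g^t(x),t)$ of $M\times[0,1]$ with $g^0=f$ and $g^1=\Psi^{-1}\circ g\circ\Psi$, such that every $g^t$ is a fibered homeomorphism of $\pi\colon M\to B$ and the families $g^t$ and $(g^t)^{-1}$ are uniformly $C^1$ along the fibers, continuously in $t$; \item $g$ is homotopic to $f$ through fibered maps, if $M$ is identified with $\hat M$ by $\Phi$: there is a homotopy $k_t\colon M\to M$ from $k_0=f$ to $k_1=\Phi^{-1}\circ g\circ\Phi$ such that every $k_t$ covers a continuous map $B\to B$ and the family $k_t$ is uniformly $C^1$ along the fibers, continuously in $t$. \end{enumerate} -/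

import Mathlib

open Set Bundle Topology
open scoped Manifold ContDiff ENNReal

universe u v w

noncomputable section

section FiberBundles

variable {B F M N : Type*} [TopologicalSpace B]
  {EF HF : Type*} [NormedAddCommGroup EF] [NormedSpace ℝ EF] [TopologicalSpace HF]
  (IF : ModelWithCorners ℝ EF HF)
  [TopologicalSpace F] [ChartedSpace HF F] [IsManifold IF ∞ F]
  {EM HM : Type*} [NormedAddCommGroup EM] [NormedSpace ℝ EM] [TopologicalSpace HM]
  (IM : ModelWithCorners ℝ EM HM)
  [TopologicalSpace M] [ChartedSpace HM M] [IsManifold IM ∞ M]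
  {EN HN : Type*} [NormedAddCommGroup EN] [NormedSpace ℝ EN] [TopologicalSpace HN]
  (IN : ModelWithCorners ℝ EN HN)
  [TopologicalSpace N] [ChartedSpace HN N] [IsManifold IN ∞ N]
  {EB HB : Type*} [NormedAddCommGroup EB] [NormedSpace ℝ EB] [TopologicalSpace HB]
  (IB : ModelWithCorners ℝ EB HB) [ChartedSpace HB B]

/-- The maps `φ u : F → N` are `C^1` and they and their derivatives vary continuously with
`u ∈ U`, jointly with the point (and tangent vector) of `F`. -/
def IsC1FamilyOn (U : Set B) (φ : B → F → N) : Prop :=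
  (∀ u ∈ U, ContMDiff IF IN 1 (φ u)) ∧
    ContinuousOn (fun p : B × TangentBundle IF F => tangentMap IF IN (φ p.1) p.2)
      (U ×ˢ (univ : Set (TangentBundle IF F)))

/-- The parametrization `F → proj⁻¹(u)`, `u ∈ e.baseSet`, given by a local trivialization `e`. -/
def fiberParam {proj : M → B} (e : Trivialization F proj) (u : B) (y : F) : M :=
  e.toOpenPartialHomeomorph.symm (u, y)

/-- A local trivialization of `proj : M → B` which embeds `F` onto the fibers over its base set as
`C^1` submanifolds of `M`, whose `1`-jets vary continuously. -/
def IsC1Trivialization {proj : M → B} (e : Trivialization F proj) : Prop :=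
  IsC1FamilyOn IF IM e.baseSet (fiberParam e) ∧
    ∀ u ∈ e.baseSet, ∀ y : F, Function.Injective (mfderiv IF IM (fiberParam e u) y)

variable (F) in
/-- `proj : M → B` is a continuous fiber bundle with `C^1` fibers `F`. -/
def IsC1FiberedBundle (proj : M → B) : Prop :=
  ∀ b : B, ∃ e : Trivialization F proj, b ∈ e.baseSet ∧ IsC1Trivialization IF IM e

variable (F) in
/-- `proj : M → B` is a `C^∞` fiber bundle with fiber `F`, over the smooth manifold `B`. -/
def IsSmoothFiberBundle (proj : M → B) : Prop :=
  ∀ b : B, ∃ e : Trivialization F proj, b ∈ e.baseSet ∧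
    ContMDiffOn IM (IB.prod IF) ∞ e e.source ∧
    ContMDiffOn (IB.prod IF) IM ∞ e.toOpenPartialHomeomorph.symm e.target

variable (F) in
/-- The map `f : M → N` is uniformly `C^1` along the fibers of `proj : M → B`: its restrictions to
the fibers are `C^1`, and their `1`-jets vary continuously. -/
def IsUniformlyC1AlongFibers (proj : M → B) (f : M → N) : Prop :=
  ∀ e : Trivialization F proj, IsC1Trivialization IF IM e →
    IsC1FamilyOn IF IN e.baseSet (fun u y => f (fiberParam e u y))

variable (F) in
/-- The maps `Γ t : M → N`, `t ∈ [0,1]`, are uniformly `C^1` along the fibers of `proj : M → B`,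
and their restrictions to the fibers vary continuously with `t` in the `C^1` sense too. -/
def IsUniformlyC1PathAlongFibers (proj : M → B) (Γ : unitInterval → M → N) : Prop :=
  ∀ e : Trivialization F proj, IsC1Trivialization IF IM e →
    IsC1FamilyOn IF IN (e.baseSet ×ˢ (univ : Set unitInterval))
      (fun (q : B × unitInterval) y => Γ q.2 (fiberParam e q.1 y))

/-- The length of a tangent vector in a Riemannian metric. -/
def riemannianLength (G : ContMDiffRiemannianMetric IM ∞ EM (fun x : M => TangentSpace IM x))
    (x : M) (v : TangentSpace IM x) : ℝ :=
  Real.sqrt (G.inner x v v)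

open Classical in
/-- The operator norm of the derivative of `f` restricted to the fiber `proj⁻¹(u)`, at the point
`fiberParam e u y`. Every tangent vector of the fiber at this point is the image of exactly one
`v` in the tangent space of `F` at `y`. The value is `∞` where the restriction of `f` to the
fiber is not differentiable. -/
def fiberDerivNormAt (G : ContMDiffRiemannianMetric IM ∞ EM (fun x : M => TangentSpace IM x))
    {proj : M → B} (f : M → M) (e : Trivialization F proj) (u : B) (y : F) : ℝ≥0∞ :=
  if MDifferentiableAt IF IM (fun z => f (fiberParam e u z)) y then
    ⨆ v : TangentSpace IF y, ENNReal.ofReal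
      (riemannianLength IM G (f (fiberParam e u y))
          (mfderiv IF IM (fun z => f (fiberParam e u z)) y v) /
        riemannianLength IM G (fiberParam e u y) (mfderiv IF IM (fiberParam e u) y v))
  else ⊤

variable (F) in
/-- The supremum over the points of `M` of the norm of the derivative of `f` along the fibers. -/
def fiberDerivNorm (G : ContMDiffRiemannianMetric IM ∞ EM (fun x : M => TangentSpace IM x))
    (proj : M → B) (f : M → M) : ℝ≥0∞ :=
  ⨆ (e : Trivialization F proj) (_ : IsC1Trivialization IF IM e) (u : B) (_ : u ∈ e.baseSet) (y : F),
    fiberDerivNormAt IF IM G f e u y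

variable (F) in
/-- The distortion along the fibers of a homeomorphism `f` that preserves the bundle `proj`. -/
def fiberDistortion (G : ContMDiffRiemannianMetric IM ∞ EM (fun x : M => TangentSpace IM x))
    (proj : M → B) (f : M ≃ₜ M) : ℝ≥0∞ :=
  max (fiberDerivNorm F IF IM G proj f) (fiberDerivNorm F IF IM G proj f.symm)

end FiberBundles

end

noncomputable section

/-! ### Calculus of continuous families of `C^1` maps. -/

section C1Families

open Function Filter

variable {Q Q' F N Z : Type*} [TopologicalSpace Q] [TopologicalSpace Q']
  {EF HF : Type*} [NormedAddCommGroup EF] [NormedSpace ℝ EF] [TopologicalSpace HF]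
  {IF : ModelWithCorners ℝ EF HF}
  [TopologicalSpace F] [ChartedSpace HF F] [IsManifold IF ∞ F]
  {EN HN : Type*} [NormedAddCommGroup EN] [NormedSpace ℝ EN] [TopologicalSpace HN]
  {IN : ModelWithCorners ℝ EN HN}
  [TopologicalSpace N] [ChartedSpace HN N] [IsManifold IN ∞ N]
  {EZ HZ : Type*} [NormedAddCommGroup EZ] [NormedSpace ℝ EZ] [TopologicalSpace HZ]
  {IZ : ModelWithCorners ℝ EZ HZ}
  [TopologicalSpace Z] [ChartedSpace HZ Z] [IsManifold IZ ∞ Z]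
  {E' : Type*} [NormedAddCommGroup E'] [NormedSpace ℝ E']
  {U V : Set Q} {φ φ' : Q → F → N}

/-! The map `g` is conjugate to `f`: `g = Ψ ∘ f ∘ Ψ⁻¹`, where `Ψ` is a homeomorphism over `h` that
is `C^1` along the fibers in both directions. Then `g` covers `h ∘ fbar ∘ h⁻¹ = gbar`, and the
deformation of `f` to `g` under `Ψ` can be taken constant. What remains is to find a smooth
structure on the total space, the map `Ψ`, and a metric in which conjugation does not spoil the
bound on the distortion.

Smooth structure (`IsC1FiberedBundle.exists_smooth_bundle`). The space `M'` is `M` with its topology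
and a new atlas, and `Φ` is the identity. It suffices to find trivializations, compatible with the
given `C^1` structure of the fibers, whose coordinate changes are smooth jointly in base and fiber.
Coordinate changes are continuous families of `C^1` diffeomorphisms of `F`. Such a family is
smoothed by embedding `F` in a Euclidean space, approximating it in the `C^1` topology by smooth
maps, patching with a partition of unity on the base, and retracting to `F`
(`IsC1DiffeoFamilyOn.exists_smoothing`). The result still consists of diffeomorphisms, since this is
a `C^1`-open condition on a compact manifold (`IsC1FamilyOn.isOpen_bijective`). A finite induction
over a cover of the base then corrects the trivializations one after the other.

The map `Ψ` (`IsC1FiberedBundle.exists_covering_homotopy`). A homotopy `H` from the identity to `h`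
lifts to a path `θ` of maps of `M` that starts at the identity and is a `C^1` diffeomorphism from
fiber to fiber at all times. Since `h` is a homeomorphism, so is `T = θ 1`, and `Ψ = Φ ∘ T`. The
path `θ t ∘ f ∘ T⁻¹ ∘ θ (1 - t)` joins `f` to `T ∘ f ∘ T⁻¹ = Φ⁻¹ ∘ g ∘ Φ`; its members are only
fibered maps, because `H t` need not be invertible at intermediate times.

The metric (`exists_riemannianMetric_near_pushforward`). The push-forward of the given metric under
`Ψ` is defined along the fibers only, and is merely continuous. It can be approximated within any
factor `C > 1` by a smooth metric on the whole space: this is possible locally, and the conditions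
on the metric are convex. Distortion grows by at most the factor `C` (`fiberDerivNorm_le_of_conj`),
and the strict inequality `D(f) < λ` leaves room for it.

Regularity of inverses, coordinate changes and conjugates comes from one principle,
`IsC1FamilyOn.lift`: a continuous lift of a `C^1` family through a family of immersions is a `C^1`
family. -/

theorem IsC1FamilyOn.mono (h : IsC1FamilyOn IF IN U φ) (hVU : V ⊆ U) :
    IsC1FamilyOn IF IN V φ :=
  ⟨fun q hq => h.1 q (hVU hq), h.2.mono (prod_mono hVU subset_rfl)⟩

theorem IsC1FamilyOn.congr (h : IsC1FamilyOn IF IN U φ) (heq : ∀ q ∈ U, φ' q = φ q) :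
    IsC1FamilyOn IF IN U φ' := by
  refine ⟨fun q hq => by rw [heq q hq]; exact h.1 q hq, h.2.congr ?_⟩
  rintro ⟨q, p⟩ ⟨hq, -⟩
  simp only [heq q hq]

theorem isC1FamilyOn_of_local (h : ∀ q ∈ U, ∃ V ∈ 𝓝[U] q, IsC1FamilyOn IF IN V φ) :
    IsC1FamilyOn IF IN U φ := by
  constructor
  · intro q hq
    obtain ⟨V, hV, hVφ⟩ := h q hq
    exact hVφ.1 q (mem_of_mem_nhdsWithin hq hV)
  · rintro ⟨q, p⟩ ⟨hq, -⟩
    obtain ⟨V, hV, hVφ⟩ := h q hq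
    refine (hVφ.2 (q, p) ⟨mem_of_mem_nhdsWithin hq hV, trivial⟩).mono_of_mem_nhdsWithin ?_
    rw [nhdsWithin_prod_eq]
    exact prod_mem_prod hV self_mem_nhdsWithin

theorem isC1FamilyOn_of_isEmpty [IsEmpty F] : IsC1FamilyOn IF IN U φ :=
  ⟨fun _ _ y => isEmptyElim y, fun p _ => isEmptyElim p.2.1⟩

theorem IsC1FamilyOn.mdifferentiable (h : IsC1FamilyOn IF IN U φ) {q : Q} (hq : q ∈ U) :
    MDifferentiable IF IN (φ q) :=
  (h.1 q hq).mdifferentiable one_ne_zero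

/-- By the chain rule, the tangent map of the composite is the composite of two jointly continuous
tangent maps. The change of parameter `a` accounts for fibered maps, which move the base point too.
-/
theorem IsC1FamilyOn.comp {U' : Set Q'} {ψ : Q' → F → N} (hψ : IsC1FamilyOn IF IN U' ψ)
    {a : Q → Q'} (ha : ContinuousOn a U) (hm : MapsTo a U U') {η : Q → Z → F}
    (hη : IsC1FamilyOn IZ IF U η) : IsC1FamilyOn IZ IN U (fun q z => ψ (a q) (η q z)) := by
  refine ⟨fun q hq => (hψ.1 _ (hm hq)).comp (hη.1 q hq), ?_⟩
  have h1 : ContinuousOn (fun p : Q × TangentBundle IZ Z => (a p.1, tangentMap IZ IF (η p.1) p.2))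
      (U ×ˢ univ) :=
    (ha.comp continuousOn_fst fun p hp => hp.1).prodMk hη.2
  refine (hψ.2.comp h1 fun p hp => ⟨hm hp.1, trivial⟩).congr ?_
  rintro ⟨q, p⟩ ⟨hq, -⟩
  exact tangentMap_comp_at p ((hψ.mdifferentiable (hm hq)) _) ((hη.mdifferentiable hq) _)

theorem isC1FamilyOn_const {g : F → N} (hg : ContMDiff IF IN 1 g) :
    IsC1FamilyOn IF IN U (fun _ => g) :=
  ⟨fun _ _ => hg, ((hg.continuous_tangentMap le_rfl).comp continuous_snd).continuousOn⟩

theorem isC1FamilyOn_id : IsC1FamilyOn IF IF U (fun _ => (id : F → F)) :=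
  isC1FamilyOn_const contMDiff_id

theorem IsC1FamilyOn.reparam {U' : Set Q'} {ψ : Q' → F → N} (hψ : IsC1FamilyOn IF IN U' ψ)
    {a : Q → Q'} (ha : ContinuousOn a U) (hm : MapsTo a U U') :
    IsC1FamilyOn IF IN U (fun q => ψ (a q)) :=
  hψ.comp ha hm isC1FamilyOn_id

theorem IsC1FamilyOn.const_comp {g : N → Z} (hg : ContMDiff IN IZ 1 g)
    (hφ : IsC1FamilyOn IF IN U φ) : IsC1FamilyOn IF IZ U (fun q y => g (φ q y)) :=
  (isC1FamilyOn_const (U := univ) hg).comp (a := fun _ : Q => ()) continuousOn_const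
    (fun _ _ => mem_univ _) hφ

/-- Evaluate the tangent maps on the zero section. -/
theorem IsC1FamilyOn.continuousOn (h : IsC1FamilyOn IF IN U φ) :
    ContinuousOn (uncurry φ) (U ×ˢ univ) := by
  have h0 : Continuous (fun y : F => (⟨y, 0⟩ : TangentBundle IF F)) :=
    (Bundle.contMDiff_zeroSection (IB := IF) (n := 0) ℝ (TangentSpace IF (M := F))).continuous
  have h1 : ContinuousOn (fun p : Q × F => (p.1, (⟨p.2, 0⟩ : TangentBundle IF F))) (U ×ˢ univ) :=
    continuousOn_fst.prodMk (h0.comp continuous_snd).continuousOn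
  exact (FiberBundle.continuous_proj EN (TangentSpace IN (M := N))).comp_continuousOn
    (h.2.comp h1 fun p hp => ⟨hp.1, trivial⟩)

theorem continuousOn_tangentBundle_model_iff {X : Type*} [TopologicalSpace X] {s : Set X}
    {g : X → TangentBundle 𝓘(ℝ, E') E'} :
    ContinuousOn g s ↔ ContinuousOn (fun x => (g x).1) s ∧ ContinuousOn (fun x => ((g x).2 : E')) s := by
  rw [← (tangentBundleModelSpaceHomeomorph 𝓘(ℝ, E')).comp_continuousOn_iff]
  have : (tangentBundleModelSpaceHomeomorph 𝓘(ℝ, E')) ∘ g =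
      fun x => (((g x).1, (g x).2) : E' × E') := by
    ext x <;> simp [tangentBundleModelSpaceHomeomorph_coe] <;> rfl
  rw [this]
  exact ⟨fun h => ⟨continuous_fst.comp_continuousOn h, continuous_snd.comp_continuousOn h⟩,
    fun h => h.1.prodMk h.2⟩

theorem isC1FamilyOn_model_iff {φ : Q → F → E'} :
    IsC1FamilyOn IF 𝓘(ℝ, E') U φ ↔ (∀ q ∈ U, ContMDiff IF 𝓘(ℝ, E') 1 (φ q)) ∧
      ContinuousOn (uncurry φ) (U ×ˢ univ) ∧
      ContinuousOn (fun p : Q × TangentBundle IF F =>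
        (mfderiv IF 𝓘(ℝ, E') (φ p.1) p.2.1 p.2.2 : E')) (U ×ˢ univ) := by
  constructor
  · exact fun h => ⟨h.1, h.continuousOn, (continuousOn_tangentBundle_model_iff.1 h.2).2⟩
  · rintro ⟨h1, h2, h3⟩
    refine ⟨h1, continuousOn_tangentBundle_model_iff.2 ⟨?_, h3⟩⟩
    exact h2.comp (continuousOn_fst.prodMk ((FiberBundle.continuous_proj EF
      (TangentSpace IF (M := F))).comp_continuousOn continuousOn_snd)) fun p hp => ⟨hp.1, trivial⟩

theorem IsC1FamilyOn.add {φ ψ : Q → F → E'} (hφ : IsC1FamilyOn IF 𝓘(ℝ, E') U φ)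
    (hψ : IsC1FamilyOn IF 𝓘(ℝ, E') U ψ) :
    IsC1FamilyOn IF 𝓘(ℝ, E') U (fun q y => φ q y + ψ q y) := by
  rw [isC1FamilyOn_model_iff] at *
  refine ⟨fun q hq => (hφ.1 q hq).add (hψ.1 q hq), hφ.2.1.add hψ.2.1, ?_⟩
  refine (hφ.2.2.add hψ.2.2).congr ?_
  rintro ⟨q, p⟩ ⟨hq, -⟩
  have := mfderiv_add ((hφ.1 q hq).mdifferentiable one_ne_zero p.1)
    ((hψ.1 q hq).mdifferentiable one_ne_zero p.1)
  exact congrArg (fun L => L p.2) this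

theorem IsC1FamilyOn.smul {ρ : Q → ℝ} (hρ : ContinuousOn ρ U) {ψ : Q → F → E'}
    (hψ : IsC1FamilyOn IF 𝓘(ℝ, E') U ψ) :
    IsC1FamilyOn IF 𝓘(ℝ, E') U (fun q y => ρ q • ψ q y) := by
  rw [isC1FamilyOn_model_iff] at *
  refine ⟨fun q hq =>
    (contMDiff_const : ContMDiff IF 𝓘(ℝ, ℝ) 1 fun _ : F => ρ q).smul (hψ.1 q hq),
    (hρ.comp continuousOn_fst fun p hp => hp.1).smul hψ.2.1, ?_⟩
  refine ((hρ.comp continuousOn_fst fun p hp => hp.1).smul hψ.2.2).congr ?_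
  rintro ⟨q, p⟩ ⟨hq, -⟩
  have := const_smul_mfderiv ((hψ.1 q hq).mdifferentiable one_ne_zero p.1) (ρ q)
  exact congrArg (fun L => L p.2) this

/-- A jointly `C^1` map defines a `C^1` family. -/
theorem isC1FamilyOn_of_contMDiffOn {EB HB : Type*} [NormedAddCommGroup EB] [NormedSpace ℝ EB]
    [TopologicalSpace HB] {IB : ModelWithCorners ℝ EB HB} [ChartedSpace HB Q] [IsManifold IB ∞ Q]
    (hU : IsOpen U)
    (h : ContMDiffOn (IB.prod IF) IN 1 (uncurry φ) (U ×ˢ univ)) :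
    IsC1FamilyOn IF IN U φ := by
  have hO : IsOpen (U ×ˢ (univ : Set F)) := hU.prod isOpen_univ
  have hat : ∀ q ∈ U, ∀ y, ContMDiffAt (IB.prod IF) IN 1 (uncurry φ) (q, y) := fun q hq y =>
    h.contMDiffAt (hO.mem_nhds ⟨hq, trivial⟩)
  have hι : ∀ q : Q, ContMDiff IF (IB.prod IF) 1 (fun y : F => (q, y)) := fun q =>
    contMDiff_const.prodMk contMDiff_id
  refine ⟨fun q hq y => (hat q hq y).comp y (hι q y), ?_⟩
  -- The inclusion of the vertical tangent vectors `(0, v)`; the tangent map of the family is that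
  -- of `uncurry φ` restricted to them.
  have hT : Continuous (fun p : Q × TangentBundle IF F =>
      (⟨(p.1, p.2.1), (0, p.2.2)⟩ : TangentBundle (IB.prod IF) (Q × F))) := by
    have h0 : Continuous (fun y : Q => (⟨y, 0⟩ : TangentBundle IB Q)) :=
      (Bundle.contMDiff_zeroSection (IB := IB) (n := 0) ℝ (TangentSpace IB (M := Q))).continuous
    exact (contMDiff_equivTangentBundleProd_symm (n := 0)).continuous.comp
      (h0.prodMap continuous_id)
  have h1 := (h.continuousOn_tangentMapWithin le_rfl hO.uniqueMDiffOn).comp hT.continuousOn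
    (fun p (hp : p ∈ U ×ˢ univ) => (⟨hp.1, trivial⟩ : (p.1, p.2.1) ∈ U ×ˢ (univ : Set F)))
  refine h1.congr ?_
  rintro ⟨q, p⟩ ⟨hq, -⟩
  have h2 := tangentMap_comp_at (f := fun y : F => (q, y)) (g := uncurry φ) (I := IF)
    (I' := IB.prod IF) (I'' := IN) p
    ((hat q hq p.1).mdifferentiableAt one_ne_zero) ((hι q).mdifferentiable one_ne_zero _)
  refine h2.trans ?_
  simp only [comp_apply]
  rw [tangentMapWithin_eq_tangentMap (hO.uniqueMDiffOn _ ⟨hq, trivial⟩)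
    ((hat q hq p.1).mdifferentiableAt one_ne_zero)]
  congr 1
  simp only [tangentMap]
  congr 1
  exact (congrArg (fun L => L p.2) (mfderiv_prod_right (I := IB) (I' := IF)
    (x₀ := q) (y₀ := p.1)))

end C1Families

/-! ### Lifting `C^1` families through immersions. -/

section Lifting

set_option linter.unusedSectionVars false

open Function Filter

variable {Q Q' F N Z : Type*} [TopologicalSpace Q] [TopologicalSpace Q']
  {EF HF : Type*} [NormedAddCommGroup EF] [NormedSpace ℝ EF] [TopologicalSpace HF]
  {IF : ModelWithCorners ℝ EF HF}
  [TopologicalSpace F] [ChartedSpace HF F] [IsManifold IF ∞ F]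
  {EN HN : Type*} [NormedAddCommGroup EN] [NormedSpace ℝ EN] [TopologicalSpace HN]
  {IN : ModelWithCorners ℝ EN HN}
  [TopologicalSpace N] [ChartedSpace HN N] [IsManifold IN ∞ N]
  {EZ HZ : Type*} [NormedAddCommGroup EZ] [NormedSpace ℝ EZ] [TopologicalSpace HZ]
  {IZ : ModelWithCorners ℝ EZ HZ}
  [TopologicalSpace Z] [ChartedSpace HZ Z]
  {E' : Type*} [NormedAddCommGroup E'] [NormedSpace ℝ E']
  {U V : Set Q} {φ φ' : Q → F → N}

/-- A continuous solution `η` of `G ∘ η = χ` is as smooth as `G` and `χ`, if `G` has invertible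
derivative. -/
theorem contMDiffAt_of_comp_eq_of_bijective [CompleteSpace EF] [CompleteSpace E']
    [IF.Boundaryless] {n : WithTop ℕ∞}
    [IsManifold IF n F]
    (hn : n ≠ 0) {G : F → E'} {z : Z} {η : Z → F} {χ : Z → E'}
    (hG : ContMDiffAt IF 𝓘(ℝ, E') n G (η z))
    (hbij : Bijective (mfderiv IF 𝓘(ℝ, E') G (η z)))
    (hη : ContinuousAt η z) (hχ : ContMDiffAt IZ 𝓘(ℝ, E') n χ z)
    (heq : ∀ᶠ z' in 𝓝 z, G (η z') = χ z') : ContMDiffAt IZ IF n η z := by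
  set c := extChartAt IF (η z) with hc
  set Θ : EF → E' := G ∘ c.symm with hΘ
  have hcs : c.symm (c (η z)) = η z := c.left_inv (mem_extChartAt_source (I := IF) (η z))
  have hΘd : ContDiffAt ℝ n Θ (c (η z)) := by
    have := (contMDiffAt_iff.1 hG).2
    rw [IF.range_eq_univ, contDiffWithinAt_univ] at this
    exact this
  have hder : fderiv ℝ Θ (c (η z)) = mfderiv IF 𝓘(ℝ, E') G (η z) := by
    refine Eq.symm ((hG.mdifferentiableAt hn).mfderiv.trans ?_)
    change fderivWithin ℝ Θ (range IF) (c (η z)) = _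
    rw [IF.range_eq_univ, fderivWithin_univ]
  let A : EF ≃L[ℝ] E' := ContinuousLinearEquiv.ofBijective (fderiv ℝ Θ (c (η z)))
    (LinearMap.ker_eq_bot.2 (by rw [hder]; exact hbij.1))
    (LinearMap.range_eq_top.2 (by rw [hder]; exact hbij.2))
  have hA : HasFDerivAt Θ (A : EF →L[ℝ] E') (c (η z)) := by
    have := (hΘd.differentiableAt hn).hasFDerivAt
    convert this using 1
    ext v; rfl
  have hs := hΘd.hasStrictFDerivAt' hA hn
  have hinv := hΘd.to_localInverse hA hn
  have hleft := hs.eventually_left_inverse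
  have hcη : ContinuousAt (fun z' => c (η z')) z :=
    ContinuousAt.comp (f := η) (g := c) (continuousAt_extChartAt (η z)) hη
  have hsrc : ∀ᶠ z' in 𝓝 z, η z' ∈ c.source := hη (extChartAt_source_mem_nhds (I := IF) (η z))
  have hΘz : Θ (c (η z)) = χ z := by
    simp only [hΘ, comp_apply, hcs]; exact heq.self_of_nhds
  -- Continuity of `η` keeps `c (η z')` where the local inverse of `Θ` is a left inverse, so `η` is
  -- a composite of maps of the desired regularity.
  have key : ∀ᶠ z' in 𝓝 z, η z' = c.symm (hs.localInverse Θ A _ (χ z')) := by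
    filter_upwards [heq, hsrc, hcη.eventually hleft] with z' h1 h2 h3
    have : Θ (c (η z')) = χ z' := by simp only [hΘ, comp_apply, c.left_inv h2, h1]
    rw [← this, h3, c.left_inv h2]
  refine ContMDiffAt.congr_of_eventuallyEq ?_ key
  have h1 : ContMDiffAt IZ 𝓘(ℝ, EF) n (fun z' => hs.localInverse Θ A _ (χ z')) z := by
    refine ContMDiffAt.comp (I' := 𝓘(ℝ, E')) z ?_ hχ
    rw [← hΘz]
    exact hinv.contMDiffAt
  refine ContMDiffAt.comp (I' := 𝓘(ℝ, EF)) z ?_ h1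
  have h2 : hs.localInverse Θ A _ (χ z) = c (η z) := by
    rw [← hΘz]; exact hs.localInverse_apply_image
  rw [h2]
  exact contMDiffOn_extChartAt_symm (η z) |>.contMDiffAt (extChartAt_target_mem_nhds (η z))

section Coordinates

variable (IF IN) in
/-- The derivative of `g` at `y`, read in the trivializations of the tangent bundles at `y₀` and
`x₀`. -/
def derivInCoord (y₀ : F) (x₀ : N) (g : F → N) (y : F) : EF →L[ℝ] EN :=
  ((trivializationAt EN (TangentSpace IN) x₀).continuousLinearMapAt ℝ (g y)) ∘L
    ((mfderiv IF IN g y) ∘L ((trivializationAt EF (TangentSpace IF) y₀).symmL ℝ y))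

theorem mem_baseSet_trivializationAt_of_mem_source {y₀ y : F} (hy : y ∈ (chartAt HF y₀).source) :
    y ∈ (trivializationAt EF (TangentSpace IF) y₀).baseSet := by
  simpa using hy

theorem continuousOn_symmL_trivializationAt (y₀ : F) (w : EF) :
    ContinuousOn (fun y : F => (⟨y, (trivializationAt EF (TangentSpace IF) y₀).symmL ℝ y w⟩ :
      TangentBundle IF F)) (chartAt HF y₀).source := by
  have h := (trivializationAt EF (TangentSpace IF (M := F)) y₀).continuousOn_symm
  have h2 : ContinuousOn (fun y : F => (y, w)) (chartAt HF y₀).source :=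
    continuousOn_id.prodMk continuousOn_const
  refine (h.comp h2 fun y hy => ⟨mem_baseSet_trivializationAt_of_mem_source hy, trivial⟩).congr
    fun y hy => ?_
  simp only [comp_apply]
  rw [Trivialization.symmL_apply _ (mem_baseSet_trivializationAt_of_mem_source hy)]

/-- Because `EF` is finite-dimensional, continuity on each vector is continuity in the operator
norm. This is what the later arguments about invertibility of derivatives need. -/
theorem IsC1FamilyOn.continuousOn_derivInCoord [FiniteDimensional ℝ EF]
    (hφ : IsC1FamilyOn IF IN U φ) (y₀ : F) (x₀ : N) :
    ContinuousOn (fun p : Q × F => derivInCoord IF IN y₀ x₀ (φ p.1) p.2)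
      {p | p.1 ∈ U ∧ p.2 ∈ (chartAt HF y₀).source ∧ φ p.1 p.2 ∈ (chartAt HN x₀).source} := by
  rw [continuousOn_clm_apply]
  intro w
  set S := {p : Q × F | p.1 ∈ U ∧ p.2 ∈ (chartAt HF y₀).source ∧
    φ p.1 p.2 ∈ (chartAt HN x₀).source} with hS
  have h1 : ContinuousOn (fun p : Q × F => tangentMap IF IN (φ p.1)
      ⟨p.2, (trivializationAt EF (TangentSpace IF) y₀).symmL ℝ p.2 w⟩) S :=
    hφ.2.comp (continuousOn_fst.prodMk ((continuousOn_symmL_trivializationAt y₀ w).comp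
      continuousOn_snd fun p hp => hp.2.1)) fun p hp => ⟨hp.1, trivial⟩
  set e := trivializationAt EN (TangentSpace IN (M := N)) x₀ with he
  have h2 : ContinuousOn (fun p : Q × F => (e (tangentMap IF IN (φ p.1)
      ⟨p.2, (trivializationAt EF (TangentSpace IF) y₀).symmL ℝ p.2 w⟩)).2) S :=
    continuousOn_snd.comp (e.continuousOn.comp h1 fun p hp =>
      e.mem_source.2 (mem_baseSet_trivializationAt_of_mem_source hp.2.2)) (mapsTo_univ _ _)
  refine h2.congr fun p hp => ?_
  have hb : φ p.1 p.2 ∈ e.baseSet := mem_baseSet_trivializationAt_of_mem_source hp.2.2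
  simp only [derivInCoord, ContinuousLinearMap.comp_apply, tangentMap]
  exact e.continuousLinearMapAt_apply_of_mem ℝ hb _

theorem injective_continuousLinearMapAt_trivializationAt {x₀ x : N}
    (hx : x ∈ (chartAt HN x₀).source) :
    Injective ((trivializationAt EN (TangentSpace IN) x₀).continuousLinearMapAt ℝ x) :=
  HasLeftInverse.injective ⟨_, (trivializationAt EN (TangentSpace IN)
    x₀).symmL_continuousLinearMapAt (R := ℝ) (mem_baseSet_trivializationAt_of_mem_source hx)⟩

theorem injective_symmL_trivializationAt {x₀ x : N} (hx : x ∈ (chartAt HN x₀).source) :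
    Injective ((trivializationAt EN (TangentSpace IN) x₀).symmL ℝ x) :=
  HasLeftInverse.injective ⟨_, (trivializationAt EN (TangentSpace IN)
    x₀).continuousLinearMapAt_symmL (R := ℝ) (mem_baseSet_trivializationAt_of_mem_source hx)⟩

theorem injective_derivInCoord {y₀ y : F} {x₀ : N} {g : F → N} (hy : y ∈ (chartAt HF y₀).source)
    (hgy : g y ∈ (chartAt HN x₀).source) (hg : Injective (mfderiv IF IN g y)) :
    Injective (derivInCoord IF IN y₀ x₀ g y) :=
  (injective_continuousLinearMapAt_trivializationAt hgy).comp
    (hg.comp (injective_symmL_trivializationAt hy))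

theorem exists_continuousLinearMap_leftInverse [FiniteDimensional ℝ EF] (D : EF →L[ℝ] E')
    (hD : Injective D) [FiniteDimensional ℝ E'] : ∃ L : E' →L[ℝ] EF, L ∘L D = .id ℝ EF := by
  obtain ⟨L, hL⟩ := LinearMap.exists_leftInverse_of_injective (D : EF →ₗ[ℝ] E')
    (LinearMap.ker_eq_bot.2 hD)
  refine ⟨LinearMap.toContinuousLinearMap L, ?_⟩
  ext v
  exact LinearMap.congr_fun hL v

variable [FiniteDimensional ℝ EF] [FiniteDimensional ℝ EN] [IF.Boundaryless] [IsManifold IZ ∞ Z]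

/-- A continuous lift of a `C^1` map through a `C^1` immersion is `C^1`. -/
theorem contMDiffAt_of_comp_eq_of_injective {g : F → N} {z : Z} {η : Z → F} {χ : Z → N}
    (hg : ContMDiffAt IF IN 1 g (η z)) (hinj : Injective (mfderiv IF IN g (η z)))
    (hη : ContinuousAt η z) (hχ : ContMDiffAt IZ IN 1 χ z) (heq : ∀ z', g (η z') = χ z') :
    ContMDiffAt IZ IF 1 η z := by
  set x₀ := g (η z) with hx₀
  set c := extChartAt IN x₀ with hc
  have hcd : ContMDiffAt IN 𝓘(ℝ, EN) 1 c x₀ := contMDiffAt_extChartAt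
  have hci : Injective (mfderiv IN 𝓘(ℝ, EN) c x₀) := by
    have h := injective_continuousLinearMapAt_trivializationAt (IN := IN) (mem_chart_source HN x₀)
    rw [TangentBundle.continuousLinearMapAt_trivializationAt (mem_chart_source HN x₀)] at h
    exact h
  let D : EF →L[ℝ] EN := (mfderiv IN 𝓘(ℝ, EN) c x₀) ∘L (mfderiv IF IN g (η z))
  -- Composing with a left inverse `L` of the derivative in a chart reduces to an equidimensional
  -- map with derivative the identity, to which the inverse function theorem applies.
  obtain ⟨L, hL⟩ := exists_continuousLinearMap_leftInverse D (hci.comp hinj)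
  have hLd : ContMDiff 𝓘(ℝ, EN) 𝓘(ℝ, EF) 1 L := L.contMDiff
  have hLc : ContMDiffAt IN 𝓘(ℝ, EF) 1 (L ∘ c) x₀ := hLd.contMDiffAt.comp x₀ hcd
  refine contMDiffAt_of_comp_eq_of_bijective (n := 1) one_ne_zero (G := (L ∘ c) ∘ g)
    (χ := (L ∘ c) ∘ χ) (hLc.comp _ hg) ?_ hη ?_ (Eventually.of_forall fun z' => ?_)
  · have h1 : mfderiv IF 𝓘(ℝ, EF) ((L ∘ c) ∘ g) (η z) = L ∘L D := by
      rw [mfderiv_comp (I' := IN) _ (hLc.mdifferentiableAt one_ne_zero)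
        (hg.mdifferentiableAt one_ne_zero),
        mfderiv_comp (I' := 𝓘(ℝ, EN)) _ (hLd.mdifferentiable one_ne_zero _)
        (hcd.mdifferentiableAt one_ne_zero), ContinuousLinearMap.mfderiv_eq]
      rfl
    rw [h1, hL]
    exact bijective_id
  · refine ContMDiffAt.comp z ?_ hχ
    rw [← heq z]
    exact hLc
  · simp only [comp_apply, heq]

omit [FiniteDimensional ℝ EN] [IF.Boundaryless] in
theorem IsC1FamilyOn.continuousWithinAt_derivInCoord {X : Type*} [TopologicalSpace X] {S : Set X}
    {U' : Set Q'} {ψ : Q' → F → N} (hψ : IsC1FamilyOn IF IN U' ψ) {a : X → Q'} {η : X → F}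
    {p₀ : X} {y₀ : F} {x₀ : N} (hp₀ : p₀ ∈ S)
    (ha : ContinuousWithinAt a S p₀) (hm : MapsTo a S U') (hη : ContinuousWithinAt η S p₀)
    (hy : η p₀ ∈ (chartAt HF y₀).source) (hx : ψ (a p₀) (η p₀) ∈ (chartAt HN x₀).source) :
    ContinuousWithinAt (fun p => derivInCoord IF IN y₀ x₀ (ψ (a p)) (η p)) S p₀ := by
  have hpair : ContinuousWithinAt (fun p => (a p, η p)) S p₀ := ha.prodMk hη
  have hψc : ContinuousWithinAt (fun p => ψ (a p) (η p)) S p₀ :=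
    ContinuousWithinAt.comp (f := fun p => (a p, η p)) (g := uncurry ψ)
      (hψ.continuousOn (a p₀, η p₀) ⟨hm hp₀, trivial⟩) hpair fun p hp => ⟨hm hp, trivial⟩
  refine ContinuousWithinAt.comp_of_preimage_mem_nhdsWithin
    (f := fun p => (a p, η p)) (g := fun r : Q' × F => derivInCoord IF IN y₀ x₀ (ψ r.1) r.2)
    (hψ.continuousOn_derivInCoord y₀ x₀ (a p₀, η p₀) ⟨hm hp₀, hy, hx⟩) hpair ?_
  filter_upwards [hη ((chartAt HF y₀).open_source.mem_nhds hy),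
    hψc ((chartAt HN x₀).open_source.mem_nhds hx), self_mem_nhdsWithin] with p hp1 hp2 hp3
  exact ⟨hm hp3, hp1, hp2⟩

/-- Continuous families of lifts of `C^1` maps through a family of `C^1` immersions are `C^1`
families. -/
theorem IsC1FamilyOn.lift {U' : Set Q'} {ψ : Q' → F → N} (hψ : IsC1FamilyOn IF IN U' ψ)
    (hinj : ∀ u ∈ U', ∀ y, Injective (mfderiv IF IN (ψ u) y))
    {a : Q → Q'} (ha : ContinuousOn a U) (hm : MapsTo a U U') {η : Q → Z → F}
    (hη : ContinuousOn (uncurry η) (U ×ˢ univ)) {χ : Q → Z → N} (hχ : IsC1FamilyOn IZ IN U χ)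
    (heq : ∀ q ∈ U, ∀ z, ψ (a q) (η q z) = χ q z) : IsC1FamilyOn IZ IF U η := by
  have hηq : ∀ q ∈ U, Continuous (η q) := fun q hq => by
    rw [← continuousOn_univ]
    exact hη.comp (f := fun z => (q, z)) (by fun_prop) fun z _ => ⟨hq, trivial⟩
  have hη1 : ∀ q ∈ U, ContMDiff IZ IF 1 (η q) := fun q hq z =>
    contMDiffAt_of_comp_eq_of_injective (hψ.1 _ (hm hq) _) (hinj _ (hm hq) _)
      (hηq q hq).continuousAt (hχ.1 q hq z) (heq q hq)
  refine ⟨hη1, ?_⟩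
  rintro ⟨q₀, p₀⟩ ⟨hq₀, -⟩
  set S : Set (Q × TangentBundle IZ Z) := U ×ˢ univ with hS
  set y₀ := η q₀ p₀.1 with hy₀
  set x₀ := χ q₀ p₀.1 with hx₀
  have hx₀' : ψ (a q₀) y₀ = x₀ := heq q₀ hq₀ _
  have hproj : Continuous (fun p : TangentBundle IZ Z => p.1) :=
    FiberBundle.continuous_proj EZ (TangentSpace IZ (M := Z))
  have hηc : ContinuousOn (fun p : Q × TangentBundle IZ Z => η p.1 p.2.1) S :=
    hη.comp (continuousOn_fst.prodMk (hproj.comp_continuousOn continuousOn_snd))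
      fun p hp => ⟨hp.1, trivial⟩
  have hχc : ContinuousOn (fun p : Q × TangentBundle IZ Z => χ p.1 p.2.1) S :=
    hχ.continuousOn.comp (continuousOn_fst.prodMk (hproj.comp_continuousOn continuousOn_snd))
      fun p hp => ⟨hp.1, trivial⟩
  have hmem : (q₀, p₀) ∈ S := ⟨hq₀, trivial⟩
  rw [FiberBundle.continuousWithinAt_totalSpace EF]
  refine ⟨hηc _ hmem, ?_⟩
  change ContinuousWithinAt (fun p : Q × TangentBundle IZ Z =>
    (trivializationAt EF (TangentSpace IF) y₀ (tangentMap IZ IF (η p.1) p.2)).2) S (q₀, p₀)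
  set eF := trivializationAt EF (TangentSpace IF (M := F)) y₀ with heF
  set eN := trivializationAt EN (TangentSpace IN (M := N)) x₀ with heN
  have hηS : ∀ᶠ p in 𝓝[S] (q₀, p₀), η p.1 p.2.1 ∈ (chartAt HF y₀).source :=
    (hηc _ hmem) (chart_source_mem_nhds HF y₀)
  have hχS : ∀ᶠ p in 𝓝[S] (q₀, p₀), χ p.1 p.2.1 ∈ (chartAt HN x₀).source :=
    (hχc _ hmem) (chart_source_mem_nhds HN x₀)
  obtain ⟨L, hL⟩ := exists_continuousLinearMap_leftInverse (derivInCoord IF IN y₀ x₀ (ψ (a q₀)) y₀)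
    (injective_derivInCoord (mem_chart_source HF y₀) (by rw [hx₀']; exact mem_chart_source HN x₀)
      (hinj _ (hm hq₀) _))
  -- In coordinates the chain rule for `ψ ∘ η = χ`, composed with `L`, reads `C · dη = L · dχ`.
  -- Since `C` is the identity at `(q₀, p₀)` and continuous there, it is invertible nearby, and `dη
  -- = C⁻¹ · L · dχ` is continuous. `Ring.inverse` is `0` off the units, but is only used on them.
  set C : Q × TangentBundle IZ Z → EF →L[ℝ] EF := fun p =>
    L ∘L (derivInCoord IF IN y₀ x₀ (ψ (a p.1)) (η p.1 p.2.1)) with hC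
  have hC0 : C (q₀, p₀) = 1 := hL
  have hCc : ContinuousWithinAt C S (q₀, p₀) := by
    refine continuousWithinAt_const.clm_comp (hψ.continuousWithinAt_derivInCoord hmem
      ((ha.comp continuousOn_fst fun p hp => hp.1) _ hmem) (fun p hp => hm hp.1) (hηc _ hmem)
      (mem_chart_source HF y₀) ?_)
    exact hx₀'.symm ▸ mem_chart_source HN x₀
  have hinv : ContinuousWithinAt (fun p => Ring.inverse (C p)) S (q₀, p₀) := by
    have := NormedRing.inverse_continuousAt (1 : (EF →L[ℝ] EF)ˣ)
    rw [Units.val_one, ← hC0] at this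
    exact ContinuousAt.comp_continuousWithinAt (f := C) this hCc
  have hunit : ∀ᶠ p in 𝓝[S] (q₀, p₀), IsUnit (C p) := by
    refine hCc (IsOpen.mem_nhds Units.isOpen ?_)
    rw [hC0]
    exact isUnit_one
  have hb : ContinuousWithinAt (fun p : Q × TangentBundle IZ Z =>
      L (eN (tangentMap IZ IN (χ p.1) p.2)).2) S (q₀, p₀) := by
    have h1 : ContinuousAt eN (tangentMap IZ IN (χ q₀) p₀) :=
      eN.continuousOn.continuousAt (eN.open_source.mem_nhds (eN.mem_source.2
        (mem_baseSet_trivializationAt_of_mem_source (mem_chart_source HN x₀))))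
    have h2 := ContinuousAt.comp_continuousWithinAt
      (f := fun p : Q × TangentBundle IZ Z => tangentMap IZ IN (χ p.1) p.2) h1 (hχ.2 _ hmem)
    exact L.continuous.continuousAt.comp_continuousWithinAt
      (continuous_snd.continuousAt.comp_continuousWithinAt h2)
  have hkey : ∀ᶠ p in 𝓝[S] (q₀, p₀), (eF (tangentMap IZ IF (η p.1) p.2)).2 =
      Ring.inverse (C p) (L (eN (tangentMap IZ IN (χ p.1) p.2)).2) := by
    filter_upwards [hηS, hχS, hunit, self_mem_nhdsWithin] with p hp1 hp2 hp3 hp4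
    have hb1 : η p.1 p.2.1 ∈ eF.baseSet := mem_baseSet_trivializationAt_of_mem_source hp1
    have hb2 : χ p.1 p.2.1 ∈ eN.baseSet := mem_baseSet_trivializationAt_of_mem_source hp2
    have hch : tangentMap IZ IN (χ p.1) p.2 =
        tangentMap IF IN (ψ (a p.1)) (tangentMap IZ IF (η p.1) p.2) := by
      have : χ p.1 = ψ (a p.1) ∘ η p.1 := funext fun z => (heq _ hp4.1 z).symm
      rw [this]
      exact tangentMap_comp_at _ (hψ.mdifferentiable (hm hp4.1) _)
        ((hη1 _ hp4.1).mdifferentiable one_ne_zero _)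
    have hCb : C p (eF (tangentMap IZ IF (η p.1) p.2)).2 =
        L (eN (tangentMap IZ IN (χ p.1) p.2)).2 := by
      have h1 : (eF (tangentMap IZ IF (η p.1) p.2)).2 =
          eF.continuousLinearMapAt ℝ (η p.1 p.2.1) (mfderiv IZ IF (η p.1) p.2.1 p.2.2) :=
        (eF.continuousLinearMapAt_apply_of_mem ℝ hb1 _).symm
      rw [h1, hC]
      simp only [derivInCoord, ContinuousLinearMap.comp_apply]
      rw [eF.symmL_continuousLinearMapAt hb1, hch]
      have hb3 : ψ (a p.1) (η p.1 p.2.1) ∈ eN.baseSet := by rw [heq _ hp4.1]; exact hb2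
      exact congrArg L (eN.continuousLinearMapAt_apply_of_mem ℝ hb3 _)
    rw [← hCb, ← mul_apply_eq_comp, Ring.inverse_mul_cancel _ hp3]
    rfl
  exact (hinv.clm_apply hb).congr_of_eventuallyEq hkey (hkey.self_of_nhdsWithin hmem)

end Coordinates

end Lifting

/-! ### Being a diffeomorphism is a `C^1`-open condition. -/

section OpenDiffeomorphisms

open Function Filter

set_option linter.unusedSectionVars false

variable {Q F N : Type*} [TopologicalSpace Q]
  {EF HF : Type*} [NormedAddCommGroup EF] [NormedSpace ℝ EF] [TopologicalSpace HF]
  {IF : ModelWithCorners ℝ EF HF}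
  [TopologicalSpace F] [ChartedSpace HF F] [IsManifold IF ∞ F]
  {EN HN : Type*} [NormedAddCommGroup EN] [NormedSpace ℝ EN] [TopologicalSpace HN]
  {IN : ModelWithCorners ℝ EN HN}
  [TopologicalSpace N] [ChartedSpace HN N] [IsManifold IN ∞ N]
  [FiniteDimensional ℝ EF] [FiniteDimensional ℝ EN] [IF.Boundaryless]

/-- Identifies `derivInCoord` with the ordinary derivative of the coordinate expression, which makes
the mean value inequality and the inverse function theorem available. -/
theorem hasFDerivAt_derivInCoord {g : F → N} {y₀ y : F} {x₀ : N}
    (hy : y ∈ (chartAt HF y₀).source) (hgy : g y ∈ (chartAt HN x₀).source)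
    (hg : MDifferentiableAt IF IN g y) :
    HasFDerivAt (fun z => extChartAt IN x₀ (g ((extChartAt IF y₀).symm z)))
      (derivInCoord IF IN y₀ x₀ g y) (extChartAt IF y₀ y) := by
  have hy' : y ∈ (extChartAt IF y₀).source := by rwa [extChartAt_source]
  have hly : (extChartAt IF y₀).symm (extChartAt IF y₀ y) = y := (extChartAt IF y₀).left_inv hy'
  have h1 : HasMFDerivAt 𝓘(ℝ, EF) IF (extChartAt IF y₀).symm (extChartAt IF y₀ y)
      ((trivializationAt EF (TangentSpace IF) y₀).symmL ℝ y) := by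
    have h2 : MDifferentiableWithinAt 𝓘(ℝ, EF) IF (extChartAt IF y₀).symm (range IF)
        (extChartAt IF y₀ y) :=
      mdifferentiableWithinAt_extChartAt_symm ((extChartAt IF y₀).map_source hy')
    have h3 := TangentBundle.symmL_trivializationAt (I := IF) hy
    have h4 := h2.hasMFDerivWithinAt
    rw [IF.range_eq_univ, hasMFDerivWithinAt_univ] at h4
    rw [IF.range_eq_univ] at h3
    have h5 : HasMFDerivAt 𝓘(ℝ, EF) IF (extChartAt IF y₀).symm (extChartAt IF y₀ y)
      (mfderiv[univ] (extChartAt IF y₀).symm (extChartAt IF y₀ y)) := h4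
    exact h3 ▸ h5
  have h6 : HasMFDerivAt IN 𝓘(ℝ, EN) (extChartAt IN x₀) (g y)
      ((trivializationAt EN (TangentSpace IN) x₀).continuousLinearMapAt ℝ (g y)) := by
    rw [TangentBundle.continuousLinearMapAt_trivializationAt hgy]
    exact (mdifferentiableAt_extChartAt hgy).hasMFDerivAt
  have h7 : HasMFDerivAt IF 𝓘(ℝ, EN) (extChartAt IN x₀ ∘ g) y
      (((trivializationAt EN (TangentSpace IN) x₀).continuousLinearMapAt ℝ (g y)) ∘L
        (mfderiv IF IN g y)) := h6.comp y hg.hasMFDerivAt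
  have h8 : HasMFDerivAt IF 𝓘(ℝ, EN) (extChartAt IN x₀ ∘ g)
      ((extChartAt IF y₀).symm (extChartAt IF y₀ y))
      ((((trivializationAt EN (TangentSpace IN) x₀).continuousLinearMapAt ℝ (g y)) ∘L
        (mfderiv IF IN g y) : EF →L[ℝ] EN)) := by
    rw [hly]; exact h7
  exact (h8.comp _ h1).hasFDerivAt

/-- Composed with a left inverse `L` of the derivative at the center, the coordinate expression has
derivative within `1/2` of the identity on a ball, for all parameters near `q₀`. By the mean value
inequality it differs from the identity by a `1/2`-Lipschitz map there, so it is injective,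
uniformly in the parameter. -/
theorem IsC1FamilyOn.eventually_injective {φ : Q → F → N} (hφ : IsC1FamilyOn IF IN univ φ)
    (q₀ : Q) (y₀ : F) (hinj : Injective (mfderiv IF IN (φ q₀) y₀)) :
    ∀ᶠ p : Q × F × F in 𝓝 (q₀, y₀, y₀), φ p.1 p.2.1 = φ p.1 p.2.2 → p.2.1 = p.2.2 := by
  set x₀ := φ q₀ y₀ with hx₀
  obtain ⟨L, hL⟩ := exists_continuousLinearMap_leftInverse (derivInCoord IF IN y₀ x₀ (φ q₀) y₀)
    (injective_derivInCoord (mem_chart_source HF y₀) (mem_chart_source HN x₀) hinj)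
  set c := extChartAt IF y₀ with hc
  set c' := extChartAt IN x₀ with hc'
  have hcont : ContinuousAt (fun p : Q × F => L ∘L derivInCoord IF IN y₀ x₀ (φ p.1) p.2)
      (q₀, y₀) := by
    rw [← continuousWithinAt_univ]
    exact continuousWithinAt_const.clm_comp (hφ.continuousWithinAt_derivInCoord (mem_univ _)
      continuousWithinAt_fst (mapsTo_univ _ _) continuousWithinAt_snd
      (mem_chart_source HF y₀) (mem_chart_source HN x₀))
  have hφc : Continuous (uncurry φ) := by
    rw [← continuousOn_univ, ← univ_prod_univ]; exact hφ.continuousOn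
  have h1 : ∀ᶠ p : Q × F in 𝓝 (q₀, y₀),
      ‖L ∘L derivInCoord IF IN y₀ x₀ (φ p.1) p.2 - .id ℝ EF‖ ≤ 1 / 2 ∧
      p.2 ∈ (chartAt HF y₀).source ∧ φ p.1 p.2 ∈ (chartAt HN x₀).source := by
    refine Eventually.and ?_ (Eventually.and ?_ ?_)
    · have := (hcont.sub_const (.id ℝ EF)).norm
      refine (Tendsto.eventually_lt_const (u := 1 / 2) ?_ this).mono fun p hp => hp.le
      change ‖L ∘L derivInCoord IF IN y₀ x₀ (φ q₀) y₀ - .id ℝ EF‖ < 1 / 2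
      rw [hL, sub_self, norm_zero]; norm_num
    · exact continuous_snd.continuousAt (chart_source_mem_nhds HF y₀)
    · exact hφc.continuousAt (x := (q₀, y₀)) (chart_source_mem_nhds HN x₀)
  rw [nhds_prod_eq] at h1
  obtain ⟨P, hP, R, hR, hPR⟩ := eventually_prod_iff.1 h1
  have hcy : ∀ᶠ z in 𝓝 (c y₀), z ∈ c.target ∧ R (c.symm z) := by
    refine Eventually.and (extChartAt_target_mem_nhds (I := IF) y₀) ?_
    have := continuousAt_extChartAt_symm (I := IF) y₀
    refine this ?_
    rw [← hc, c.left_inv (mem_extChartAt_source (I := IF) y₀)]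
    exact hR
  obtain ⟨r, hr, hball⟩ := Metric.eventually_nhds_iff_ball.1 hcy
  have hV : ∀ᶠ y in 𝓝 y₀, y ∈ c.source ∧ c y ∈ Metric.ball (c y₀) r :=
    Eventually.and (extChartAt_source_mem_nhds (I := IF) y₀)
      (continuousAt_extChartAt (I := IF) y₀ (Metric.ball_mem_nhds _ hr))
  have hVV : ∀ᶠ p : Q × F × F in 𝓝 (q₀, y₀, y₀), P p.1 ∧
      (p.2.1 ∈ c.source ∧ c p.2.1 ∈ Metric.ball (c y₀) r) ∧
      (p.2.2 ∈ c.source ∧ c p.2.2 ∈ Metric.ball (c y₀) r) := by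
    rw [nhds_prod_eq, nhds_prod_eq]
    exact hP.prod_mk (hV.prod_mk hV)
  filter_upwards [hVV] with p ⟨hp, ⟨hy1, hy2⟩, ⟨hy1', hy2'⟩⟩ heq
  have hder : ∀ z ∈ Metric.ball (c y₀) r, HasFDerivWithinAt
      (fun z => L (c' (φ p.1 (c.symm z)))) (L ∘L derivInCoord IF IN y₀ x₀ (φ p.1) (c.symm z))
      (Metric.ball (c y₀) r) z := by
    intro z hz
    obtain ⟨hzt, hzR⟩ := hball z hz
    obtain ⟨-, h3, h4⟩ := hPR hp hzR
    have h5 := hasFDerivAt_derivInCoord h3 h4 (hφ.mdifferentiable (mem_univ p.1) _)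
    rw [← hc, ← hc', c.right_inv hzt] at h5
    exact (L.hasFDerivAt.comp z h5).hasFDerivWithinAt
  have hmv := (convex_ball (c y₀) r).norm_image_sub_le_of_norm_hasFDerivWithin_le' hder
    (fun z hz => (hPR hp (hball z hz).2).1) hy2 hy2'
  have e1 : c.symm (c p.2.1) = p.2.1 := c.left_inv hy1
  have e2 : c.symm (c p.2.2) = p.2.2 := c.left_inv hy1'
  simp only [e1, e2, heq, sub_self, zero_sub, norm_neg, ContinuousLinearMap.id_apply] at hmv
  have h0 : c p.2.2 = c p.2.1 := by
    rw [← sub_eq_zero, ← norm_le_zero_iff]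
    linarith
  rw [← e1, ← e2, h0]

/-- With `L` a left inverse at `(q₀, y₀)`, the composite of `L` and the derivative is an
endomorphism near the identity, hence a unit. -/
theorem IsC1FamilyOn.eventually_injective_mfderiv {φ : Q → F → N}
    (hφ : IsC1FamilyOn IF IN univ φ)
    (q₀ : Q) (y₀ : F) (hinj : Injective (mfderiv IF IN (φ q₀) y₀)) :
    ∀ᶠ p : Q × F in 𝓝 (q₀, y₀), Injective (mfderiv IF IN (φ p.1) p.2) := by
  set x₀ := φ q₀ y₀ with hx₀
  obtain ⟨L, hL⟩ := exists_continuousLinearMap_leftInverse (derivInCoord IF IN y₀ x₀ (φ q₀) y₀)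
    (injective_derivInCoord (mem_chart_source HF y₀) (mem_chart_source HN x₀) hinj)
  have hcont : ContinuousAt (fun p : Q × F => L ∘L derivInCoord IF IN y₀ x₀ (φ p.1) p.2)
      (q₀, y₀) := by
    rw [← continuousWithinAt_univ]
    exact continuousWithinAt_const.clm_comp (hφ.continuousWithinAt_derivInCoord (mem_univ _)
      continuousWithinAt_fst (mapsTo_univ _ _) continuousWithinAt_snd
      (mem_chart_source HF y₀) (mem_chart_source HN x₀))
  have hunit : ∀ᶠ p in 𝓝 (q₀, y₀),
      IsUnit (L ∘L derivInCoord IF IN y₀ x₀ (φ p.1) p.2 : EF →L[ℝ] EF) := by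
    refine hcont (IsOpen.mem_nhds Units.isOpen ?_)
    change IsUnit (L ∘L derivInCoord IF IN y₀ x₀ (φ q₀) y₀)
    rw [hL]
    exact isUnit_one
  have hsrc : ∀ᶠ p : Q × F in 𝓝 (q₀, y₀), p.2 ∈ (chartAt HF y₀).source :=
    continuous_snd.continuousAt (chart_source_mem_nhds HF y₀)
  filter_upwards [hunit, hsrc] with p hp hp2
  have h1 : Injective (L ∘L derivInCoord IF IN y₀ x₀ (φ p.1) p.2 : EF →L[ℝ] EF) := by
    obtain ⟨u, hu⟩ := hp
    rw [← hu]
    exact (ContinuousLinearEquiv.unitsEquiv ℝ EF u).injective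
  intro v w hvw
  have hb := mem_baseSet_trivializationAt_of_mem_source (IF := IF) hp2
  set e := trivializationAt EF (TangentSpace IF (M := F)) y₀ with he
  rw [← e.symmL_continuousLinearMapAt (R := ℝ) hb v, ← e.symmL_continuousLinearMapAt (R := ℝ) hb w]
  congr 1
  apply h1
  simp only [derivInCoord, ContinuousLinearMap.comp_apply]
  rw [e.symmL_continuousLinearMapAt (R := ℝ) hb v, e.symmL_continuousLinearMapAt (R := ℝ) hb w, hvw]

theorem isOpenMap_of_injective_mfderiv {g : F → F} (hg : ContMDiff IF IF 1 g)
    (hinj : ∀ y, Injective (mfderiv IF IF g y)) : IsOpenMap g := by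
  rw [isOpenMap_iff_nhds_le]
  intro y
  set c := extChartAt IF y with hc
  set c' := extChartAt IF (g y) with hc'
  set Θ : EF → EF := fun z => c' (g (c.symm z)) with hΘ
  have hΘd : ContDiffAt ℝ 1 Θ (c y) := by
    have := (contMDiffAt_iff.1 (hg y)).2
    rw [IF.range_eq_univ, contDiffWithinAt_univ] at this
    exact this
  have hder := hasFDerivAt_derivInCoord (mem_chart_source HF y) (mem_chart_source HF (g y))
    (hg.mdifferentiable one_ne_zero y)
  have hDinj : Injective (derivInCoord IF IF y (g y) g y) :=
    injective_derivInCoord (mem_chart_source HF y) (mem_chart_source HF (g y)) (hinj y)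
  let A : EF ≃L[ℝ] EF := ContinuousLinearEquiv.ofBijective (derivInCoord IF IF y (g y) g y)
    (LinearMap.ker_eq_bot.2 hDinj)
    (LinearMap.range_eq_top.2 ((LinearMap.injective_iff_surjective
      (f := (derivInCoord IF IF y (g y) g y : EF →ₗ[ℝ] EF))).1 hDinj))
  have hA : HasFDerivAt Θ (A : EF →L[ℝ] EF) (c y) := hder
  have hmap := (hΘd.hasStrictFDerivAt' hA one_ne_zero).map_nhds_eq_of_equiv
  have hcy : c.symm (c y) = y := c.left_inv (mem_extChartAt_source (I := IF) y)
  have hΘy : Θ (c y) = c' (g y) := by simp only [hΘ, hcy]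
  have h1 : 𝓝 (g y) = map c'.symm (𝓝 (c' (g y))) := by
    have := map_extChartAt_symm_nhdsWithin_range (I := IF) (g y)
    rw [IF.range_eq_univ, nhdsWithin_univ] at this
    exact this.symm
  rw [h1, ← hΘy, ← hmap, ← map_extChartAt_nhds_of_boundaryless (I := IF) y, map_map, map_map]
  refine (map_congr ?_).le
  have h2 : ∀ᶠ z in 𝓝 y, z ∈ c.source := extChartAt_source_mem_nhds (I := IF) y
  have h3 : ∀ᶠ z in 𝓝 y, g z ∈ c'.source :=
    hg.continuous.continuousAt (extChartAt_source_mem_nhds (I := IF) (g y))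
  filter_upwards [h2, h3] with z hz hz'
  simp only [comp_apply, hΘ]
  rw [← hc, c.left_inv hz, c'.left_inv hz']

/-- Being a `C^1` diffeomorphism is an open condition in a `C^1` family of self-maps of a compact
manifold. -/
theorem IsC1FamilyOn.isOpen_bijective [CompactSpace F] [T2Space F] {φ : Q → F → F}
    (hφ : IsC1FamilyOn IF IF univ φ) :
    IsOpen {q | Bijective (φ q) ∧ ∀ y, Injective (mfderiv IF IF (φ q) y)} := by
  have hφc : Continuous (uncurry φ) := by
    rw [← continuousOn_univ, ← univ_prod_univ]; exact hφ.continuousOn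
  have : LocallyConnectedSpace HF := IF.toHomeomorph.isOpenEmbedding.locallyConnectedSpace
  have : LocallyConnectedSpace F := ChartedSpace.locallyConnectedSpace HF F
  rw [isOpen_iff_mem_nhds]
  rintro q₀ ⟨hbij, hder⟩
  have hd : ∀ᶠ q in 𝓝 q₀, ∀ y ∈ (univ : Set F), Injective (mfderiv IF IF (φ q) y) :=
    isCompact_univ.eventually_forall_of_forall_eventually fun y _ =>
      hφ.eventually_injective_mfderiv q₀ y (hder y)
  -- Compactness of `F × F`: near the diagonal the local injectivity is uniform in `q`, and away
  -- from it distinct values remain distinct.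
  have hi : ∀ᶠ q in 𝓝 q₀, ∀ p ∈ (univ : Set (F × F)), φ q p.1 = φ q p.2 → p.1 = p.2 := by
    refine isCompact_univ.eventually_forall_of_forall_eventually fun p _ => ?_
    obtain ⟨y, y'⟩ := p
    rcases eq_or_ne y y' with rfl | hne
    · exact hφ.eventually_injective q₀ y (hder y)
    · have h1 : φ q₀ y ≠ φ q₀ y' := hbij.1.ne hne
      have h2 : ContinuousAt (fun p : Q × F × F => (φ p.1 p.2.1, φ p.1 p.2.2)) (q₀, y, y') :=
        ((hφc.comp (by fun_prop : Continuous fun p : Q × F × F => (p.1, p.2.1))).prodMk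
        (hφc.comp (by fun_prop : Continuous fun p : Q × F × F => (p.1, p.2.2)))).continuousAt
      have h3 : ∀ᶠ r : F × F in 𝓝 (φ q₀ y, φ q₀ y'), r.1 ≠ r.2 :=
        (isOpen_ne_fun continuous_fst continuous_snd).mem_nhds h1
      filter_upwards [h2.eventually h3] with p hp h
      exact absurd h hp
  -- For surjectivity: the image of `φ q` is open and closed, hence a union of components. It meets
  -- every component, because `φ q y` lies in the component of `φ q₀ y` and `φ q₀` is onto.
  have hs : ∀ᶠ q in 𝓝 q₀, ∀ y ∈ (univ : Set F),
      φ q₀ y ∈ connectedComponent (φ q y) := by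
    refine isCompact_univ.eventually_forall_of_forall_eventually fun y _ => ?_
    have h1 : connectedComponent (φ q₀ y) ∈ 𝓝 (φ q₀ y) :=
      isOpen_connectedComponent.mem_nhds mem_connectedComponent
    have h2 : ∀ᶠ p : Q × F in 𝓝 (q₀, y), φ p.1 p.2 ∈ connectedComponent (φ q₀ y) :=
      hφc.continuousAt (x := (q₀, y)) h1
    have h3 : ∀ᶠ p : Q × F in 𝓝 (q₀, y), φ q₀ p.2 ∈ connectedComponent (φ q₀ y) :=
      (hφc.comp (by fun_prop : Continuous fun p : Q × F => (q₀, p.2))).continuousAt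
        (x := (q₀, y)) h1
    filter_upwards [h2, h3] with p hp2 hp3
    rw [← connectedComponent_eq hp2]
    exact hp3
  filter_upwards [hd, hi, hs] with q h1 h2 h3
  refine ⟨⟨fun y y' h => h2 (y, y') trivial h, ?_⟩, fun y => h1 y trivial⟩
  have hopen : IsOpen (range (φ q)) :=
    (isOpenMap_of_injective_mfderiv (hφ.1 q trivial) fun y => h1 y trivial).isOpen_range
  have hclosed : IsClosed (range (φ q)) :=
    (isCompact_range (hφ.1 q trivial).continuous).isClosed
  intro x
  obtain ⟨y, rfl⟩ := hbij.2 x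
  exact IsClopen.connectedComponent_subset ⟨hclosed, hopen⟩ (mem_range_self y) (h3 y trivial)

end OpenDiffeomorphisms

/-! ### Smooth neighborhood retractions by nearest points. -/

section Retraction

open Function Filter

set_option linter.unusedSectionVars false

variable {F : Type*}
  {EF HF : Type*} [NormedAddCommGroup EF] [NormedSpace ℝ EF] [TopologicalSpace HF]
  {IF : ModelWithCorners ℝ EF HF}
  [TopologicalSpace F] [ChartedSpace HF F] [IsManifold IF ∞ F]
  [FiniteDimensional ℝ EF] [IF.Boundaryless]
  {V : Type*} [NormedAddCommGroup V] [InnerProductSpace ℝ V] [FiniteDimensional ℝ V]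

/-- The criticality equation of the distance from `z` to the points `ψ x` of a parametrized
submanifold. -/
def nearestPointEq (ψ : EF → V) (p : V × EF) : V × (EF →L[ℝ] ℝ) :=
  (p.1, (innerSL ℝ (p.1 - ψ p.2)).comp (fderiv ℝ ψ p.2))

theorem contDiffAt_nearestPointEq {ψ : EF → V} {p : V × EF} (hψ : ContDiffAt ℝ ∞ ψ p.2) :
    ContDiffAt ℝ ∞ (nearestPointEq ψ) p := by
  have h2 : ContDiffAt ℝ ∞ (fun p : V × EF => ψ p.2) p := hψ.comp p contDiffAt_snd
  have h3 : ContDiffAt ℝ ∞ (fun p : V × EF => fderiv ℝ ψ p.2) p :=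
    (hψ.fderiv_right (m := ∞) (by simp)).comp p contDiffAt_snd
  refine contDiffAt_fst.prodMk (ContDiffAt.clm_comp ?_ h3)
  exact (innerSL ℝ : V →L[ℝ] V →L[ℝ] ℝ).contDiff.contDiffAt.comp p (contDiffAt_fst.sub h2)

/-- At a point of the submanifold the factor `p.1 - ψ p.2` vanishes and kills the second derivative
of `ψ`. A vector `(0, dx)` in the kernel then satisfies `‖dψ dx‖² = 0`. -/
theorem injective_fderiv_nearestPointEq {ψ : EF → V} {p : V × EF} (hψ : ContDiffAt ℝ ∞ ψ p.2)
    (hp : p.1 = ψ p.2) (hinj : Injective (fderiv ℝ ψ p.2)) :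
    Injective (fderiv ℝ (nearestPointEq ψ) p) := by
  have hd : HasFDerivAt (nearestPointEq ψ) (fderiv ℝ (nearestPointEq ψ) p) p :=
    ((contDiffAt_nearestPointEq hψ).differentiableAt (by simp)).hasFDerivAt
  rw [injective_iff_map_eq_zero]
  rintro ⟨dz, dx⟩ h0
  have h1 : dz = 0 := by
    have h2 : HasFDerivAt (fun p : V × EF => p.1)
        ((ContinuousLinearMap.fst ℝ V _).comp (fderiv ℝ (nearestPointEq ψ) p)) p := hd.fst
    have h3 := congrArg (fun L => L (dz, dx)) (h2.unique hasFDerivAt_fst)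
    simpa [h0] using h3.symm
  subst h1
  have hψd : HasFDerivAt (fun p : V × EF => ψ p.2)
      ((fderiv ℝ ψ p.2).comp (ContinuousLinearMap.snd ℝ V EF)) p :=
    (hψ.differentiableAt (by simp)).hasFDerivAt.comp p hasFDerivAt_snd
  have hψ' : DifferentiableAt ℝ (fun p : V × EF => fderiv ℝ ψ p.2 dx) p := by
    have h3 : ContDiffAt ℝ ∞ (fun p : V × EF => fderiv ℝ ψ p.2) p :=
      (hψ.fderiv_right (m := ∞) (by simp)).comp p contDiffAt_snd
    exact (h3.differentiableAt (by simp)).clm_apply (differentiableAt_const dx)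
  have h4 : HasFDerivAt (fun p : V × EF => inner ℝ (p.1 - ψ p.2) (fderiv ℝ ψ p.2 dx)) _ p :=
    (hasFDerivAt_fst.sub hψd).inner ℝ hψ'.hasFDerivAt
  have h5 : HasFDerivAt (fun p : V × EF => inner ℝ (p.1 - ψ p.2) (fderiv ℝ ψ p.2 dx))
      ((ContinuousLinearMap.apply ℝ ℝ dx).comp
        ((ContinuousLinearMap.snd ℝ V (EF →L[ℝ] ℝ)).comp (fderiv ℝ (nearestPointEq ψ) p))) p :=
    (ContinuousLinearMap.apply ℝ ℝ dx).hasFDerivAt.comp p hd.snd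
  have h6 := congrArg (fun L => L ((0 : V), dx)) (h5.unique h4)
  simp [h0, hp, fderivInnerCLM_apply] at h6
  have h7 : dx = 0 := hinj (by rw [h6, map_zero])
  rw [h7]; rfl

theorem eventually_bijective_fderiv_nearestPointEq {ψ : EF → V} {p : V × EF}
    (hψ : ContDiffAt ℝ ∞ ψ p.2) (hp : p.1 = ψ p.2) (hinj : Injective (fderiv ℝ ψ p.2)) :
    ∀ᶠ p' in 𝓝 p, Bijective (fderiv ℝ (nearestPointEq ψ) p') := by
  have hdim : Module.finrank ℝ (V × EF) = Module.finrank ℝ (V × (EF →L[ℝ] ℝ)) := by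
    rw [Module.finrank_prod, Module.finrank_prod]
    congr 1
    rw [(LinearMap.toContinuousLinearMap (𝕜 := ℝ) (E := EF) (F' := ℝ)).symm.finrank_eq]
    exact Subspace.dual_finrank_eq.symm
  have h1 := injective_fderiv_nearestPointEq hψ hp hinj
  let A : (V × EF) ≃L[ℝ] (V × (EF →L[ℝ] ℝ)) := ContinuousLinearEquiv.ofBijective
    (fderiv ℝ (nearestPointEq ψ) p) (LinearMap.ker_eq_bot.2 h1)
    (LinearMap.range_eq_top.2 ((LinearMap.injective_iff_surjective_of_finrank_eq_finrank hdim).1 h1))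
  have hA : (A : (V × EF) →L[ℝ] (V × (EF →L[ℝ] ℝ))) = fderiv ℝ (nearestPointEq ψ) p := by
    ext v <;> rfl
  have hc : ContinuousAt (fderiv ℝ (nearestPointEq ψ)) p :=
    ((contDiffAt_nearestPointEq hψ).fderiv_right (m := 0) (by simp)).continuousAt
  have h2 := hc (hA ▸ ContinuousLinearEquiv.nhds A)
  filter_upwards [h2] with p' ⟨A', hA'⟩
  rw [← hA']
  exact A'.bijective

theorem fderiv_comp_extChartAt_symm_injective {j : F → V} (hj : ContMDiff IF 𝓘(ℝ, V) ∞ j)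
    {y : F} (hinj : Injective (mfderiv IF 𝓘(ℝ, V) j y)) :
    Injective (fderiv ℝ (j ∘ (extChartAt IF y).symm) (extChartAt IF y y)) := by
  have h := ((hj y).mdifferentiableAt (by simp)).mfderiv
  rw [IF.range_eq_univ, fderivWithin_univ] at h
  exact h ▸ hinj

theorem contDiffAt_comp_extChartAt_symm {j : F → V} (hj : ContMDiff IF 𝓘(ℝ, V) ∞ j)
    {y : F} {x : EF} (hx : x ∈ (extChartAt IF y).target) :
    ContDiffAt ℝ ∞ (j ∘ (extChartAt IF y).symm) x := by
  rw [← contMDiffAt_iff_contDiffAt]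
  exact hj.contMDiffAt.comp x ((contMDiffOn_extChartAt_symm y).contMDiffAt
    ((isOpen_extChartAt_target y).mem_nhds hx))

/-- A nearest point is a critical point of the squared distance, read in a chart. -/
theorem nearestPointEq_eq_zero {j : F → V} (hj : ContMDiff IF 𝓘(ℝ, V) ∞ j) {y : F} {z : V} {y' : F}
    (hy' : y' ∈ (extChartAt IF y).source) (hmin : ∀ y'', dist z (j y') ≤ dist z (j y'')) :
    nearestPointEq (j ∘ (extChartAt IF y).symm) (z, extChartAt IF y y') = (z, 0) := by
  set c := extChartAt IF y with hc
  refine Prod.ext rfl ?_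
  ext w
  have hx : c y' ∈ c.target := c.map_source hy'
  have hd : HasFDerivAt (j ∘ c.symm) (fderiv ℝ (j ∘ c.symm) (c y')) (c y') :=
    ((contDiffAt_comp_extChartAt_symm hj hx).differentiableAt (by simp)).hasFDerivAt
  have hsub : HasFDerivAt (fun x => z - (j ∘ c.symm) x) (-fderiv ℝ (j ∘ c.symm) (c y')) (c y') :=
    hd.const_sub z
  have hin := hsub.norm_sq
  have hlm : IsLocalMin (fun x => ‖z - (j ∘ c.symm) x‖ ^ 2) (c y') := by
    refine Eventually.of_forall fun x => ?_
    have := hmin (c.symm x)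
    rw [dist_eq_norm, dist_eq_norm] at this
    simp only [comp_apply, c.left_inv hy']
    gcongr
  have h0 := congrArg (fun L => L w) (hlm.hasFDerivAt_eq_zero hin)
  simp [nearestPointEq] at h0 ⊢
  linarith

/-- A compact manifold is a smooth neighborhood retract in some Euclidean space. -/
theorem exists_smooth_retraction (IF : ModelWithCorners ℝ EF HF) [IF.Boundaryless]
    (F : Type*) [TopologicalSpace F] [ChartedSpace HF F] [IsManifold IF ∞ F]
    [CompactSpace F] [T2Space F] [Nonempty F] :
    ∃ (n : ℕ) (j : F → EuclideanSpace ℝ (Fin n)) (r : EuclideanSpace ℝ (Fin n) → F)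
      (O : Set (EuclideanSpace ℝ (Fin n))), ContMDiff IF 𝓘(ℝ, EuclideanSpace ℝ (Fin n)) ∞ j ∧
      IsOpen O ∧ (∀ y, j y ∈ O) ∧
      ContMDiffOn 𝓘(ℝ, EuclideanSpace ℝ (Fin n)) IF ∞ r O ∧ ∀ y, r (j y) = y := by
  obtain ⟨n, j, hj, hemb, hinj⟩ := exists_embedding_euclidean_of_compact (I := IF) (M := F)
  have hex : ∀ z : EuclideanSpace ℝ (Fin n), ∃ y : F, ∀ y', dist z (j y) ≤ dist z (j y') := by
    intro z
    obtain ⟨y, -, hy⟩ := isCompact_univ.exists_isMinOn (univ_nonempty (α := F))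
      (f := fun y => dist z (j y)) (continuous_const.dist hemb.continuous).continuousOn
    exact ⟨y, fun y' => hy (mem_univ y')⟩
  -- Nearest points need not be unique; `r` is an arbitrary choice, which turns out to be smooth
  -- near `j '' univ`.
  choose r hr using hex
  have hrj : ∀ y, r (j y) = y := fun y => by
    have := hr (j y) y
    rw [dist_self, dist_le_zero] at this
    exact (hemb.injective this).symm
  -- As `j (r z)` is at least as close to `z` as `j y` is, its distance to `j y` is at most `2 *
  -- dist z (j y)`.
  have hrc : ∀ y, ContinuousAt r (j y) := by
    intro y
    rw [ContinuousAt, hrj, hemb.isInducing.nhds_eq_comap, tendsto_comap_iff,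
      tendsto_iff_dist_tendsto_zero]
    refine squeeze_zero (g := fun z => 2 * dist z (j y)) (fun _ => dist_nonneg) (fun z => ?_) ?_
    · have h1 := hr z y
      have h2 := dist_triangle_left (j (r z)) (j y) z
      simp only [comp_apply]
      linarith
    · have : Tendsto (fun z => 2 * dist z (j y)) (𝓝 (j y)) (𝓝 (2 * dist (j y) (j y))) :=
        (continuous_const.mul (continuous_id.dist continuous_const)).tendsto _
      simpa using this
  -- Where `r` is continuous, `z ↦ (z, c (r z))` solves `nearestPointEq = (z, 0)` continuously, so
  -- it is smooth where the derivative of the equation is bijective.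
  have hat : ∀ y₀ : F, ∀ z : EuclideanSpace ℝ (Fin n), ∀ m : WithTop ℕ∞, m ≠ 0 → m ≤ (∞ : WithTop ℕ∞) →
      r z ∈ (extChartAt IF y₀).source → ContinuousAt r z →
      Bijective (fderiv ℝ (nearestPointEq (j ∘ (extChartAt IF y₀).symm))
        (z, extChartAt IF y₀ (r z))) →
      ContMDiffAt 𝓘(ℝ, EuclideanSpace ℝ (Fin n)) IF m r z := by
    intro y₀ z m hm0 hm hsrc hcont hbij
    set c := extChartAt IF y₀ with hc
    set ψ := j ∘ c.symm with hψ
    have hcc : ContinuousAt (fun z' => c (r z')) z :=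
      ContinuousAt.comp (f := r) (continuousAt_extChartAt' hsrc) hcont
    have hd : ContDiffAt ℝ m (nearestPointEq ψ) (z, c (r z)) :=
      (contDiffAt_nearestPointEq
        (contDiffAt_comp_extChartAt_symm hj (c.map_source hsrc))).of_le hm
    have hsrc' : ∀ᶠ z' in 𝓝 z, r z' ∈ c.source := hcont (extChartAt_source_mem_nhds' hsrc)
    have h1 : ContMDiffAt 𝓘(ℝ, EuclideanSpace ℝ (Fin n)) 𝓘(ℝ, EuclideanSpace ℝ (Fin n) × EF) m
        (fun z' => (z', c (r z'))) z := by
      refine contMDiffAt_of_comp_eq_of_bijective (F := EuclideanSpace ℝ (Fin n) × EF) hm0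
        (G := nearestPointEq ψ) (χ := fun z' => (z', 0)) hd.contMDiffAt ?_ ?_ ?_ ?_
      · rw [mfderiv_eq_fderiv]; exact hbij
      · exact continuousAt_id.prodMk hcc
      · exact (contDiffAt_id.prodMk contDiffAt_const).contMDiffAt
      · filter_upwards [hsrc'] with z' hz'
        exact nearestPointEq_eq_zero hj hz' (hr z')
    have h2 : ContMDiffAt 𝓘(ℝ, EuclideanSpace ℝ (Fin n)) 𝓘(ℝ, EF) m (fun z' => c (r z')) z :=
      (contDiffAt_snd.comp z h1.contDiffAt).contMDiffAt
    have h3 : ContMDiffAt 𝓘(ℝ, EuclideanSpace ℝ (Fin n)) IF m (fun z' => c.symm (c (r z'))) z :=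
      (((contMDiffOn_extChartAt_symm y₀).contMDiffAt ((isOpen_extChartAt_target y₀).mem_nhds
        (c.map_source hsrc))).of_le hm).comp z h2
    refine h3.congr_of_eventuallyEq ?_
    filter_upwards [hsrc'] with z' hz'
    rw [c.left_inv hz']
  have hnear : ∀ y₀ : F, ∀ᶠ z in 𝓝 (j y₀),
      ContMDiffAt 𝓘(ℝ, EuclideanSpace ℝ (Fin n)) IF ∞ r z := by
    intro y₀
    set c := extChartAt IF y₀ with hc
    have hsrc : r (j y₀) ∈ c.source := by rw [hrj]; exact mem_extChartAt_source y₀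
    have hcc : ContinuousAt (fun z => (z, c (r z))) (j y₀) :=
      continuousAt_id.prodMk (ContinuousAt.comp (f := r) (continuousAt_extChartAt' hsrc) (hrc y₀))
    have hbij : ∀ᶠ z in 𝓝 (j y₀), Bijective (fderiv ℝ (nearestPointEq (j ∘ c.symm))
        (z, c (r z))) := by
      refine hcc.eventually (eventually_bijective_fderiv_nearestPointEq
        (contDiffAt_comp_extChartAt_symm hj (c.map_source hsrc)) ?_ ?_)
      · rw [comp_apply, c.left_inv hsrc, hrj]
      · simp only [hrj]
        exact fderiv_comp_extChartAt_symm_injective hj (hinj y₀)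
    -- Continuity of `r` is so far known only on the submanifold. Order `1` is used first because
    -- being `C^1` at a point spreads to a neighborhood, which being `C^∞` at a point need not do;
    -- continuity nearby then permits order `∞` at each nearby point.
    have h1 := hat y₀ (j y₀) 1 one_ne_zero (by simp) hsrc (hrc y₀) hbij.self_of_nhds
    have hc1 : ∀ᶠ z in 𝓝 (j y₀), ContinuousAt r z :=
      ((contMDiffAt_iff_contMDiffAt_nhds (by simp)).1 h1).mono fun z hz => hz.continuousAt
    filter_upwards [hc1, hbij, (hrc y₀) (extChartAt_source_mem_nhds' hsrc)] with z hz1 hz2 hz3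
    exact hat y₀ z ∞ (by simp) le_rfl hz3 hz1 hz2
  refine ⟨n, j, r, interior {z | ContMDiffAt 𝓘(ℝ, EuclideanSpace ℝ (Fin n)) IF ∞ r z}, hj,
    isOpen_interior, fun y => mem_interior_iff_mem_nhds.2 (hnear y), fun z hz => ?_, hrj⟩
  exact ContMDiffAt.contMDiffWithinAt (interior_subset hz)

end Retraction

/-! ### Smooth approximation in the `C^1` topology. -/

section Approximation

open Function Filter MeasureTheory

/-- Compactly supported `C^1` functions are limits of smooth functions in the `C^1` topology. -/
theorem exists_contDiff_approx_fderiv {V W : Type*} [NormedAddCommGroup V] [NormedSpace ℝ V]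
    [FiniteDimensional ℝ V] [NormedAddCommGroup W] [NormedSpace ℝ W] [CompleteSpace W]
    {S : V → W} (hS : ContDiff ℝ 1 S) (hc : HasCompactSupport S) {ε : ℝ} (hε : 0 < ε) :
    ∃ S' : V → W, ContDiff ℝ ∞ S' ∧
      ∀ x, ‖S' x - S x‖ ≤ ε ∧ ‖fderiv ℝ S' x - fderiv ℝ S x‖ ≤ ε := by
  borelize V
  let μ : Measure V := Measure.addHaar
  have hS' : Continuous (fderiv ℝ S) := hS.continuous_fderiv one_ne_zero
  have hc' : HasCompactSupport (fderiv ℝ S) := hc.fderiv ℝ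
  obtain ⟨δ₁, hδ₁, h₁⟩ := Metric.uniformContinuous_iff.1
    (hc.uniformContinuous_of_continuous hS.continuous) ε hε
  obtain ⟨δ₂, hδ₂, h₂⟩ := Metric.uniformContinuous_iff.1
    (hc'.uniformContinuous_of_continuous hS') ε hε
  -- Convolution with a normalized bump of radius `min δ₁ δ₂` moves `S` and, as differentiation
  -- falls on `S`, also `fderiv ℝ S`, by no more than their oscillation at that scale.
  let φ : ContDiffBump (0 : V) := ⟨min δ₁ δ₂ / 2, min δ₁ δ₂, by positivity, by
    have : 0 < min δ₁ δ₂ := by positivity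
    linarith⟩
  have hφ : Continuous (φ.normed μ) := φ.continuous_normed
  have hφl : LocallyIntegrable (φ.normed μ) μ := hφ.locallyIntegrable
  have hder : ∀ x, fderiv ℝ (convolution (φ.normed μ) S (ContinuousLinearMap.lsmul ℝ ℝ) μ) x =
      convolution (φ.normed μ) (fderiv ℝ S) (ContinuousLinearMap.lsmul ℝ ℝ) μ x := by
    intro x
    have := (hc.hasFDerivAt_convolution_right (ContinuousLinearMap.lsmul ℝ ℝ) hφl hS x).fderiv
    rw [this]
    congr 1
  refine ⟨convolution (φ.normed μ) S (ContinuousLinearMap.lsmul ℝ ℝ) μ, ?_, fun x => ⟨?_, ?_⟩⟩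
  · exact φ.hasCompactSupport_normed.contDiff_convolution_left _ φ.contDiff_normed
      hS.continuous.locallyIntegrable
  · rw [← dist_eq_norm]
    refine φ.dist_normed_convolution_le hS.continuous.aestronglyMeasurable fun y hy => ?_
    exact (h₁ (lt_of_lt_of_le hy (min_le_left _ _))).le
  · rw [← dist_eq_norm, hder]
    refine φ.dist_normed_convolution_le hS'.aestronglyMeasurable fun y hy => ?_
    exact (h₂ (lt_of_lt_of_le hy (min_le_right _ _))).le

/-! ### Jets of maps from a submanifold of a vector space. -/

section Jets

set_option linter.unusedSectionVars false

variable {Q F : Type*} [TopologicalSpace Q]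
  {EF HF : Type*} [NormedAddCommGroup EF] [NormedSpace ℝ EF] [TopologicalSpace HF]
  {IF : ModelWithCorners ℝ EF HF}
  [TopologicalSpace F] [ChartedSpace HF F]
  {V : Type*} [NormedAddCommGroup V] [NormedSpace ℝ V]

variable (IF) in
/-- `r` is a smooth retraction of the open set `O` to the submanifold `j : F → V`. -/
structure IsSmoothRetraction (j : F → V) (r : V → F) (O : Set V) : Prop where
  contMDiff_embed : ContMDiff IF 𝓘(ℝ, V) ∞ j
  isOpen : IsOpen O
  embed_mem : ∀ y, j y ∈ O
  contMDiffOn_retract : ContMDiffOn 𝓘(ℝ, V) IF ∞ r O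
  retract_embed : ∀ y, r (j y) = y

variable (IF) in
/-- `w` is the `1`-jet of `s : F → V`, where derivatives are computed for the extension of `s` by
means of the retraction `r`. -/
def IsJet (j : F → V) (r : V → F) (w : C(F, V × (V →L[ℝ] V))) (s : F → V) : Prop :=
  ContMDiff IF 𝓘(ℝ, V) 1 s ∧ ∀ y, w y = (s y, fderiv ℝ (s ∘ r) (j y))

variable {j : F → V} {r : V → F} {O : Set V} {w w' : C(F, V × (V →L[ℝ] V))} {s s' : F → V}

theorem IsSmoothRetraction.contMDiffAt_retract (h : IsSmoothRetraction IF j r O) (y : F) :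
    ContMDiffAt 𝓘(ℝ, V) IF ∞ r (j y) :=
  h.contMDiffOn_retract.contMDiffAt (h.isOpen.mem_nhds (h.embed_mem y))

theorem IsSmoothRetraction.contDiffAt_comp {n : WithTop ℕ∞} (h : IsSmoothRetraction IF j r O)
    (hn : n ≤ (∞ : WithTop ℕ∞)) (hs : ContMDiff IF 𝓘(ℝ, V) n s) {z : V} (hz : z ∈ O) :
    ContDiffAt ℝ n (s ∘ r) z := by
  rw [← contMDiffAt_iff_contDiffAt]
  exact hs.contMDiffAt.comp z
    ((h.contMDiffOn_retract.contMDiffAt (h.isOpen.mem_nhds hz)).of_le hn)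

theorem IsSmoothRetraction.differentiableAt_comp (h : IsSmoothRetraction IF j r O)
    (hs : ContMDiff IF 𝓘(ℝ, V) 1 s) (y : F) : DifferentiableAt ℝ (s ∘ r) (j y) :=
  (h.contDiffAt_comp (by simp) hs (h.embed_mem y)).differentiableAt one_ne_zero

theorem IsJet.add (h : IsSmoothRetraction IF j r O) (hw : IsJet IF j r w s)
    (hw' : IsJet IF j r w' s') : IsJet IF j r (w + w') (fun y => s y + s' y) := by
  refine ⟨hw.1.add hw'.1, fun y => ?_⟩
  rw [ContinuousMap.add_apply, hw.2, hw'.2]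
  refine Prod.ext rfl ?_
  exact (fderiv_add (h.differentiableAt_comp hw.1 y) (h.differentiableAt_comp hw'.1 y)).symm

theorem IsJet.smul (h : IsSmoothRetraction IF j r O) (c : ℝ) (hw : IsJet IF j r w s) :
    IsJet IF j r (c • w) (fun y => c • s y) := by
  refine ⟨(contMDiff_const : ContMDiff IF 𝓘(ℝ, ℝ) 1 fun _ : F => c).smul hw.1, fun y => ?_⟩
  rw [ContinuousMap.smul_apply, hw.2]
  refine Prod.ext rfl ?_
  exact (fderiv_const_smul (h.differentiableAt_comp hw.1 y) c).symm

theorem isJet_zero : IsJet IF j r 0 (fun _ => 0) := by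
  refine ⟨contMDiff_const, fun y => Prod.ext rfl ?_⟩
  exact (fderiv_const_apply (𝕜 := ℝ) (x := j y) (0 : V)).symm

theorem IsJet.sum (h : IsSmoothRetraction IF j r O) {ι : Type*} (T : Finset ι) (c : ι → ℝ)
    {w : ι → C(F, V × (V →L[ℝ] V))} {s : ι → F → V} (hw : ∀ i, IsJet IF j r (w i) (s i)) :
    IsJet IF j r (∑ i ∈ T, c i • w i) (fun y => ∑ i ∈ T, c i • s i y) := by
  classical
  induction T using Finset.induction_on with
  | empty => simpa using isJet_zero
  | insert i T hi ih =>
    simp only [Finset.sum_insert hi]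
    exact ((hw i).smul h (c i)).add h ih

variable [IsManifold IF ∞ F] [FiniteDimensional ℝ V]

/-- The derivative of `t q ∘ r` at `j y` along `v` is the tangent map of `t q` applied to `dr v`.
Since `V` is finite-dimensional, continuity may be tested on each `v`. -/
theorem IsC1FamilyOn.continuousOn_fderiv_retract (h : IsSmoothRetraction IF j r O) {U : Set Q}
    {t : Q → F → V} (ht : IsC1FamilyOn IF 𝓘(ℝ, V) U t) :
    ContinuousOn (fun p : Q × F => (t p.1 p.2, fderiv ℝ (t p.1 ∘ r) (j p.2))) (U ×ˢ univ) := by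
  refine ht.continuousOn.prodMk (continuousOn_clm_apply.2 fun v => ?_)
  have hr := h.contMDiffOn_retract.continuousOn_tangentMapWithin (by simp) h.isOpen.uniqueMDiffOn
  have hj : Continuous (fun p : Q × F => ((tangentBundleModelSpaceHomeomorph 𝓘(ℝ, V)).symm
      ((j p.2, v) : V × V) : TangentBundle 𝓘(ℝ, V) V)) :=
    (tangentBundleModelSpaceHomeomorph 𝓘(ℝ, V)).symm.continuous.comp
      ((h.contMDiff_embed.continuous.comp continuous_snd).prodMk continuous_const)
  have h1 := hr.comp hj.continuousOn (s := U ×ˢ univ) fun p _ => h.embed_mem p.2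
  have h2 := (continuousOn_tangentBundle_model_iff.1 (ht.2.comp (continuousOn_fst.prodMk h1)
    fun p hp => ⟨hp.1, trivial⟩)).2
  refine h2.congr ?_
  rintro ⟨q, y⟩ ⟨hq, -⟩
  have h3 : MDifferentiableAt 𝓘(ℝ, V) IF r (j y) :=
    (h.contMDiffAt_retract y).mdifferentiableAt (by simp)
  have h4 := mfderiv_comp (j y) ((ht.mdifferentiable hq) (r (j y))) h3
  rw [mfderiv_eq_fderiv] at h4
  change fderiv ℝ (t q ∘ r) (j y) v =
    mfderiv IF 𝓘(ℝ, V) (t q) (r (j y)) (mfderivWithin 𝓘(ℝ, V) IF r O (j y) v)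
  rw [mfderivWithin_eq_mfderiv (h.isOpen.uniqueMDiffOn _ (h.embed_mem y)) h3, h4]
  rfl

theorem exists_isJet (h : IsSmoothRetraction IF j r O) (hs : ContMDiff IF 𝓘(ℝ, V) 1 s) :
    ∃ w, IsJet IF j r w s := by
  have h1 := (isC1FamilyOn_const (Q := Unit) (U := univ) hs).continuousOn_fderiv_retract h
  refine ⟨⟨fun y => (s y, fderiv ℝ (s ∘ r) (j y)), ?_⟩, hs, fun y => rfl⟩
  rw [univ_prod_univ, continuousOn_univ] at h1
  exact h1.comp (by fun_prop : Continuous fun y : F => ((), y))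

/-- A `C^1` family is a continuous curve of jets in the compact-open topology, by currying. This
turns `C^1` approximation into approximation in a normed space of continuous maps. -/
theorem IsC1FamilyOn.exists_isJet (h : IsSmoothRetraction IF j r O) {U : Set Q}
    {t : Q → F → V} (ht : IsC1FamilyOn IF 𝓘(ℝ, V) U t) :
    ∃ J : Q → C(F, V × (V →L[ℝ] V)), ContinuousOn J U ∧ ∀ q ∈ U, IsJet IF j r (J q) (t q) := by
  classical
  have hex : ∀ q : Q, ∃ w, q ∈ U → IsJet IF j r w (t q) := fun q => by
    by_cases hq : q ∈ U
    · obtain ⟨w, hw⟩ := _root_.exists_isJet h (ht.1 q hq)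
      exact ⟨w, fun _ => hw⟩
    · exact ⟨0, fun h => absurd h hq⟩
  choose J hJ using hex
  refine ⟨J, ?_, fun q hq => hJ q hq⟩
  rw [continuousOn_iff_continuous_domRestrict]
  refine ContinuousMap.continuous_of_continuous_uncurry _ ?_
  have h1 := (ht.continuousOn_fderiv_retract h).comp_continuous
    (f := fun p : U × F => ((p.1 : Q), p.2)) (by fun_prop) (fun p => ⟨p.1.2, trivial⟩)
  refine h1.congr fun p => ?_
  exact ((hJ p.1 p.1.2).2 p.2).symm

/-- The tautological family of maps, parametrized by their jets. -/
theorem isC1FamilyOn_jet [LocallyCompactSpace F] (h : IsSmoothRetraction IF j r O) :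
    IsC1FamilyOn IF 𝓘(ℝ, V) {w | ∃ s, IsJet IF j r w s} (fun w y => (w y).1) := by
  have hfst : ∀ {w : C(F, V × (V →L[ℝ] V))} {s : F → V}, IsJet IF j r w s →
      (fun y => (w y).1) = s := fun hw => funext fun y => by rw [hw.2]
  have heval : Continuous (fun p : C(F, V × (V →L[ℝ] V)) × F => p.1 p.2) := continuous_eval
  rw [isC1FamilyOn_model_iff]
  refine ⟨?_, ?_, ?_⟩
  · rintro w ⟨s, hs⟩
    rw [hfst hs]; exact hs.1
  · exact (continuous_fst.comp heval).continuousOn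
  · have hj : Continuous (fun p : TangentBundle IF F => (mfderiv IF 𝓘(ℝ, V) j p.1 p.2 : V)) := by
      have h1 := h.contMDiff_embed.continuous_tangentMap (by simp)
      exact continuousOn_univ.1 (continuousOn_tangentBundle_model_iff.1 (continuousOn_univ.2 h1)).2
    have h2 : Continuous (fun p : C(F, V × (V →L[ℝ] V)) × TangentBundle IF F => (p.1 p.2.1).2) :=
      continuous_snd.comp (heval.comp (continuous_fst.prodMk
        ((FiberBundle.continuous_proj EF (TangentSpace IF (M := F))).comp continuous_snd)))
    refine (h2.clm_apply (hj.comp continuous_snd)).continuousOn.congr ?_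
    rintro ⟨w, p⟩ ⟨⟨s, hs⟩, -⟩
    -- Hence `ds = d(s ∘ r) · dj`, so the second component of a jet, composed with `dj`, recovers
    -- the derivative of the map.
    have h3 : s = (s ∘ r) ∘ j := funext fun y => by simp only [comp_apply, h.retract_embed]
    have h4 := mfderiv_comp (I' := 𝓘(ℝ, V)) p.1
      (h.differentiableAt_comp hs.1 p.1).mdifferentiableAt
      (h.contMDiff_embed.mdifferentiable (by simp) p.1)
    rw [← h3, mfderiv_eq_fderiv] at h4
    change mfderiv IF 𝓘(ℝ, V) (fun y => (w y).1) p.1 p.2 = (w p.1).2 (mfderiv IF 𝓘(ℝ, V) j p.1 p.2)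
    rw [hfst hs, h4, hs.2]
    rfl

/-- The map extends to the compactly supported `C^1` map `χ • (s ∘ r)` of the vector space, which
has smooth `C^1` approximations; restrict one of these to the submanifold. -/
theorem IsJet.exists_contMDiff_near [CompactSpace F] (h : IsSmoothRetraction IF j r O)
    (hw : IsJet IF j r w s) {δ : ℝ} (hδ : 0 < δ) :
    ∃ s' w', ContMDiff IF 𝓘(ℝ, V) ∞ s' ∧ IsJet IF j r w' s' ∧ dist w' w < δ := by
  obtain ⟨wj, hwj⟩ := exists_isJet h (h.contMDiff_embed.of_le (by simp))
  have hK : IsCompact (range j) := isCompact_range h.contMDiff_embed.continuous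
  obtain ⟨K', hK', hKK', hK'O⟩ := exists_compact_between hK h.isOpen (range_subset_iff.2 h.embed_mem)
  obtain ⟨χ, hχ1, hχ0, -⟩ := exists_contMDiffMap_one_nhds_of_subset_interior (n := (⊤ : ℕ∞)) 𝓘(ℝ, V)
    hK.isClosed hKK'
  have hχc : ContDiff ℝ ∞ χ := χ.contMDiff.contDiff
  have hsupp : tsupport χ ⊆ K' := by
    refine closure_minimal (fun x hx => ?_) hK'.isClosed
    by_contra hxK
    exact hx (hχ0 x hxK)
  let S : V → V := fun x => χ x • s (r x)
  have hS0 : ∀ x, x ∉ tsupport χ → S =ᶠ[𝓝 x] 0 := fun x hx => by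
    filter_upwards [notMem_tsupport_iff_eventuallyEq.1 hx] with z hz
    simp [S, hz]
  have hSc : ContDiff ℝ 1 S := by
    refine contDiff_iff_contDiffAt.2 fun x => ?_
    by_cases hx : x ∈ tsupport χ
    · exact (hχc.of_le (by simp)).contDiffAt.smul
        (h.contDiffAt_comp (by simp) hw.1 (hK'O (hsupp hx)))
    · exact (contDiffAt_const (c := (0 : V))).congr_of_eventuallyEq (hS0 x hx)
  have hScs : HasCompactSupport S := HasCompactSupport.intro hK' fun x hx => by
    simp [S, hχ0 x hx]
  -- The derivative part of the jet of `T ∘ j` is `dT` composed with `d(j ∘ r)`, whose norm is at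
  -- most `‖wj‖`. An error `ε` in the vector space thus costs at most `ε * (1 + ‖wj‖) = δ / 2` in
  -- the jets.
  have hε : 0 < δ / 2 / (1 + ‖wj‖) := by positivity
  obtain ⟨S', hS', hS'S⟩ := exists_contDiff_approx_fderiv hSc hScs hε
  have hs' : ContMDiff IF 𝓘(ℝ, V) ∞ (S' ∘ j) := hS'.contMDiff.comp h.contMDiff_embed
  obtain ⟨w', hw'⟩ := exists_isJet h (hs'.of_le (by simp))
  refine ⟨S' ∘ j, w', hs', hw', lt_of_le_of_lt ?_ (half_lt_self hδ)⟩
  have hχj : ∀ y, χ (j y) = 1 := fun y => (hχ1.self_of_nhdsSet (j y) ⟨y, rfl⟩)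
  have hsj : s = S ∘ j := funext fun y => by simp [S, hχj, h.retract_embed]
  have hcomp : ∀ T : V → V, Differentiable ℝ T → ∀ y,
      fderiv ℝ ((T ∘ j) ∘ r) (j y) = (fderiv ℝ T (j y)).comp (wj y).2 := fun T hT y => by
    have h1 := fderiv_comp (j y) (g := T) (f := j ∘ r) (hT _)
      (h.differentiableAt_comp hwj.1 y)
    have h2 : (j ∘ r) (j y) = j y := by simp [h.retract_embed]
    rw [h2] at h1
    rw [hwj.2 y]
    exact h1
  refine (ContinuousMap.dist_le (by positivity)).2 fun y => ?_
  have hwy : w y = (S (j y), (fderiv ℝ S (j y)).comp (wj y).2) := by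
    rw [hw.2 y, ← hcomp S (hSc.differentiable one_ne_zero) y, ← hsj]
    exact Prod.ext (congrFun hsj y) rfl
  have hwy' : w' y = (S' (j y), (fderiv ℝ S' (j y)).comp (wj y).2) := by
    rw [hw'.2 y, ← hcomp S' (hS'.differentiable (by simp)) y]
    rfl
  have hle : δ / 2 / (1 + ‖wj‖) * (1 + ‖wj‖) = δ / 2 := by field_simp
  rw [hwy, hwy', dist_eq_norm, Prod.mk_sub_mk, Prod.norm_mk, ← ContinuousLinearMap.sub_comp]
  refine max_le ?_ ?_
  · rw [← hle]
    refine (hS'S (j y)).1.trans (le_mul_of_one_le_right hε.le ?_)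
    linarith [norm_nonneg wj]
  · rw [← hle]
    refine (ContinuousLinearMap.opNorm_comp_le _ _).trans ?_
    refine mul_le_mul (hS'S (j y)).2 ?_ (norm_nonneg _) hε.le
    have := (norm_snd_le (wj y)).trans (wj.norm_coe_le_norm y)
    linarith

end Jets

end Approximation

/-! ### Smoothing families of diffeomorphisms. -/

section Smoothing

open Function Filter

set_option linter.unusedSectionVars false

variable {Q F N Z : Type*} [TopologicalSpace Q]
  {EF HF : Type*} [NormedAddCommGroup EF] [NormedSpace ℝ EF] [TopologicalSpace HF]
  {IF : ModelWithCorners ℝ EF HF}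
  [TopologicalSpace F] [ChartedSpace HF F] [IsManifold IF ∞ F]
  {EN HN : Type*} [NormedAddCommGroup EN] [NormedSpace ℝ EN] [TopologicalSpace HN]
  {IN : ModelWithCorners ℝ EN HN}
  [TopologicalSpace N] [ChartedSpace HN N] [IsManifold IN ∞ N]
  {EZ HZ : Type*} [NormedAddCommGroup EZ] [NormedSpace ℝ EZ] [TopologicalSpace HZ]
  {IZ : ModelWithCorners ℝ EZ HZ}
  [TopologicalSpace Z] [ChartedSpace HZ Z] [IsManifold IZ ∞ Z]

theorem IsC1FamilyOn.contMDiffOn_comp {U : Set Q} {φ : Q → F → N} (hφ : IsC1FamilyOn IF IN U φ)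
    {O : Set N} (hO : IsOpen O) {g : N → Z} (hg : ContMDiffOn IN IZ 1 g O)
    (hmem : ∀ q ∈ U, ∀ y, φ q y ∈ O) : IsC1FamilyOn IF IZ U (fun q y => g (φ q y)) := by
  have hat : ∀ q ∈ U, ∀ y, ContMDiffAt IN IZ 1 g (φ q y) := fun q hq y =>
    hg.contMDiffAt (hO.mem_nhds (hmem q hq y))
  refine ⟨fun q hq y => (hat q hq y).comp y (hφ.1 q hq y), ?_⟩
  have h1 := (hg.continuousOn_tangentMapWithin le_rfl hO.uniqueMDiffOn).comp hφ.2
    fun p hp => hmem p.1 hp.1 p.2.1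
  refine h1.congr ?_
  rintro ⟨q, p⟩ ⟨hq, -⟩
  have h2 := (hat q hq p.1).mdifferentiableAt one_ne_zero
  refine (tangentMap_comp_at p h2 ((hφ.mdifferentiable hq) _)).trans ?_
  exact (tangentMapWithin_eq_tangentMap (hO.uniqueMDiffOn _ (hmem q hq p.1)) h2).symm

variable (IF) in
/-- A family of `C^1` diffeomorphisms of `F` that depends continuously on the parameter in the `C^1`
sense. -/
def IsC1DiffeoFamilyOn (U : Set Q) (t : Q → F → F) : Prop :=
  IsC1FamilyOn IF IF U t ∧
    ∀ q ∈ U, Bijective (t q) ∧ ∀ y, Injective (mfderiv IF IF (t q) y)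

/-- Jets with values in `O` parametrize a `C^1` family of self-maps of `F`, the retraction of the
tautological one, and `IsC1FamilyOn.isOpen_bijective` applies to it. Only the trace of `W` on
genuine jets has a meaning. -/
theorem isOpen_setOf_isJet_diffeo {V : Type*} [NormedAddCommGroup V] [NormedSpace ℝ V]
    [FiniteDimensional ℝ V] [FiniteDimensional ℝ EF] [IF.Boundaryless] [CompactSpace F] [T2Space F]
    {j : F → V} {r : V → F} {O : Set V} (h : IsSmoothRetraction IF j r O) :
    ∃ W : Set C(F, V × (V →L[ℝ] V)), IsOpen W ∧ ∀ w s, IsJet IF j r w s →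
      (w ∈ W ↔ (∀ y, s y ∈ O) ∧ Bijective (r ∘ s) ∧
        ∀ y, Injective (mfderiv IF IF (r ∘ s) y)) := by
  let X : Set C(F, V × (V →L[ℝ] V)) := {w | (∃ s, IsJet IF j r w s) ∧ ∀ y, (w y).1 ∈ O}
  have hO' : IsOpen {w : C(F, V × (V →L[ℝ] V)) | MapsTo w univ (Prod.fst ⁻¹' O)} :=
    ContinuousMap.isOpen_setOfPred_mapsTo isCompact_univ (h.isOpen.preimage continuous_fst)
  have h1 : IsC1FamilyOn IF IF (univ : Set X) (fun w y => r ((w.1 y).1)) :=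
    IsC1FamilyOn.contMDiffOn_comp ((isC1FamilyOn_jet h).reparam continuous_subtype_val.continuousOn
      fun w _ => w.2.1) h.isOpen (h.contMDiffOn_retract.of_le (by simp)) fun w _ y => w.2.2 y
  obtain ⟨W, hW, hWX⟩ := isOpen_induced_iff.1 h1.isOpen_bijective
  refine ⟨W ∩ {w | MapsTo w univ (Prod.fst ⁻¹' O)}, hW.inter hO', fun w s hw => ?_⟩
  have hs : ∀ y, (w y).1 = s y := fun y => by rw [hw.2]
  have hs' : (fun y => r ((w y).1)) = r ∘ s := funext fun y => by rw [hs]; rfl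
  have hX : (∀ y, s y ∈ O) → (w ∈ W ↔ Bijective (r ∘ s) ∧
      ∀ y, Injective (mfderiv IF IF (r ∘ s) y)) := fun hsO => by
    have := Set.ext_iff.1 hWX ⟨w, ⟨s, hw⟩, fun y => by rw [hs]; exact hsO y⟩
    rw [← hs']
    exact this
  have hm : MapsTo w univ (Prod.fst ⁻¹' O) ↔ ∀ y, s y ∈ O :=
    ⟨fun hm y => hs y ▸ hm (mem_univ y), fun hm y _ => by
      change (w y).1 ∈ O
      rw [hs]; exact hm y⟩
  constructor
  · rintro ⟨hwW, hwO⟩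
    exact ⟨hm.1 hwO, (hX (hm.1 hwO)).1 hwW⟩
  · rintro ⟨hsO, hb⟩
    exact ⟨(hX hsO).2 hb, hm.2 hsO⟩

/-- Smooth convex combinations approximate a continuous map to a normed space. -/
theorem exists_smooth_convex_approx {Y : Type*} [NormedAddCommGroup Y] [NormedSpace ℝ Y]
    {EB HB : Type*} [NormedAddCommGroup EB] [NormedSpace ℝ EB] [FiniteDimensional ℝ EB]
    [TopologicalSpace HB] {IB : ModelWithCorners ℝ EB HB} [ChartedSpace HB Q] [IsManifold IB ∞ Q]
    [CompactSpace Q] [T2Space Q] {U : Set Q} (hU : IsOpen U)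
    {J : Q → Y} (hJ : ContinuousOn J U) {W : Set Y} (hW : IsOpen W) (hJW : ∀ q ∈ U, J q ∈ W)
    {P : Y → Prop} (hP : ∀ q ∈ U, ∀ δ > 0, ∃ w, P w ∧ dist w (J q) < δ)
    {ρ : Q → ℝ} (hρI : ∀ q, ρ q ∈ Icc (0 : ℝ) 1) (hρU : tsupport ρ ⊆ U) :
    ∃ (T : Finset (tsupport ρ)) (χ : T → Q → ℝ) (w : T → Y),
      (∀ i, ContMDiff IB 𝓘(ℝ, ℝ) ∞ (χ i)) ∧ (∀ i, P (w i)) ∧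
      ∀ q ∈ U, (1 - ρ q) • J q + ρ q • ∑ i, χ i q • w i ∈ W := by
  classical
  have hD : IsCompact (tsupport ρ) := (isClosed_tsupport ρ).isCompact
  -- A uniform radius: `W` contains the `δ`-balls around all values of `J` on the compact support of
  -- `ρ`, and balls are convex.
  obtain ⟨δ, hδ, hδW⟩ := (hD.image_of_continuousOn (hJ.mono hρU)).exists_thickening_subset_open hW
    (image_subset_iff.2 fun q hq => hJW q (hρU hq))
  choose w hw hwd using fun p : tsupport ρ => hP p (hρU p.2) δ hδ
  let N : tsupport ρ → Set Q := fun p => U ∩ J ⁻¹' Metric.ball (w p) δ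
  have hN : ∀ p, IsOpen (N p) := fun p => hJ.isOpen_inter_preimage hU Metric.isOpen_ball
  obtain ⟨T, hT⟩ := hD.elim_finite_subcover N hN fun p hp =>
    mem_iUnion.2 ⟨⟨p, hp⟩, hρU hp, by
      rw [mem_preimage, Metric.mem_ball, dist_comm]; exact hwd ⟨p, hp⟩⟩
  obtain ⟨χ, hχ⟩ := SmoothPartitionOfUnity.exists_isSubordinate IB (isClosed_tsupport ρ)
    (fun p : T => N p) (fun p => hN p) (by
      intro p hp
      obtain ⟨i, hi, hpi⟩ := mem_iUnion₂.1 (hT hp)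
      exact mem_iUnion.2 ⟨⟨i, hi⟩, hpi⟩)
  refine ⟨T, fun p => χ p, fun p => w p, fun p => (χ p).contMDiff, fun p => hw p,
    fun q hq => ?_⟩
  by_cases hq0 : ρ q = 0
  · rw [hq0, sub_zero, one_smul, zero_smul, add_zero]; exact hJW q hq
  have hqD : q ∈ tsupport ρ := subset_tsupport ρ hq0
  have hball : Metric.ball (J q) δ ⊆ W :=
    (Metric.ball_subset_thickening (mem_image_of_mem J hqD) δ).trans hδW
  refine hball ((convex_ball (J q) δ) (Metric.mem_ball_self hδ) ?_ (by linarith [(hρI q).2])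
    (hρI q).1 (by ring))
  have hsum : ∑ p : T, χ p q = 1 := by
    rw [← finsum_eq_sum_of_fintype]; exact χ.sum_eq_one hqD
  -- Only the `w p` with nonzero weight at `q` are known to lie near `J q`.
  have hwσ : ∑ p : T, χ p q • w p = ∑ p : T with χ p q ≠ 0, χ p q • w p := by
    rw [Finset.sum_filter_of_ne]
    intro p _ hp h0
    exact hp (by rw [h0, zero_smul])
  rw [hwσ]
  refine (convex_ball (J q) δ).sum_mem (fun p _ => χ.nonneg p q) ?_ fun p hp => ?_
  · rw [← hsum, Finset.sum_filter_of_ne fun p _ hp => hp]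
  · have : q ∈ N p := hχ p (subset_tsupport _ (Finset.mem_filter.1 hp).2)
    rw [Metric.mem_ball, dist_comm]
    exact this.2

set_option synthInstance.maxHeartbeats 200000 in
-- The new family is `r ∘ ((1 - ρ) • (j ∘ t) + ρ • σ)`, where `σ` is a combination, with smooth
-- weights in the parameter, of smooth maps that are `C^1`-close to `j ∘ t`. Its jets before
-- retraction stay in the open set of jets of diffeomorphisms. It is `t` where `ρ = 0`, smooth near
-- the points where `ρ = 1` locally, and smooth wherever `t` is because everything else in the
-- formula is smooth.
theorem IsC1DiffeoFamilyOn.exists_smoothing_of_retraction {V : Type*} [NormedAddCommGroup V]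
    [NormedSpace ℝ V] [FiniteDimensional ℝ V] {j : F → V} {r : V → F} {O : Set V}
    (h : IsSmoothRetraction IF j r O) [FiniteDimensional ℝ EF] [IF.Boundaryless]
    [CompactSpace F] [T2Space F]
    {EB HB : Type*} [NormedAddCommGroup EB] [NormedSpace ℝ EB] [FiniteDimensional ℝ EB]
    [TopologicalSpace HB] {IB : ModelWithCorners ℝ EB HB} [ChartedSpace HB Q] [IsManifold IB ∞ Q]
    [CompactSpace Q] [T2Space Q] {U : Set Q} (hU : IsOpen U)
    {t : Q → F → F} (ht : IsC1DiffeoFamilyOn IF U t) {ρ : Q → ℝ} (hρ : ContMDiff IB 𝓘(ℝ, ℝ) ∞ ρ)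
    (hρI : ∀ q, ρ q ∈ Icc (0 : ℝ) 1) (hρU : tsupport ρ ⊆ U) :
    ∃ t' : Q → F → F, IsC1DiffeoFamilyOn IF U t' ∧ (∀ q ∈ U, ρ q = 0 → t' q = t q) ∧
      (∀ q ∈ U, ∀ y, ContMDiffAt (IB.prod IF) IF ∞ (uncurry t) (q, y) →
        ContMDiffAt (IB.prod IF) IF ∞ (uncurry t') (q, y)) ∧
      ∀ q ∈ U, ρ =ᶠ[𝓝 q] 1 → ∀ y, ContMDiffAt (IB.prod IF) IF ∞ (uncurry t') (q, y) := by
  classical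
  obtain ⟨hj, hO, hjO, hr, hrj⟩ := id h
  obtain ⟨W, hW, hWiff⟩ := isOpen_setOf_isJet_diffeo h
  have hjt : IsC1FamilyOn IF 𝓘(ℝ, V) U (fun q y => j (t q y)) :=
    ht.1.const_comp (hj.of_le (by simp))
  obtain ⟨J, hJc, hJ⟩ := hjt.exists_isJet h
  have hrjt : ∀ q, r ∘ (fun y => j (t q y)) = t q := fun q => funext fun y => hrj _
  have hJW : ∀ q ∈ U, J q ∈ W := fun q hq =>
    (hWiff _ _ (hJ q hq)).2 ⟨fun y => hjO _, by rw [hrjt]; exact ht.2 q hq⟩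
  obtain ⟨T, χ, w, hχ, hwP, hcW⟩ := exists_smooth_convex_approx (IB := IB) hU hJc hW hJW
    (P := fun w => ∃ s, ContMDiff IF 𝓘(ℝ, V) ∞ s ∧ IsJet IF j r w s)
    (fun q hq δ hδ => by
      obtain ⟨s, w, hs, hw, hd⟩ := (hJ q hq).exists_contMDiff_near h hδ
      exact ⟨w, ⟨s, hs, hw⟩, hd⟩) hρI hρU
  choose s hs hw using hwP
  let σ : Q → F → V := fun q y => ∑ p, χ p q • s p y
  let c : Q → F → V := fun q y => (1 - ρ q) • j (t q y) + ρ q • σ q y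
  let wσ : Q → C(F, V × (V →L[ℝ]
    V)) := fun q => ∑ p, χ p q • w p
  have hσ : ∀ q, IsJet IF j r (wσ q) (σ q) := fun q =>
    IsJet.sum h _ (fun p => χ p q) fun p => hw p
  have hσs : ∀ q y, ContMDiffAt (IB.prod IF) 𝓘(ℝ, V) ∞ (uncurry σ) (q, y) := by
    intro q y
    have : ContMDiff (IB.prod IF) 𝓘(ℝ, V) ∞
        (fun x : Q × F => ∑ p, χ p x.1 • s p x.2) :=
      contMDiff_finsetSum fun p _ =>
        ((hχ p).comp contMDiff_fst).smul ((hs p).comp contMDiff_snd)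
    exact this (q, y)
  have hσ1 : IsC1FamilyOn IF 𝓘(ℝ, V) U σ :=
    isC1FamilyOn_of_contMDiffOn hU fun x _ =>
      ((hσs x.1 x.2).of_le (by simp)).contMDiffWithinAt
  have hc1 : IsC1FamilyOn IF 𝓘(ℝ, V) U c :=
    (hjt.smul (continuous_const.sub hρ.continuous).continuousOn).add
      (hσ1.smul hρ.continuous.continuousOn)
  have hcjet : ∀ q ∈ U, IsJet IF j r ((1 - ρ q) • J q + ρ q • wσ q) (c q) := fun q hq =>
    ((hJ q hq).smul h _).add h ((hσ q).smul h _)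
  have hcO := fun q hq => (hWiff _ _ (hcjet q hq)).1 (hcW q hq)
  have hrc : ∀ q ∈ U, ∀ y, ContMDiffAt (IB.prod IF) 𝓘(ℝ, V) ∞ (uncurry c) (q, y)
      → ContMDiffAt (IB.prod IF) IF ∞ (uncurry fun q y => r (c q y)) (q, y) := fun q hq y hcq =>
    (h.contMDiffOn_retract.contMDiffAt (hO.mem_nhds ((hcO q hq).1 y))).comp (q, y) hcq
  have hρ' : ∀ x : Q × F, ContMDiffAt (IB.prod IF) 𝓘(ℝ, ℝ) ∞ (fun x : Q × F => ρ x.1) x := fun x =>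
    (hρ.comp contMDiff_fst) x
  refine ⟨fun q y => r (c q y), ⟨hc1.contMDiffOn_comp hO (hr.of_le (by simp)) fun q hq =>
    (hcO q hq).1, fun q hq => (hcO q hq).2⟩, fun q hq hq0 => ?_, fun q hq y hty => ?_,
    fun q hq hq1 y => ?_⟩
  · funext y
    simp [c, hq0, hrj]
  · refine hrc q hq y ?_
    have h1 : ContMDiffAt (IB.prod IF) 𝓘(ℝ, V) ∞
        (fun x : Q × F => j (t x.1 x.2)) (q, y) := (hj _).comp (q, y) hty
    exact ((contMDiffAt_const.sub (hρ' _)).smul h1).add ((hρ' _).smul (hσs q y))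
  · refine hrc q hq y ((hσs q y).congr_of_eventuallyEq ?_)
    have : ∀ᶠ x : Q × F in 𝓝 (q, y), ρ x.1 = 1 :=
      (continuous_fst.tendsto (q, y)).eventually hq1
    filter_upwards [this] with x hx
    simp [c, uncurry, hx]

/-- A continuous family of `C^1` diffeomorphisms of a closed manifold can be smoothed where `ρ = 1`,
without changing it where `ρ = 0` and keeping it smooth where it is. -/
theorem IsC1DiffeoFamilyOn.exists_smoothing [FiniteDimensional ℝ EF] [IF.Boundaryless]
    [CompactSpace F] [T2Space F]
    {EB HB : Type*} [NormedAddCommGroup EB] [NormedSpace ℝ EB] [FiniteDimensional ℝ EB]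
    [TopologicalSpace HB] {IB : ModelWithCorners ℝ EB HB} [ChartedSpace HB Q] [IsManifold IB ∞ Q]
    [CompactSpace Q] [T2Space Q] {U : Set Q} (hU : IsOpen U)
    {t : Q → F → F} (ht : IsC1DiffeoFamilyOn IF U t) {ρ : Q → ℝ} (hρ : ContMDiff IB 𝓘(ℝ, ℝ) ∞ ρ)
    (hρI : ∀ q, ρ q ∈ Icc (0 : ℝ) 1) (hρU : tsupport ρ ⊆ U) :
    ∃ t' : Q → F → F, IsC1DiffeoFamilyOn IF U t' ∧ (∀ q ∈ U, ρ q = 0 → t' q = t q) ∧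
      (∀ q ∈ U, ∀ y, ContMDiffAt (IB.prod IF) IF ∞ (uncurry t) (q, y) →
        ContMDiffAt (IB.prod IF) IF ∞ (uncurry t') (q, y)) ∧
      ∀ q ∈ U, ρ =ᶠ[𝓝 q] 1 → ∀ y, ContMDiffAt (IB.prod IF) IF ∞ (uncurry t') (q, y) := by
  rcases isEmpty_or_nonempty F with hF | hF
  · exact ⟨t, ht, fun _ _ _ => rfl, fun _ _ y => isEmptyElim y, fun _ _ _ y => isEmptyElim y⟩
  obtain ⟨n, j, r, O, hj, hO, hjO, hr, hrj⟩ := exists_smooth_retraction IF F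
  exact exists_smoothing_of_retraction ⟨hj, hO, hjO, hr, hrj⟩ hU ht hρ hρI hρU

end Smoothing

/-! ### Local trivializations and their reparametrization. -/

section TrivializationBasics

open Function Filter

variable {B F M : Type*} [TopologicalSpace B] [TopologicalSpace F] [TopologicalSpace M]
  {proj : M → B} {u : B}

theorem apply_fiberParam (e : Trivialization F proj) (hu : u ∈ e.baseSet) (y : F) :
    e (fiberParam e u y) = (u, y) :=
  e.apply_symm_apply' hu

theorem proj_fiberParam (e : Trivialization F proj) (hu : u ∈ e.baseSet) (y : F) :
    proj (fiberParam e u y) = u :=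
  e.proj_symm_apply' hu

theorem fiberParam_mem_source (e : Trivialization F proj) (hu : u ∈ e.baseSet) (y : F) :
    fiberParam e u y ∈ e.source :=
  e.map_target (e.mem_target.2 hu)

theorem fiberParam_proj (e : Trivialization F proj) {x : M} (hx : proj x ∈ e.baseSet) :
    fiberParam e (proj x) (e x).2 = x :=
  e.symm_apply_mk_proj (e.mem_source.2 hx)

theorem fiberParam_of_proj_eq (e : Trivialization F proj) {x : M} (hu : u ∈ e.baseSet)
    (hx : proj x = u) : fiberParam e u (e x).2 = x := by
  subst hx; exact fiberParam_proj e hu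

theorem continuousOn_fiberParam (e : Trivialization F proj) :
    ContinuousOn (uncurry (fiberParam e)) (e.baseSet ×ˢ univ) :=
  e.toOpenPartialHomeomorph.continuousOn_symm.mono fun _ hp => e.mem_target.2 hp.1

theorem fiberParam_coordChange (e e' : Trivialization F proj) (hu : u ∈ e.baseSet)
    (hu' : u ∈ e'.baseSet) (y : F) :
    fiberParam e' u (e.coordChange e' u y) = fiberParam e u y :=
  fiberParam_of_proj_eq e' hu' (proj_fiberParam e hu y)

theorem continuousOn_uncurry_coordChange (e e' : Trivialization F proj) :
    ContinuousOn (uncurry (e.coordChange e')) ((e.baseSet ∩ e'.baseSet) ×ˢ univ) := by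
  refine continuous_snd.comp_continuousOn (e'.toOpenPartialHomeomorph.continuousOn.comp
    ((continuousOn_fiberParam e).mono fun p hp => ⟨hp.1.1, trivial⟩) fun p hp => ?_)
  exact e'.mem_source.2 ((proj_fiberParam e hp.1.1 p.2).symm ▸ hp.1.2)

theorem bijective_coordChange (e e' : Trivialization F proj) (hu : u ∈ e.baseSet)
    (hu' : u ∈ e'.baseSet) : Bijective (e.coordChange e' u) :=
  (e.coordChangeHomeomorph e' hu hu').bijective

/-- Inverses of a continuous family of homeomorphisms of a compact space form a continuous
family. -/
theorem continuousOn_uncurry_of_inverse {Q : Type*} [TopologicalSpace Q] [CompactSpace F] [T2Space F]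
    {U : Set Q} {α β : Q → F → F} (hα : ContinuousOn (uncurry α) (U ×ˢ univ))
    (h₁ : ∀ q ∈ U, LeftInverse (β q) (α q)) (h₂ : ∀ q ∈ U, RightInverse (β q) (α q)) :
    ContinuousOn (uncurry β) (U ×ˢ univ) := by
  rintro ⟨q₀, z₀⟩ ⟨hq₀, -⟩
  -- `F` being compact, it suffices to identify cluster points `y'` of `β` at `(q₀, z₀)`. Passing to
  -- the limit in `α q (β q z) = z` along an ultrafilter gives `α q₀ y' = z₀`.
  refine tendsto_nhds_of_unique_mapClusterPt fun y' hy' => ?_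
  obtain ⟨𝒰, h𝒰, hlim⟩ := mapClusterPt_iff_ultrafilter.1 hy'
  have hq : Tendsto Prod.fst (𝒰 : Filter (Q × F)) (𝓝 q₀) :=
    (continuous_fst.tendsto (q₀, z₀)).mono_left (h𝒰.trans nhdsWithin_le_nhds)
  have hz : Tendsto Prod.snd (𝒰 : Filter (Q × F)) (𝓝 z₀) :=
    (continuous_snd.tendsto (q₀, z₀)).mono_left (h𝒰.trans nhdsWithin_le_nhds)
  have hU : ∀ᶠ p : Q × F in 𝒰, p.1 ∈ U :=
    (h𝒰 self_mem_nhdsWithin : U ×ˢ univ ∈ (𝒰 : Filter (Q × F))) |> fun h =>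
      mem_of_superset h fun p hp => hp.1
  have h3 : Tendsto (fun p : Q × F => (p.1, β p.1 p.2)) 𝒰 (𝓝[U ×ˢ univ] (q₀, y')) :=
    tendsto_nhdsWithin_iff.2 ⟨hq.prodMk_nhds hlim, hU.mono fun p hp => ⟨hp, trivial⟩⟩
  have h4 : Tendsto (fun p : Q × F => p.2) 𝒰 (𝓝 (α q₀ y')) := by
    refine Tendsto.congr' ?_ ((hα (q₀, y') ⟨hq₀, trivial⟩).tendsto.comp h3)
    filter_upwards [hU] with p hp
    exact h₂ _ hp p.2
  have h5 : α q₀ y' = z₀ := tendsto_nhds_unique h4 hz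
  change y' = β q₀ z₀
  rw [← h5, h₁ q₀ hq₀]

/-- Reparametrization of the fibers of a local trivialization. -/
theorem exists_trivialization_twist [CompactSpace F] [T2Space F] (e : Trivialization F proj)
    {α : B → F → F} (hα : ContinuousOn (uncurry α) (e.baseSet ×ˢ univ))
    (hbij : ∀ u ∈ e.baseSet, Bijective (α u)) :
    ∃ e' : Trivialization F proj, e'.baseSet = e.baseSet ∧
      ∀ u ∈ e.baseSet, ∀ y, fiberParam e' u y = fiberParam e u (α u y) := by
  classical
  have hex : ∀ u, ∃ β : F → F, u ∈ e.baseSet → LeftInverse β (α u) ∧ RightInverse β (α u) := by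
    intro u
    by_cases hu : u ∈ e.baseSet
    · obtain ⟨β, h1, h2⟩ := bijective_iff_has_inverse.1 (hbij u hu)
      exact ⟨β, fun _ => ⟨h1, h2⟩⟩
    · exact ⟨id, fun h => absurd h hu⟩
  choose β hβ using hex
  have hβc : ContinuousOn (uncurry β) (e.baseSet ×ˢ univ) :=
    continuousOn_uncurry_of_inverse hα (fun u hu => (hβ u hu).1) fun u hu => (hβ u hu).2
  refine ⟨{
    toFun := fun x => (proj x, β (proj x) (e x).2)
    invFun := fun p => fiberParam e p.1 (α p.1 p.2)
    source := e.source
    target := e.target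
    map_source' := fun x hx => e.mem_target.2 (e.mem_source.1 hx)
    map_target' := fun p hp => fiberParam_mem_source e (e.mem_target.1 hp) _
    left_inv' := fun x hx => by
      have hx' := e.mem_source.1 hx
      change fiberParam e (proj x) (α (proj x) (β (proj x) (e x).2)) = x
      rw [(hβ _ hx').2, fiberParam_proj e hx']
    right_inv' := fun p hp => by
      have hp' := e.mem_target.1 hp
      refine Prod.ext (proj_fiberParam e hp' _) ?_
      change β (proj (fiberParam e p.1 (α p.1 p.2))) (e (fiberParam e p.1 (α p.1 p.2))).2 = p.2
      rw [proj_fiberParam e hp', apply_fiberParam e hp', (hβ _ hp').1]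
    open_source := e.open_source
    open_target := e.open_target
    continuousOn_toFun := by
      refine e.continuousOn_proj.prodMk ?_
      exact hβc.comp (f := fun x => (proj x, (e x).2)) (e.continuousOn_proj.prodMk
        (continuous_snd.comp_continuousOn e.toOpenPartialHomeomorph.continuousOn))
        fun x hx => ⟨e.mem_source.1 hx, trivial⟩
    continuousOn_invFun := by
      have h1 : ContinuousOn (fun p : B × F => (p.1, α p.1 p.2)) (e.baseSet ×ˢ univ) :=
        continuousOn_fst.prodMk hα
      rw [e.target_eq]
      exact (continuousOn_fiberParam e).comp h1 fun p hp => ⟨hp.1, trivial⟩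
    baseSet := e.baseSet
    open_baseSet := e.open_baseSet
    source_eq := e.source_eq
    target_eq := e.target_eq
    proj_toFun := fun _ _ => rfl }, rfl, fun u _ y => rfl⟩

end TrivializationBasics

/-! ### Coordinate changes: `C^1` along fibers, and jointly smooth. -/

section SmoothTransitions

open Function Filter

set_option linter.unusedSectionVars false

variable {B F M : Type*} [TopologicalSpace B]
  {EF HF : Type*} [NormedAddCommGroup EF] [NormedSpace ℝ EF] [FiniteDimensional ℝ EF]
  [TopologicalSpace HF]
  {IF : ModelWithCorners ℝ EF HF} [IF.Boundaryless]
  [TopologicalSpace F] [ChartedSpace HF F] [IsManifold IF ∞ F]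
  {EM HM : Type*} [NormedAddCommGroup EM] [NormedSpace ℝ EM] [FiniteDimensional ℝ EM]
  [TopologicalSpace HM]
  {IM : ModelWithCorners ℝ EM HM}
  [TopologicalSpace M] [ChartedSpace HM M] [IsManifold IM ∞ M]
  {EB HB : Type*} [NormedAddCommGroup EB] [NormedSpace ℝ EB] [FiniteDimensional ℝ EB]
  [TopologicalSpace HB]
  {IB : ModelWithCorners ℝ EB HB} [IB.Boundaryless] [ChartedSpace HB B] [IsManifold IB ∞ B]
  {proj : M → B} {e e' e'' : Trivialization F proj} {u : B}

theorem injective_mfderiv_of_comp {N : Type*} {EN HN : Type*} [NormedAddCommGroup EN]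
    [NormedSpace ℝ EN] [TopologicalSpace HN] {IN : ModelWithCorners ℝ EN HN} [TopologicalSpace N]
    [ChartedSpace HN N] {g : F → N} {η : F → F} {y : F}
    (hg : MDifferentiableAt IF IN g (η y)) (hη : MDifferentiableAt IF IF η y)
    (hinj : Injective (mfderiv IF IN (g ∘ η) y)) : Injective (mfderiv IF IF η y) := by
  have h1 := mfderiv_comp y hg hη
  rw [h1] at hinj
  exact Injective.of_comp hinj

/-- A coordinate change is the continuous lift of `fiberParam e u` through the immersion `fiberParam
e' u`. Its derivative is injective since the composite is an immersion. -/
theorem IsC1Trivialization.coordChange (he : IsC1Trivialization IF IM e)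
    (he' : IsC1Trivialization IF IM e') :
    IsC1DiffeoFamilyOn IF (e.baseSet ∩ e'.baseSet) (e.coordChange e') := by
  have h1 : IsC1FamilyOn IF IF (e.baseSet ∩ e'.baseSet) (e.coordChange e') :=
    he'.1.lift he'.2 (a := id) continuousOn_id (fun u hu => hu.2)
      (continuousOn_uncurry_coordChange e e') (he.1.mono inter_subset_left)
      fun u hu y => fiberParam_coordChange e e' hu.1 hu.2 y
  refine ⟨h1, fun u hu => ⟨bijective_coordChange e e' hu.1 hu.2, fun y => ?_⟩⟩
  refine injective_mfderiv_of_comp (g := fiberParam e' u) (he'.1.mdifferentiable hu.2 _)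
    (h1.mdifferentiable hu _) ?_
  rw [show fiberParam e' u ∘ e.coordChange e' u = fiberParam e u from
    funext fun y => fiberParam_coordChange e e' hu.1 hu.2 y]
  exact he.2 u hu.1 y

theorem IsC1DiffeoFamilyOn.comp {Q : Type*} [TopologicalSpace Q] {U : Set Q} {s t : Q → F → F}
    (hs : IsC1DiffeoFamilyOn IF U s) (ht : IsC1DiffeoFamilyOn IF U t) :
    IsC1DiffeoFamilyOn IF U (fun q y => s q (t q y)) := by
  refine ⟨hs.1.comp continuousOn_id (mapsTo_id U) ht.1, fun q hq =>
    ⟨(hs.2 q hq).1.comp (ht.2 q hq).1, fun y => ?_⟩⟩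
  have h1 := mfderiv_comp y (hs.1.mdifferentiable hq (t q y)) (ht.1.mdifferentiable hq y)
  change Injective (mfderiv IF IF (s q ∘ t q) y)
  rw [h1]
  exact ((hs.2 q hq).2 _).comp ((ht.2 q hq).2 y)

theorem IsC1Trivialization.of_twist (he : IsC1Trivialization IF IM e) {α : B → F → F}
    (hα : IsC1DiffeoFamilyOn IF e.baseSet α) (hbase : e'.baseSet = e.baseSet)
    (heq : ∀ u ∈ e.baseSet, ∀ y, fiberParam e' u y = fiberParam e u (α u y)) :
    IsC1Trivialization IF IM e' := by
  have heq' : ∀ u ∈ e.baseSet, fiberParam e' u = fiberParam e u ∘ α u := fun u hu =>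
    funext (heq u hu)
  have h1 : IsC1FamilyOn IF IM e.baseSet (fun u y => fiberParam e u (α u y)) :=
    he.1.comp continuousOn_id (mapsTo_id _) hα.1
  refine ⟨hbase ▸ h1.congr heq', fun u hu y => ?_⟩
  rw [hbase] at hu
  have h2 := mfderiv_comp y (he.1.mdifferentiable hu (α u y)) (hα.1.mdifferentiable hu y)
  rw [heq' u hu, h2]
  exact (he.2 u hu _).comp ((hα.2 u hu).2 y)

variable (IF IB) in
/-- The coordinate change between two local trivializations is smooth near the fiber over `u`. -/
def SmoothTransitionAt (e e' : Trivialization F proj) (u : B) : Prop :=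
  ∀ y, ContMDiffAt (IB.prod IF) IF ∞ (uncurry (e.coordChange e')) (u, y)

theorem SmoothTransitionAt.congr_left (h : SmoothTransitionAt IF IB e e'' u)
    (heq : ∀ᶠ v in 𝓝 u, ∀ y, fiberParam e' v y = fiberParam e v y) :
    SmoothTransitionAt IF IB e' e'' u := fun y => by
  refine (h y).congr_of_eventuallyEq ?_
  filter_upwards [(continuous_fst.tendsto (u, y)).eventually heq] with p hp
  exact congrArg (fun x => (e'' x).2) (hp p.2)

theorem smoothTransitionAt_refl (hu : u ∈ e.baseSet) : SmoothTransitionAt IF IB e e u := fun y => by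
  refine (contMDiffAt_snd : ContMDiffAt (IB.prod IF) IF ∞ Prod.snd (u, y)).congr_of_eventuallyEq ?_
  filter_upwards [(continuous_fst.tendsto (u, y)).eventually (e.open_baseSet.mem_nhds hu)] with p hp
  exact e.coordChange_same_apply hp p.2

theorem SmoothTransitionAt.trans (h : SmoothTransitionAt IF IB e e' u)
    (h' : SmoothTransitionAt IF IB e' e'' u) (hu : u ∈ e.baseSet) (hu' : u ∈ e'.baseSet) :
    SmoothTransitionAt IF IB e e'' u := fun y => by
  have h1 : ContMDiffAt (IB.prod IF) (IB.prod IF) ∞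
      (fun p : B × F => (p.1, e.coordChange e' p.1 p.2)) (u, y) :=
    contMDiffAt_fst.prodMk (h y)
  refine (ContMDiffAt.comp (u, y) (h' _) h1).congr_of_eventuallyEq ?_
  filter_upwards [(continuous_fst.tendsto (u, y)).eventually (e.open_baseSet.mem_nhds hu),
    (continuous_fst.tendsto (u, y)).eventually (e'.open_baseSet.mem_nhds hu')] with p hp hp'
  exact (e.coordChange_coordChange e' e'' hp hp' p.2).symm

/-- The inverse function theorem for the fibered map `(v, z) ↦ (v, t v z)`. Its derivative is block
triangular, so injectivity along the fiber suffices. -/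
theorem contMDiffAt_uncurry_of_inverse {t t' : B → F → F} {y : F}
    (ht : ContMDiffAt (IB.prod IF) IF ∞ (uncurry t) (u, t' u y))
    (hinj : Injective (mfderiv IF IF (t u) (t' u y)))
    (ht' : ContinuousAt (uncurry t') (u, y)) (heq : ∀ᶠ v in 𝓝 u, ∀ z, t v (t' v z) = z) :
    ContMDiffAt (IB.prod IF) IF ∞ (uncurry t') (u, y) := by
  set T : B × F → B × F := fun p => (p.1, t p.1 p.2) with hT
  set η : B × F → B × F := fun p => (p.1, t' p.1 p.2) with hη
  set p₀ : B × F := η (u, y) with hp₀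
  have hTp : T p₀ = (u, y) := Prod.ext rfl (heq.self_of_nhds y)
  have hT1 : ContMDiffAt (IB.prod IF) (IB.prod IF) ∞ T p₀ := contMDiffAt_fst.prodMk ht
  -- The chart serves to obtain a map into a vector space, as `contMDiffAt_of_comp_eq_of_bijective`
  -- requires.
  let c := extChartAt (IB.prod IF) (u, y)
  have hc : ContMDiffAt (IB.prod IF) 𝓘(ℝ, EB × EF) ∞ c (u, y) := contMDiffAt_extChartAt
  have hbij : Bijective (mfderiv (IB.prod IF) 𝓘(ℝ, EB × EF) (c ∘ T) p₀) := by
    have h1 := mfderiv_comp p₀ (hTp ▸ hc.mdifferentiableAt (by simp))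
      (hT1.mdifferentiableAt (by simp)) (I' := IB.prod IF) (g := c)
    have hinjT : Injective (mfderiv (IB.prod IF) (IB.prod IF) T p₀) := by
      rw [injective_iff_map_eq_zero]
      rintro v hv
      have hd : MDifferentiableAt (IB.prod IF) IF (uncurry t) p₀ := ht.mdifferentiableAt (by simp)
      have h2 := mfderiv_prodMk (I := IB.prod IF) (I' := IB) (I'' := IF) (x := p₀)
        (mdifferentiableAt_fst) hd
      have h3 : mfderiv (IB.prod IF) (IB.prod IF) T p₀ v =
        (mfderiv (IB.prod IF) IB Prod.fst p₀ v, mfderiv (IB.prod IF) IF (uncurry t) p₀ v) :=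
        congrArg (fun L => L v) h2
      rw [h3, mfderiv_fst] at hv
      have hv1 : v.1 = 0 := congrArg Prod.fst hv
      have hv2 : mfderiv (IB.prod IF) IF (uncurry t) p₀ v = 0 := congrArg Prod.snd hv
      have h4 : mfderiv IF IF (t u) (t' u y) v.2 = 0 := by
        refine Eq.trans ?_ ((mfderiv_prod_eq_add_apply hd).symm.trans hv2)
        have h5 : mfderiv IB IF (fun z => uncurry t (z, p₀.2)) p₀.1 v.1 = 0 :=
          (congrArg _ hv1).trans (map_zero _)
        exact (zero_add _).symm.trans (congrArg (· + _) h5.symm)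
      have hv3 : v.2 = 0 := (injective_iff_map_eq_zero _).1 hinj _ h4
      exact Prod.ext hv1 hv3
    have hinjc : Injective (mfderiv (IB.prod IF) 𝓘(ℝ, EB × EF) c (T p₀)) := by
      rw [hTp]
      obtain ⟨L, hL⟩ := isInvertible_mfderiv_extChartAt (I := IB.prod IF)
        (mem_extChartAt_source (I := IB.prod IF) (u, y))
      change Injective (mfderiv (IB.prod IF) 𝓘(ℝ, EB × EF) (extChartAt (IB.prod IF) (u, y)) (u, y))
      rw [← hL]
      exact L.injective
    have hinjcT : Injective (mfderiv (IB.prod IF) 𝓘(ℝ, EB × EF) (c ∘ T) p₀) := by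
      rw [h1]
      exact hinjc.comp hinjT
    let L : (EB × EF) →L[ℝ] (EB × EF) := mfderiv (IB.prod IF) 𝓘(ℝ, EB × EF) (c ∘ T) p₀
    exact ⟨hinjcT, (LinearMap.injective_iff_surjective (f := L.toLinearMap)).1 hinjcT⟩
  have hηc : ContinuousAt η (u, y) := continuousAt_fst.prodMk ht'
  have h6 : ContMDiffAt (IB.prod IF) (IB.prod IF) ∞ η (u, y) := by
    refine contMDiffAt_of_comp_eq_of_bijective (n := ∞) (by simp) (G := c ∘ T) (χ := c)
      (ContMDiffAt.comp p₀ (hTp ▸ hc) hT1) hbij hηc hc ?_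
    filter_upwards [(continuous_fst.tendsto (u, y)).eventually heq] with p hp
    exact congrArg c (Prod.ext rfl (hp p.2))
  exact contMDiffAt_snd.comp (u, y) h6

theorem SmoothTransitionAt.symm (h : SmoothTransitionAt IF IB e e' u)
    (he : IsC1Trivialization IF IM e) (he' : IsC1Trivialization IF IM e') (hu : u ∈ e.baseSet)
    (hu' : u ∈ e'.baseSet) : SmoothTransitionAt IF IB e' e u := fun y => by
  have hO := e'.open_baseSet.inter e.open_baseSet
  refine contMDiffAt_uncurry_of_inverse (h _) (((he.coordChange he').2 u ⟨hu, hu'⟩).2 _)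
    ((continuousOn_uncurry_coordChange e' e).continuousAt
      ((hO.prod isOpen_univ).mem_nhds ⟨⟨hu', hu⟩, trivial⟩)) ?_
  filter_upwards [hO.mem_nhds ⟨hu', hu⟩] with v hv z
  rw [e'.coordChange_coordChange e e' hv.1 hv.2, e'.coordChange_same_apply hv.1]

end SmoothTransitions

/-! ### Construction of a smooth bundle atlas. -/

section SmoothingTransitions

open Function Filter

set_option linter.unusedSectionVars false

variable {B F M : Type*} [TopologicalSpace B]
  {EF HF : Type*} [NormedAddCommGroup EF] [NormedSpace ℝ EF] [FiniteDimensional ℝ EF]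
  [TopologicalSpace HF]
  {IF : ModelWithCorners ℝ EF HF} [IF.Boundaryless]
  [TopologicalSpace F] [ChartedSpace HF F] [IsManifold IF ∞ F] [CompactSpace F] [T2Space F]
  {EM HM : Type*} [NormedAddCommGroup EM] [NormedSpace ℝ EM] [FiniteDimensional ℝ EM]
  [TopologicalSpace HM]
  {IM : ModelWithCorners ℝ EM HM}
  [TopologicalSpace M] [ChartedSpace HM M] [IsManifold IM ∞ M]
  {EB HB : Type*} [NormedAddCommGroup EB] [NormedSpace ℝ EB] [FiniteDimensional ℝ EB]
  [TopologicalSpace HB]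
  {IB : ModelWithCorners ℝ EB HB} [IB.Boundaryless] [ChartedSpace HB B] [IsManifold IB ∞ B]
  [CompactSpace B] [T2Space B]
  {proj : M → B} {e e₁ : Trivialization F proj}

/-- Twisting `e` by `(e₁ → e) ∘ t`, where `t` is a smoothing of the coordinate change `e → e₁`,
makes `t` the new coordinate change. The cutoff `ρ` is `1` near `C` and supported in `O`, so the
twist is the identity near the points outside `O` and extends over the whole base set of `e`. -/
theorem IsC1Trivialization.exists_smoothing (he : IsC1Trivialization IF IM e)
    (he₁ : IsC1Trivialization IF IM e₁) {O C : Set B} (hO : IsOpen O) (hOe : O ⊆ e.baseSet)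
    (hOe₁ : O ⊆ e₁.baseSet) (hC : IsClosed C) (hCO : C ⊆ O) (IB : ModelWithCorners ℝ EB HB)
    [IB.Boundaryless] [IsManifold IB ∞ B] :
    ∃ e' : Trivialization F proj, IsC1Trivialization IF IM e' ∧ e'.baseSet = e.baseSet ∧
      (∀ u ∈ C, SmoothTransitionAt IF IB e' e₁ u) ∧
      (∀ u ∈ O, SmoothTransitionAt IF IB e e₁ u → SmoothTransitionAt IF IB e' e₁ u) ∧
      ∀ u ∈ e.baseSet \ O, ∀ᶠ v in 𝓝 u, ∀ y, fiberParam e' v y = fiberParam e v y := by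
  classical
  have : LocallyCompactSpace B := Manifold.locallyCompact_of_finiteDimensional IB
  obtain ⟨D, hD, hCD, hDO⟩ := exists_compact_between hC.isCompact hO hCO
  obtain ⟨ρ, hρ1, hρ0, hρI⟩ := exists_contMDiffMap_one_nhds_of_subset_interior (n := (⊤ : ℕ∞)) IB
    hC hCD
  have hρD : tsupport ρ ⊆ D := closure_minimal (fun x hx => by
    by_contra hxD
    exact hx (hρ0 x hxD)) hD.isClosed
  set W := e.baseSet ∩ e₁.baseSet with hW
  have hWo : IsOpen W := e.open_baseSet.inter e₁.open_baseSet
  have hOW : O ⊆ W := subset_inter hOe hOe₁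
  obtain ⟨t, ht, ht0, hts, ht1⟩ := (he.coordChange he₁).exists_smoothing hWo ρ.contMDiff hρI
    (hρD.trans (hDO.trans hOW))
  let α : B → F → F := fun u y => if u ∈ W then e₁.coordChange e u (t u y) else y
  have hαW : ∀ u ∈ W, α u = fun y => e₁.coordChange e u (t u y) := fun u hu =>
    funext fun y => if_pos hu
  have hα0 : ∀ u, u ∉ tsupport ρ → α u = id := fun u hu => by
    by_cases huW : u ∈ W
    · rw [hαW u huW, ht0 u huW (image_eq_zero_of_notMem_tsupport hu)]
      funext y
      rw [e.coordChange_coordChange e₁ e huW.1 huW.2, e.coordChange_same_apply huW.1, id]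
    · exact funext fun y => if_neg huW
  have hα1 : IsC1DiffeoFamilyOn IF W α := by
    have h1 : IsC1DiffeoFamilyOn IF W (e₁.coordChange e) := by
      have := he₁.coordChange he
      rwa [inter_comm] at this
    have h2 := h1.comp ht
    exact ⟨h2.1.congr hαW, fun u hu => by rw [hαW u hu]; exact h2.2 u hu⟩
  have hα : IsC1DiffeoFamilyOn IF e.baseSet α := by
    refine ⟨isC1FamilyOn_of_local fun u hu => ?_, fun u hu => ?_⟩
    · by_cases huW : u ∈ W
      · exact ⟨W, mem_nhdsWithin_of_mem_nhds (hWo.mem_nhds huW), hα1.1⟩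
      · have huρ : u ∉ tsupport ρ := fun h => huW (hOW (hDO (hρD h)))
        exact ⟨(tsupport ρ)ᶜ, mem_nhdsWithin_of_mem_nhds
          ((isClosed_tsupport ρ).isOpen_compl.mem_nhds huρ),
          isC1FamilyOn_id.congr fun v hv => hα0 v hv⟩
    · by_cases huW : u ∈ W
      · exact hα1.2 u huW
      · rw [hα0 u fun h => huW (hOW (hDO (hρD h)))]
        refine ⟨bijective_id, fun y => ?_⟩
        rw [mfderiv_id]
        exact injective_id
  obtain ⟨e', hbase, he'⟩ := exists_trivialization_twist e hα.1.continuousOn fun u hu =>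
    (hα.2 u hu).1
  have hcc : ∀ u ∈ W, e'.coordChange e₁ u = t u := fun u hu => funext fun y => by
    change (e₁ (fiberParam e' u y)).2 = _
    rw [he' u hu.1, hαW u hu, fiberParam_coordChange e₁ e hu.2 hu.1, apply_fiberParam e₁ hu.2]
  have hsm : ∀ u ∈ W, (∀ y, ContMDiffAt (IB.prod IF) IF ∞ (uncurry t) (u, y)) →
      SmoothTransitionAt IF IB e' e₁ u := fun u hu h y => by
    refine (h y).congr_of_eventuallyEq ?_
    filter_upwards [(continuous_fst.tendsto (u, y)).eventually (hWo.mem_nhds hu)] with p hp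
    exact congrFun (hcc p.1 hp) p.2
  refine ⟨e', he.of_twist hα hbase he', hbase, fun u hu => ?_, fun u hu h => ?_, fun u hu => ?_⟩
  · exact hsm u (hOW (hCO hu)) fun y => ht1 u (hOW (hCO hu)) (eventually_nhdsSet_iff_forall.1 hρ1 u hu) y
  · exact hsm u (hOW hu) fun y => hts u (hOW hu) y (h y)
  · have huρ : u ∉ tsupport ρ := fun h => hu.2 (hDO (hρD h))
    filter_upwards [e.open_baseSet.mem_nhds hu.1,
      (isClosed_tsupport ρ).isOpen_compl.mem_nhds huρ] with v hv hvρ y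
    rw [he' v hv, hα0 v hvρ, id]

/-- A continuous bundle with `C^1` fibers has an atlas of `C^1` trivializations with smooth
coordinate changes. -/
theorem IsC1FiberedBundle.exists_smooth_atlas (hproj : IsC1FiberedBundle F IF IM proj)
    (IB : ModelWithCorners ℝ EB HB) [IB.Boundaryless] [IsManifold IB ∞ B] :
    ∃ S : Set (Trivialization F proj × Set B),
      (∀ p ∈ S, IsC1Trivialization IF IM p.1 ∧ IsOpen p.2 ∧ p.2 ⊆ p.1.baseSet) ∧
      (∀ u, ∃ p ∈ S, u ∈ p.2) ∧
      ∀ p ∈ S, ∀ p' ∈ S, ∀ u ∈ p.2 ∩ p'.2, SmoothTransitionAt IF IB p.1 p'.1 u := by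
  classical
  have : LocallyCompactSpace B := Manifold.locallyCompact_of_finiteDimensional IB
  choose e he heC using hproj
  choose K hK huK hKe using fun u =>
    exists_compact_subset (e u).open_baseSet (he u)
  -- Trivializations are made compatible one at a time. The domains `V i` shrink at each stage, but
  -- always contain the fixed compact sets `K i`, whose interiors cover the base.
  have houter : ∀ T : Finset B, ∃ (E : B → Trivialization F proj) (V : B → Set B),
      (∀ i ∈ T, IsC1Trivialization IF IM (E i) ∧ IsOpen (V i) ∧ K i ⊆ V i ∧
        V i ⊆ (E i).baseSet) ∧
      ∀ i ∈ T, ∀ l ∈ T, ∀ u ∈ V i ∩ V l, SmoothTransitionAt IF IB (E i) (E l) u := by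
    intro T
    induction T using Finset.induction_on with
    | empty => exact ⟨e, fun _ => ∅, by simp, by simp⟩
    | insert a T ha ih =>
      obtain ⟨E, V, hEV, hsm⟩ := ih
      have hex : ∀ i, ∃ L : Set B, i ∈ T → IsCompact L ∧ K i ⊆ interior L ∧ L ⊆ V i := fun i => by
        by_cases hi : i ∈ T
        · obtain ⟨L, h1, h2, h3⟩ := exists_compact_between (hK i) (hEV i hi).2.1 (hEV i hi).2.2.1
          exact ⟨L, fun _ => ⟨h1, h2, h3⟩⟩
        · exact ⟨∅, fun h => absurd h hi⟩
      choose L hL using hex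
      -- Only the new trivialization is modified: it is adapted successively to each of the old
      -- ones, over the compact sets `L i`.
      have hinner : ∀ T' : Finset B, T' ⊆ T → ∃ (e' : Trivialization F proj) (V' : Set B),
          IsC1Trivialization IF IM e' ∧ IsOpen V' ∧ K a ⊆ V' ∧ V' ⊆ e'.baseSet ∧
          ∀ i ∈ T', ∀ u ∈ V' ∩ L i, SmoothTransitionAt IF IB e' (E i) u := by
        intro T'
        induction T' using Finset.induction_on with
        | empty =>
          exact fun _ => ⟨e a, (e a).baseSet, heC a, (e a).open_baseSet, hKe a, subset_rfl,
            by simp⟩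
        | insert l T' hl ih' =>
          intro hT'
          obtain ⟨e', V', he', hV', hKV', hVe', hs'⟩ := ih' ((Finset.subset_insert l T').trans hT')
          have hlT : l ∈ T := hT' (Finset.mem_insert_self l T')
          obtain ⟨L', hL', hKL', hLV'⟩ := exists_compact_between (hK a) hV' hKV'
          obtain ⟨hEl, hVl, -, hVEl⟩ := hEV l hlT
          obtain ⟨e'', he'', hbase, h1, h2, h3⟩ := he'.exists_smoothing hEl
            (O := V' ∩ V l) (C := L' ∩ L l) (hV'.inter hVl) (inter_subset_left.trans hVe')
            (inter_subset_right.trans hVEl) (hL'.isClosed.inter (hL l hlT).1.isClosed)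
            (inter_subset_inter hLV' (hL l hlT).2.2) IB
          refine ⟨e'', interior L', he'', isOpen_interior, hKL', ?_, fun i hi u hu => ?_⟩
          · rw [hbase]; exact interior_subset.trans (hLV'.trans hVe')
          · have huL' : u ∈ L' := interior_subset hu.1
            have hiT : i ∈ T := hT' hi
            rcases Finset.mem_insert.1 hi with rfl | hi'
            · exact h1 u ⟨huL', hu.2⟩
            · have hsi : SmoothTransitionAt IF IB e' (E i) u := hs' i hi' u ⟨hLV' huL', hu.2⟩
              have hue' : u ∈ e'.baseSet := hVe' (hLV' huL')
              have huVi : u ∈ V i := (hL i hiT).2.2 hu.2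
              -- Adapting to `E l` must not destroy smoothness of the transition to `E i`. Over `V'
              -- ∩ V l` the transition from `e'` to `E l` at `u` is already smooth, through `E i`;
              -- the smoothing keeps it smooth, and one returns to `E i`. Elsewhere `e'` is
              -- unchanged near `u`.
              by_cases huO : u ∈ V' ∩ V l
              · exact (h2 u huO (hsi.trans (hsm i hiT l hlT u ⟨huVi, huO.2⟩) hue'
                  ((hEV i hiT).2.2.2 huVi))).trans (hsm l hlT i hiT u ⟨huO.2, huVi⟩)
                  (hbase ▸ hue') (hVEl huO.2)
              · exact hsi.congr_left (h3 u ⟨hue', huO⟩)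
      obtain ⟨e', V', he', hV', hKV', hVe', hs'⟩ := hinner T subset_rfl
      have hne : ∀ i ∈ T, i ≠ a := fun i hi h => ha (h ▸ hi)
      refine ⟨update E a e', update (fun i => interior (L i)) a V', fun i hi => ?_,
        fun i hi l hl u hu => ?_⟩
      · rcases Finset.mem_insert.1 hi with rfl | hi'
        · simp only [update_self]; exact ⟨he', hV', hKV', hVe'⟩
        · rw [update_of_ne (hne i hi'), update_of_ne (hne i hi')]
          exact ⟨(hEV i hi').1, isOpen_interior, (hL i hi').2.1,
            interior_subset.trans ((hL i hi').2.2.trans (hEV i hi').2.2.2)⟩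
      · rcases Finset.mem_insert.1 hi with rfl | hi' <;>
          rcases Finset.mem_insert.1 hl with rfl | hl'
        · simp only [update_self] at hu ⊢
          exact smoothTransitionAt_refl (hVe' hu.1)
        · rw [update_self, update_of_ne (hne l hl')] at hu ⊢
          exact hs' l hl' u ⟨hu.1, interior_subset hu.2⟩
        · rw [update_self, update_of_ne (hne i hi')] at hu ⊢
          exact (hs' i hi' u ⟨hu.2, interior_subset hu.1⟩).symm he' (hEV i hi').1 (hVe' hu.2)
            ((hEV i hi').2.2.2 ((hL i hi').2.2 (interior_subset hu.1)))
        · rw [update_of_ne (hne i hi'), update_of_ne (hne l hl')] at hu ⊢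
          exact hsm i hi' l hl' u ⟨(hL i hi').2.2 (interior_subset hu.1),
            (hL l hl').2.2 (interior_subset hu.2)⟩
  obtain ⟨T, hT⟩ := isCompact_univ.elim_finite_subcover (fun u => interior (K u))
    (fun u => isOpen_interior) fun u _ => mem_iUnion.2 ⟨u, huK u⟩
  obtain ⟨E, V, hEV, hsm⟩ := houter T
  refine ⟨(fun i => (E i, V i)) '' T, ?_, fun u => ?_, ?_⟩
  · rintro _ ⟨i, hi, rfl⟩
    exact ⟨(hEV i hi).1, (hEV i hi).2.1, (hEV i hi).2.2.2⟩
  · obtain ⟨i, hi, hu⟩ := mem_iUnion₂.1 (hT (mem_univ u))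
    exact ⟨_, ⟨i, hi, rfl⟩, (hEV i hi).2.2.1 (interior_subset hu)⟩
  · rintro _ ⟨i, hi, rfl⟩ _ ⟨l, hl, rfl⟩ u hu
    exact hsm i hi l hl u hu

end SmoothingTransitions

/-! ### The manifold structure defined by a smooth bundle atlas. -/

section Gluing

open Function Filter

set_option linter.unusedSectionVars false

variable {B F X : Type*} [TopologicalSpace B] [TopologicalSpace X]
  {EF HF : Type*} [NormedAddCommGroup EF] [NormedSpace ℝ EF] [TopologicalSpace HF]
  {IF : ModelWithCorners ℝ EF HF} [IF.Boundaryless]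
  [TopologicalSpace F] [ChartedSpace HF F] [IsManifold IF ∞ F]
  {EB HB : Type*} [NormedAddCommGroup EB] [NormedSpace ℝ EB] [TopologicalSpace HB]
  {IB : ModelWithCorners ℝ EB HB} [IB.Boundaryless] [ChartedSpace HB B] [IsManifold IB ∞ B]
  {E' : Type*} [NormedAddCommGroup E'] [NormedSpace ℝ E']
  {proj : X → B} {e e' : Trivialization F proj}

variable (IB IF) in
/-- The chart of the total space of a bundle given by a local trivialization and a chart of the
product of base and fiber. -/
def bundleChart (L : (EB × EF) ≃L[ℝ] E') (e : Trivialization F proj) (p : B × F) :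
    OpenPartialHomeomorph X E' :=
  (e.toOpenPartialHomeomorph ≫ₕ chartAt (ModelProd HB HF) p) ≫ₕ
    ((IB.prod IF).toHomeomorph.trans L.toHomeomorph).toOpenPartialHomeomorph

variable {L : (EB × EF) ≃L[ℝ] E'}

theorem mem_bundleChart_source {p : B × F} {x : X} :
    x ∈ (bundleChart IF IB L e p).source ↔
      x ∈ e.source ∧ e x ∈ (chartAt (ModelProd HB HF) p).source := by
  simp [bundleChart]

theorem mem_bundleChart_target {p : B × F} {z : E'} :
    z ∈ (bundleChart IF IB L e p).target ↔ L.symm z ∈ (extChartAt (IB.prod IF) p).target ∧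
      (extChartAt (IB.prod IF) p).symm (L.symm z) ∈ e.target := by
  rw [extChartAt_target, (IB.prod IF).range_eq_univ, inter_univ]
  simp only [bundleChart, OpenPartialHomeomorph.trans_target, mem_inter_iff, mem_preimage]
  exact ⟨fun h => h.2, fun h => ⟨trivial, h⟩⟩

theorem bundleChart_symm_apply {p : B × F} {z : E'} :
    (bundleChart IF IB L e p).symm z =
      e.toOpenPartialHomeomorph.symm ((extChartAt (IB.prod IF) p).symm (L.symm z)) := rfl

theorem contMDiffOn_trivialization_comp_symm
    (h : ∀ u ∈ e.baseSet ∩ e'.baseSet, SmoothTransitionAt IF IB e e' u) :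
    ContMDiffOn (IB.prod IF) (IB.prod IF) ∞ (fun p => e' (e.toOpenPartialHomeomorph.symm p))
      {p | p.1 ∈ e.baseSet ∩ e'.baseSet} := by
  have h1 : ContMDiffOn (IB.prod IF) (IB.prod IF) ∞
      (fun p : B × F => (p.1, e.coordChange e' p.1 p.2)) {p | p.1 ∈ e.baseSet ∩ e'.baseSet} :=
    contMDiffOn_fst.prodMk fun p hp => (h p.1 hp p.2).contMDiffWithinAt
  refine h1.congr fun p hp => ?_
  exact (e.mk_coordChange e' hp.1 hp.2 p.2).symm

/-- Local trivializations with smooth coordinate changes define a smooth structure. -/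
theorem exists_chartedSpace_of_smoothTransitionAt {S : Set (Trivialization F proj)}
    (hcov : ∀ u, ∃ e ∈ S, u ∈ e.baseSet)
    (hS : ∀ e ∈ S, ∀ e' ∈ S, ∀ u ∈ e.baseSet ∩ e'.baseSet, SmoothTransitionAt IF IB e e' u)
    (L : (EB × EF) ≃L[ℝ] E') :
    ∃ (_ : ChartedSpace E' X) (_ : IsManifold 𝓘(ℝ, E') ∞ X), ∀ e ∈ S,
      ContMDiffOn 𝓘(ℝ, E') (IB.prod IF) ∞ e e.source ∧
      ContMDiffOn (IB.prod IF) 𝓘(ℝ, E') ∞ e.toOpenPartialHomeomorph.symm e.target := by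
  choose e heS hmem using hcov
  have hsrc : ∀ x, x ∈ (e (proj x)).source := fun x => (e (proj x)).mem_source.2 (hmem _)
  let ch : X → OpenPartialHomeomorph X E' := fun x => bundleChart IF IB L (e (proj x)) (e (proj x) x)
  let cs : ChartedSpace E' X :=
    { atlas := range ch
      chartAt := ch
      mem_chart_source := fun x =>
        mem_bundleChart_source.2 ⟨hsrc x, mem_chart_source _ _⟩
      chart_mem_atlas := fun x => mem_range_self x }
  have hman : IsManifold 𝓘(ℝ, E') ∞ X := by
    refine isManifold_of_contDiffOn 𝓘(ℝ, E') ∞ X ?_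
    -- A change of charts is the smooth transition of trivializations, conjugated by charts of `B ×
    -- F` and by `L`.
    rintro _ _ ⟨x, rfl⟩ ⟨x', rfl⟩
    rw [← contMDiffOn_iff_contDiffOn]
    have h1 := contMDiffOn_trivialization_comp_symm (hS _ (heS (proj x)) _ (heS (proj x')))
    have h2 := (contMDiffOn_extChartAt_symm (I := IB.prod IF) (n := ∞) (e (proj x) x)).comp
      (L.symm.contDiff (n := ∞)).contMDiff.contMDiffOn (s := (ch x).target)
      fun z hz => (mem_bundleChart_target.1 hz).1
    have hm : ∀ z ∈ ((ch x).symm ≫ₕ ch x').source, z ∈ (ch x).target ∧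
        (ch x).symm z ∈ (ch x').source := fun z hz => by
      rwa [OpenPartialHomeomorph.trans_source] at hz
    have h4 := h1.comp (h2.mono (t := ((ch x).symm ≫ₕ ch x').source) fun z hz => (hm z hz).1)
      fun z hz => by
        obtain ⟨hz1, hz2⟩ := hm z hz
        refine ⟨(e (proj x)).mem_target.1 (mem_bundleChart_target.1 hz1).2, ?_⟩
        have h5 := (e (proj x')).mem_source.1 (mem_bundleChart_source.1 hz2).1
        have h6 := (e (proj x)).proj_symm_apply (mem_bundleChart_target.1 hz1).2
        rw [bundleChart_symm_apply, h6] at h5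
        exact h5
    have h7 := (contMDiffOn_extChartAt (I := IB.prod IF) (n := ∞) (x := e (proj x') x')).comp h4
      fun z hz => (mem_bundleChart_source.1 (hm z hz).2).2
    have h8 := (L.contDiff (n := ∞)).contMDiff.comp_contMDiffOn h7
    refine h8.mono fun z hz => ?_
    exact hz.1
  refine ⟨cs, hman, fun e₁ he₁ => ⟨fun x hx => ?_, fun q hq => ?_⟩⟩
  · have h1 := contMDiffOn_trivialization_comp_symm (hS _ (heS (proj x)) _ he₁)
    have hc : ContMDiffAt 𝓘(ℝ, E') 𝓘(ℝ, E') ∞ (ch x) x := contMDiffAt_of_mem_maximalAtlas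
      (IsManifold.chart_mem_maximalAtlas x) (mem_chart_source E' x)
    have hex : ContMDiffAt 𝓘(ℝ, E') (IB.prod IF) ∞ (e (proj x)) x := by
      have hz : L.symm (ch x x) = extChartAt (IB.prod IF) (e (proj x) x) (e (proj x) x) :=
        L.symm_apply_apply _
      have h2 : ContMDiffAt 𝓘(ℝ, EB × EF) (IB.prod IF) ∞
          (extChartAt (IB.prod IF) (e (proj x) x)).symm (L.symm (ch x x)) := by
        rw [hz]
        exact (contMDiffOn_extChartAt_symm (I := IB.prod IF) (n := ∞) (e (proj x) x)).contMDiffAt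
          (extChartAt_target_mem_nhds _)
      have h3 := h2.comp x (((L.symm.contDiff (n := ∞)).contMDiff.contMDiffAt).comp x hc)
      refine h3.congr_of_eventuallyEq ?_
      filter_upwards [(ch x).open_source.mem_nhds (mem_chart_source E' x)] with x' hx'
      have h4 := (mem_bundleChart_source.1 hx').2
      have h5 : L.symm (ch x x') = extChartAt (IB.prod IF) (e (proj x) x) (e (proj x) x') :=
        L.symm_apply_apply _
      simp only [comp_apply]
      rw [h5, (extChartAt (IB.prod IF) (e (proj x) x)).left_inv]
      rwa [extChartAt_source]
    have hO : IsOpen {p : B × F | p.1 ∈ (e (proj x)).baseSet ∩ e₁.baseSet} :=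
      ((e (proj x)).open_baseSet.inter e₁.open_baseSet).preimage continuous_fst
    have hxb : (e (proj x) x).1 = proj x := (e (proj x)).coe_fst (hsrc x)
    have h6 := (h1.contMDiffAt (x := e (proj x) x) (hO.mem_nhds (by
      rw [mem_ofPred_eq, hxb]; exact ⟨hmem _, e₁.mem_source.1 hx⟩))).comp x hex
    refine (h6.congr_of_eventuallyEq ?_).contMDiffWithinAt
    filter_upwards [(e (proj x)).open_source.mem_nhds (hsrc x)] with x' hx'
    exact congrArg e₁ ((e (proj x)).left_inv hx').symm
  · set x := e₁.toOpenPartialHomeomorph.symm q with hx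
    have hxs : x ∈ e₁.source := e₁.map_target hq
    have hpx : proj x = q.1 := e₁.proj_symm_apply hq
    have h1 := contMDiffOn_trivialization_comp_symm (hS _ he₁ _ (heS (proj x)))
    have hO : IsOpen {p : B × F | p.1 ∈ e₁.baseSet ∩ (e (proj x)).baseSet} :=
      (e₁.open_baseSet.inter (e (proj x)).open_baseSet).preimage continuous_fst
    have h2 := h1.contMDiffAt (x := q) (hO.mem_nhds ⟨e₁.mem_target.1 hq, hpx ▸ hmem _⟩)
    have h3 : ContMDiffAt (IB.prod IF) 𝓘(ℝ, E') ∞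
        (fun p => ch x (e₁.toOpenPartialHomeomorph.symm p)) q := by
      have h4 : ContMDiffAt (IB.prod IF) 𝓘(ℝ, EB × EF) ∞
          (extChartAt (IB.prod IF) (e (proj x) x)) (e (proj x) x) := contMDiffAt_extChartAt
      have h7 := h4.comp q h2
      exact ContMDiffAt.comp q (g := L) (I' := 𝓘(ℝ, EB × EF))
        (L.contDiff (n := ∞)).contMDiff.contMDiffAt h7
    have h5 : ContMDiffAt 𝓘(ℝ, E') 𝓘(ℝ, E') ∞ (ch x).symm (ch x x) :=
      (contMDiffOn_symm_of_mem_maximalAtlas (IsManifold.chart_mem_maximalAtlas x)).contMDiffAt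
        ((ch x).open_target.mem_nhds ((ch x).map_source (mem_chart_source E' x)))
    refine ((h5.comp q h3).congr_of_eventuallyEq ?_).contMDiffWithinAt
    have h6 : ContinuousAt e₁.toOpenPartialHomeomorph.symm q :=
      e₁.toOpenPartialHomeomorph.continuousAt_symm hq
    filter_upwards [h6 ((ch x).open_source.mem_nhds (mem_chart_source E' x))] with p hp
    exact ((ch x).left_inv hp).symm

end Gluing

/-! ### Smooth structure on the total space. -/

section SmoothBundles

open Function Filter

set_option linter.unusedSectionVars false

variable {B F M : Type*} [TopologicalSpace B]
  {EF HF : Type*} [NormedAddCommGroup EF] [NormedSpace ℝ EF] [FiniteDimensional ℝ EF]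
  [TopologicalSpace HF]
  {IF : ModelWithCorners ℝ EF HF} [IF.Boundaryless]
  [TopologicalSpace F] [ChartedSpace HF F] [IsManifold IF ∞ F]
  {EM HM : Type*} [NormedAddCommGroup EM] [NormedSpace ℝ EM] [FiniteDimensional ℝ EM]
  [TopologicalSpace HM]
  {IM : ModelWithCorners ℝ EM HM}
  [TopologicalSpace M] [ChartedSpace HM M] [IsManifold IM ∞ M]
  {EB HB : Type*} [NormedAddCommGroup EB] [NormedSpace ℝ EB] [FiniteDimensional ℝ EB]
  [TopologicalSpace HB]
  {IB : ModelWithCorners ℝ EB HB} [IB.Boundaryless] [ChartedSpace HB B] [IsManifold IB ∞ B]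
  {proj : M → B} {e : Trivialization F proj}

/-- Smooth local trivializations are `C^1` trivializations. -/
theorem isC1Trivialization_of_contMDiffOn (h : ContMDiffOn IM (IB.prod IF) ∞ e e.source)
    (h' : ContMDiffOn (IB.prod IF) IM ∞ e.toOpenPartialHomeomorph.symm e.target) :
    IsC1Trivialization IF IM e := by
  refine ⟨isC1FamilyOn_of_contMDiffOn (IB := IB) e.open_baseSet ?_, fun u hu y => ?_⟩
  · rw [← e.target_eq]
    exact h'.of_le (by simp)
  · have h1 : ContMDiffAt IM IF ∞ (fun x => (e x).2) (fiberParam e u y) :=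
      contMDiffAt_snd.comp (fiberParam e u y) (h.contMDiffAt
        (e.open_source.mem_nhds (fiberParam_mem_source e hu y)))
    have h2 : ContMDiffAt IF IM ∞ (fiberParam e u) y :=
      (h'.contMDiffAt (x := (u, y)) (e.open_target.mem_nhds (e.mem_target.2 hu))).comp y
        (contMDiffAt_const.prodMk contMDiffAt_id)
    have h3 := mfderiv_comp y (h1.mdifferentiableAt (by simp)) (h2.mdifferentiableAt (by simp))
    have h4 : (fun x => (e x).2) ∘ fiberParam e u = id := funext fun y =>
      congrArg Prod.snd (apply_fiberParam e hu y)
    rw [h4, mfderiv_id] at h3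
    intro v w hvw
    have h5 : ∀ v : TangentSpace IF y, v = mfderiv IM IF (fun x => (e x).2) (fiberParam e u y)
        (mfderiv IF IM (fiberParam e u) y v) := fun v => congrArg (fun L => L v) h3
    rw [h5 v, h5 w, hvw]

/-- The total space of a continuous bundle with `C^1` fibers has a smooth structure that makes it
a smooth bundle, and in which the fibers have the same `C^1` structure. -/
theorem IsC1FiberedBundle.exists_smooth_bundle [CompactSpace F] [T2Space F] [CompactSpace B]
    [T2Space B] (hproj : IsC1FiberedBundle F IF IM proj)
    (IB : ModelWithCorners ℝ EB HB) [IB.Boundaryless] [IsManifold IB ∞ B]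
    {E' : Type*} [NormedAddCommGroup E'] [NormedSpace ℝ E'] (L : (EB × EF) ≃L[ℝ] E') :
    ∃ (_ : ChartedSpace E' M) (_ : IsManifold 𝓘(ℝ, E') ∞ M),
      ∀ u, ∃ e : Trivialization F proj, u ∈ e.baseSet ∧ IsC1Trivialization IF IM e ∧
        ContMDiffOn 𝓘(ℝ, E') (IB.prod IF) ∞ e e.source ∧
        ContMDiffOn (IB.prod IF) 𝓘(ℝ, E') ∞ e.toOpenPartialHomeomorph.symm e.target := by
  obtain ⟨S, hS, hcov, hsm⟩ := hproj.exists_smooth_atlas IB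
  -- Transitions are known to be smooth only over the open sets `p.2`, hence the restriction.
  let R : S → Trivialization F proj := fun p => p.1.1.restrOpen p.1.2 (hS p.1 p.2).2.1
  have hR : ∀ p, IsC1Trivialization IF IM (R p) := fun p =>
    ⟨(hS p.1 p.2).1.1.mono inter_subset_left, fun u hu => (hS p.1 p.2).1.2 u hu.1⟩
  have hRsm : ∀ p p', ∀ u ∈ (R p).baseSet ∩ (R p').baseSet, SmoothTransitionAt IF IB (R p) (R p') u :=
    fun p p' u hu => hsm p.1 p.2 p'.1 p'.2 u ⟨hu.1.2, hu.2.2⟩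
  have hRcov : ∀ u, ∃ e ∈ range R, u ∈ e.baseSet := fun u => by
    obtain ⟨p, hp, hu⟩ := hcov u
    exact ⟨_, ⟨⟨p, hp⟩, rfl⟩, (hS p hp).2.2 hu, hu⟩
  obtain ⟨cs, hman, h⟩ := exists_chartedSpace_of_smoothTransitionAt hRcov
    (by rintro _ ⟨p, rfl⟩ _ ⟨p', rfl⟩; exact hRsm p p') L
  refine ⟨cs, hman, fun u => ?_⟩
  obtain ⟨_, ⟨p, rfl⟩, hu⟩ := hRcov u
  exact ⟨R p, hu, hR p, h _ ⟨p, rfl⟩⟩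

end SmoothBundles

/-! ### Maps that are uniformly `C^1` along the fibers. -/

section UniformlyC1

open Function Filter

set_option linter.unusedSectionVars false

variable {B B' F M N Z : Type*} [TopologicalSpace B] [TopologicalSpace B']
  {EF HF : Type*} [NormedAddCommGroup EF] [NormedSpace ℝ EF] [FiniteDimensional ℝ EF]
  [TopologicalSpace HF]
  {IF : ModelWithCorners ℝ EF HF} [IF.Boundaryless]
  [TopologicalSpace F] [ChartedSpace HF F] [IsManifold IF ∞ F]
  {EM HM : Type*} [NormedAddCommGroup EM] [NormedSpace ℝ EM] [FiniteDimensional ℝ EM]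
  [TopologicalSpace HM]
  {IM : ModelWithCorners ℝ EM HM}
  [TopologicalSpace M] [ChartedSpace HM M] [IsManifold IM ∞ M]
  {EN HN : Type*} [NormedAddCommGroup EN] [NormedSpace ℝ EN] [FiniteDimensional ℝ EN]
  [TopologicalSpace HN]
  {IN : ModelWithCorners ℝ EN HN}
  [TopologicalSpace N] [ChartedSpace HN N] [IsManifold IN ∞ N]
  {EZ HZ : Type*} [NormedAddCommGroup EZ] [NormedSpace ℝ EZ] [FiniteDimensional ℝ EZ]
  [TopologicalSpace HZ]
  {IZ : ModelWithCorners ℝ EZ HZ}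
  [TopologicalSpace Z] [ChartedSpace HZ Z] [IsManifold IZ ∞ Z]
  {proj : M → B} {proj' : N → B'}

theorem IsUniformlyC1AlongFibers.const_path {f : M → N}
    (hf : IsUniformlyC1AlongFibers F IF IM IN proj f) :
    IsUniformlyC1PathAlongFibers F IF IM IN proj (fun _ => f) := fun e he =>
  (hf e he).reparam (a := Prod.fst) continuousOn_fst fun _ hq => hq.1

theorem IsUniformlyC1PathAlongFibers.apply {Γ : unitInterval → M → N}
    (hΓ : IsUniformlyC1PathAlongFibers F IF IM IN proj Γ) (t : unitInterval) :
    IsUniformlyC1AlongFibers F IF IM IN proj (Γ t) := fun e he =>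
  (hΓ e he).reparam (a := fun u => (u, t)) (by fun_prop) fun _ hu => ⟨hu, trivial⟩

theorem IsUniformlyC1PathAlongFibers.reparam {Γ : unitInterval → M → N}
    (hΓ : IsUniformlyC1PathAlongFibers F IF IM IN proj Γ) {s : unitInterval → unitInterval}
    (hs : Continuous s) : IsUniformlyC1PathAlongFibers F IF IM IN proj (fun t => Γ (s t)) :=
  fun e he => (hΓ e he).reparam (a := fun q : B × unitInterval => (q.1, s q.2))
    (by fun_prop) fun _ hq => ⟨hq.1, trivial⟩

/-- The definition tests all `C^1` trivializations, but coordinate changes are `C^1` families, so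
one trivialization near each point is enough. -/
theorem isUniformlyC1PathAlongFibers_of_local {Γ : unitInterval → M → N}
    (h : ∀ u t, ∃ e : Trivialization F proj, u ∈ e.baseSet ∧ IsC1Trivialization IF IM e ∧
      ∃ V ∈ 𝓝 (u, t), IsC1FamilyOn IF IN V
        (fun (q : B × unitInterval) y => Γ q.2 (fiberParam e q.1 y))) :
    IsUniformlyC1PathAlongFibers F IF IM IN proj Γ := by
  intro e' he'
  refine isC1FamilyOn_of_local fun q hq => ?_
  obtain ⟨e, hu, he, V, hV, hVΓ⟩ := h q.1 q.2
  set W : Set (B × unitInterval) := V ∩ Prod.fst ⁻¹' (e'.baseSet ∩ e.baseSet) with hW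
  have hWn : W ∈ 𝓝 q := inter_mem hV
    (((e'.open_baseSet.inter e.open_baseSet).preimage continuous_fst).mem_nhds ⟨hq.1, hu⟩)
  refine ⟨W, mem_nhdsWithin_of_mem_nhds hWn, ?_⟩
  have h1 : IsC1FamilyOn IF IF W (fun q => e'.coordChange e q.1) :=
    (he'.coordChange he).1.reparam continuousOn_fst fun _ hq => hq.2
  refine (hVΓ.comp continuousOn_id (fun _ hq => hq.1) h1).congr fun q hq => ?_
  funext y
  rw [id, fiberParam_coordChange e' e hq.2.1 hq.2.2]

theorem isUniformlyC1AlongFibers_of_cover {f : M → N}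
    (h : ∀ u, ∃ e : Trivialization F proj, u ∈ e.baseSet ∧ IsC1Trivialization IF IM e ∧
      IsC1FamilyOn IF IN e.baseSet (fun u y => f (fiberParam e u y))) :
    IsUniformlyC1AlongFibers F IF IM IN proj f := by
  refine (isUniformlyC1PathAlongFibers_of_local (Γ := fun _ => f) fun u t => ?_).apply 0
  obtain ⟨e, hu, he, hf⟩ := h u
  refine ⟨e, hu, he, Prod.fst ⁻¹' e.baseSet,
    (e.open_baseSet.preimage continuous_fst).mem_nhds hu, ?_⟩
  exact hf.reparam continuousOn_fst fun _ hq => hq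

/-- The coordinate expression of a map between bundles that is uniformly `C^1` along the fibers. -/
theorem IsUniformlyC1PathAlongFibers.lift {a : unitInterval → M → N}
    (ha : IsUniformlyC1PathAlongFibers F IF IM IN proj a) {abar : unitInterval → B → B'}
    (hproj : ∀ t x, proj' (a t x) = abar t (proj x))
    (hc : Continuous fun q : B × unitInterval => abar q.2 q.1)
    {e : Trivialization F proj} (he : IsC1Trivialization IF IM e)
    {e' : Trivialization F proj'} (he' : IsC1Trivialization IF IN e') :
    IsC1FamilyOn IF IF {q : B × unitInterval | q.1 ∈ e.baseSet ∧ abar q.2 q.1 ∈ e'.baseSet}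
      (fun q y => (e' (a q.2 (fiberParam e q.1 y))).2) := by
  have hp : ∀ q : B × unitInterval, q.1 ∈ e.baseSet → ∀ y,
      proj' (a q.2 (fiberParam e q.1 y)) = abar q.2 q.1 := fun q hq y => by
    rw [hproj, proj_fiberParam e hq]
  have h1 := (ha e he).mono (V := {q : B × unitInterval | q.1 ∈ e.baseSet ∧
    abar q.2 q.1 ∈ e'.baseSet}) fun q hq => ⟨hq.1, trivial⟩
  refine he'.1.lift he'.2 (a := fun q => abar q.2 q.1) hc.continuousOn (fun q hq => hq.2) ?_ h1
    fun q hq y => fiberParam_of_proj_eq e' hq.2 (hp q hq.1 y)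
  refine continuous_snd.comp_continuousOn
    (e'.toOpenPartialHomeomorph.continuousOn.comp h1.continuousOn fun p hp' => ?_)
  exact e'.mem_source.2 ((hp p.1 hp'.1.1 p.2).symm ▸ hp'.1.2)

/-- Inserting a trivialization `e'` of the middle bundle splits the composite into `b ∘ e'` and the
coordinate expression of `a`. That `a` preserves fibers is essential: nothing is known of `b`
transversally. -/
theorem IsUniformlyC1PathAlongFibers.comp (hN : IsC1FiberedBundle F IF IN proj')
    {b : unitInterval → N → Z} (hb : IsUniformlyC1PathAlongFibers F IF IN IZ proj' b)
    {a : unitInterval → M → N}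
    (ha : IsUniformlyC1PathAlongFibers F IF IM IN proj a) {abar : unitInterval → B → B'}
    (hproj : ∀ t x, proj' (a t x) = abar t (proj x))
    (hc : Continuous fun q : B × unitInterval => abar q.2 q.1) :
    IsUniformlyC1PathAlongFibers F IF IM IZ proj (fun t x => b t (a t x)) := by
  intro e he
  refine isC1FamilyOn_of_local fun q₀ hq₀ => ?_
  obtain ⟨e', hu, he'⟩ := hN (abar q₀.2 q₀.1)
  set V : Set (B × unitInterval) := {q | q.1 ∈ e.baseSet ∧ abar q.2 q.1 ∈ e'.baseSet} with hV
  have hVn : V ∈ 𝓝 q₀ := inter_mem ((e.open_baseSet.preimage continuous_fst).mem_nhds hq₀.1)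
    ((e'.open_baseSet.preimage hc).mem_nhds hu)
  refine ⟨V, mem_nhdsWithin_of_mem_nhds hVn, ?_⟩
  have h1 := (hb e' he').comp (a := fun q : B × unitInterval => (abar q.2 q.1, q.2))
    (hc.prodMk continuous_snd).continuousOn (U := V) (fun q hq => ⟨hq.2, trivial⟩)
    (ha.lift hproj hc he he')
  refine h1.congr fun q hq => funext fun y => ?_
  rw [fiberParam_of_proj_eq e' hq.2]
  rw [hproj, proj_fiberParam e hq.1]

theorem IsUniformlyC1AlongFibers.comp (hN : IsC1FiberedBundle F IF IN proj')
    {b : N → Z} (hb : IsUniformlyC1AlongFibers F IF IN IZ proj' b) {a : M → N}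
    (ha : IsUniformlyC1AlongFibers F IF IM IN proj a) {abar : B → B'}
    (hproj : ∀ x, proj' (a x) = abar (proj x)) (hc : Continuous abar) :
    IsUniformlyC1AlongFibers F IF IM IZ proj (fun x => b (a x)) :=
  (hb.const_path.comp hN ha.const_path (abar := fun _ => abar) (fun _ => hproj)
    (hc.comp continuous_fst)).apply 0

theorem IsUniformlyC1AlongFibers.lift {a : M → N}
    (ha : IsUniformlyC1AlongFibers F IF IM IN proj a) {abar : B → B'}
    (hproj : ∀ x, proj' (a x) = abar (proj x)) (hc : Continuous abar)
    {e : Trivialization F proj} (he : IsC1Trivialization IF IM e)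
    {e' : Trivialization F proj'} (he' : IsC1Trivialization IF IN e') :
    IsC1FamilyOn IF IF {u | u ∈ e.baseSet ∧ abar u ∈ e'.baseSet}
      (fun u y => (e' (a (fiberParam e u y))).2) :=
  (ha.const_path.lift (abar := fun _ => abar) (fun _ => hproj) (hc.comp continuous_fst) he he').reparam
    (a := fun u : B => (u, (0 : unitInterval))) (by fun_prop) fun _ hu => hu

/-- Differentiating `a' ∘ a = id` along the fibers. Differentiability of `a'` along them is enough,
without continuity of the derivative. -/
theorem IsUniformlyC1AlongFibers.injective_mfderiv_of_leftInverse
    (hN : IsC1FiberedBundle F IF IN proj') {a : M → N}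
    (ha : IsUniformlyC1AlongFibers F IF IM IN proj a) {abar : B → B'}
    (hproj : ∀ x, proj' (a x) = abar (proj x)) (hc : Continuous abar) {a' : N → M}
    (hinv : LeftInverse a' a)
    (ha' : ∀ e' : Trivialization F proj', IsC1Trivialization IF IN e' → ∀ u ∈ e'.baseSet, ∀ y,
      MDifferentiableAt IF IM (fun z => a' (fiberParam e' u z)) y)
    {e : Trivialization F proj} (he : IsC1Trivialization IF IM e) {u : B} (hu : u ∈ e.baseSet)
    (y : F) : Injective (mfderiv IF IN (fun z => a (fiberParam e u z)) y) := by
  obtain ⟨e', hu', he'⟩ := hN (abar u)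
  have hη := ha.lift hproj hc he he'
  set η : F → F := fun z => (e' (a (fiberParam e u z))).2 with hη_def
  have hηd : MDifferentiableAt IF IF η y := hη.mdifferentiable ⟨hu, hu'⟩ y
  have hpar : (fun z => a (fiberParam e u z)) = fiberParam e' (abar u) ∘ η := funext fun z =>
    (fiberParam_of_proj_eq e' hu' (by rw [hproj, proj_fiberParam e hu])).symm
  have h1 : (fun z => a' (fiberParam e' (abar u) z)) ∘ η = fiberParam e u := funext fun z => by
    have := congrFun hpar z
    simp only [comp_apply] at this ⊢
    rw [← this, hinv]
  have h2 : Injective (mfderiv IF IF η y) :=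
    injective_mfderiv_of_comp (ha' e' he' _ hu' _) hηd (by rw [h1]; exact he.2 u hu y)
  have h3 := mfderiv_comp y (he'.1.mdifferentiable hu' (η y)) hηd
  rw [hpar, h3]
  exact (he'.2 _ hu' _).comp h2

/-- In trivializations, the inverse is a continuous lift of `fiberParam e'` through the immersions
`a ∘ fiberParam e`. -/
theorem IsUniformlyC1AlongFibers.symm (hM : IsC1FiberedBundle F IF IM proj) {a : M ≃ₜ N}
    (ha : IsUniformlyC1AlongFibers F IF IM IN proj a) {abar : B ≃ₜ B'}
    (hproj : ∀ x, proj' (a x) = abar (proj x))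
    (hinj : ∀ e : Trivialization F proj, IsC1Trivialization IF IM e → ∀ u ∈ e.baseSet, ∀ y,
      Injective (mfderiv IF IN (fun z => a (fiberParam e u z)) y)) :
    IsUniformlyC1AlongFibers F IF IN IM proj' a.symm := by
  intro e' he'
  have hproj' : ∀ x, proj (a.symm x) = abar.symm (proj' x) := fun x => by
    rw [abar.eq_symm_apply, ← hproj, a.apply_symm_apply]
  refine isC1FamilyOn_of_local fun u₀ hu₀ => ?_
  obtain ⟨e, hu, he⟩ := hM (abar.symm u₀)
  set V : Set B' := {u | u ∈ e'.baseSet ∧ abar.symm u ∈ e.baseSet} with hV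
  have hVn : V ∈ 𝓝 u₀ := inter_mem (e'.open_baseSet.mem_nhds hu₀)
    ((e.open_baseSet.preimage abar.symm.continuous).mem_nhds hu)
  refine ⟨V, mem_nhdsWithin_of_mem_nhds hVn, ?_⟩
  have hp : ∀ u ∈ V, ∀ y, proj (a.symm (fiberParam e' u y)) = abar.symm u := fun u hu y => by
    rw [hproj', proj_fiberParam e' hu.1]
  have hs : ∀ u ∈ V, ∀ y, fiberParam e (abar.symm u) (e (a.symm (fiberParam e' u y))).2 =
      a.symm (fiberParam e' u y) := fun u hu y => fiberParam_of_proj_eq e hu.2 (hp u hu y)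
  have hη : IsC1FamilyOn IF IF V (fun u y => (e (a.symm (fiberParam e' u y))).2) := by
    refine (ha e he).lift (hinj e he) (a := abar.symm) abar.symm.continuous.continuousOn
      (fun u hu => hu.2) ?_ (he'.1.mono fun u hu => hu.1) fun u hu y => ?_
    · refine continuous_snd.comp_continuousOn (e.toOpenPartialHomeomorph.continuousOn.comp
        (a.symm.continuous.comp_continuousOn ((continuousOn_fiberParam e').mono fun p hp =>
          ⟨hp.1.1, trivial⟩)) fun p hp' => ?_)
      exact e.mem_source.2 ((hp p.1 hp'.1 p.2).symm ▸ hp'.1.2)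
    · rw [hs u hu, a.apply_symm_apply]
  refine (he.1.comp (a := abar.symm) abar.symm.continuous.continuousOn (fun u hu => hu.2) hη).congr
    fun u hu => funext fun y => (hs u hu y).symm

/-- A fibered homeomorphism of finite distortion, uniformly `C^1` along the fibers, has an inverse
with the same property. -/
theorem IsUniformlyC1AlongFibers.symm_of_fiberDistortion_ne_top
    {G : ContMDiffRiemannianMetric IM ∞ EM (fun x : M => TangentSpace IM x)}
    (hM : IsC1FiberedBundle F IF IM proj) {f : M ≃ₜ M}
    (hf : IsUniformlyC1AlongFibers F IF IM IM proj f) {fbar : B ≃ₜ B}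
    (hproj : ∀ x, proj (f x) = fbar (proj x)) (hdist : fiberDistortion F IF IM G proj f ≠ ⊤) :
    IsUniformlyC1AlongFibers F IF IM IM proj f.symm := by
  have hfin : ∀ e : Trivialization F proj, IsC1Trivialization IF IM e → ∀ u ∈ e.baseSet, ∀ y,
      MDifferentiableAt IF IM (fun z => f.symm (fiberParam e u z)) y := by
    intro e he u hu y
    -- The value `⊤` of `fiberDerivNormAt` at points of non-differentiability turns finite
    -- distortion into differentiability of the inverse.
    by_contra h
    refine hdist (top_le_iff.1 ?_)
    refine le_trans ?_ (le_max_right _ _)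
    refine le_trans ?_ (le_iSup₂_of_le e he (le_iSup₂_of_le u hu (le_iSup _ y)))
    rw [fiberDerivNormAt, if_neg h]
  exact hf.symm hM hproj fun e he u hu y =>
    hf.injective_mfderiv_of_leftInverse hM hproj fbar.continuous f.symm_apply_apply hfin he hu y

end UniformlyC1

/-! ### The covering homotopy theorem with `C^1` fibers. -/

section CoveringHomotopy

open Function Filter

set_option linter.unusedSectionVars false

variable {B F M : Type*} [TopologicalSpace B]
  {EF HF : Type*} [NormedAddCommGroup EF] [NormedSpace ℝ EF] [FiniteDimensional ℝ EF]
  [TopologicalSpace HF]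
  {IF : ModelWithCorners ℝ EF HF} [IF.Boundaryless]
  [TopologicalSpace F] [ChartedSpace HF F] [IsManifold IF ∞ F]
  {EM HM : Type*} [NormedAddCommGroup EM] [NormedSpace ℝ EM] [FiniteDimensional ℝ EM]
  [TopologicalSpace HM]
  {IM : ModelWithCorners ℝ EM HM}
  [TopologicalSpace M] [ChartedSpace HM M] [IsManifold IM ∞ M]
  {proj : M → B} {c c' : B × unitInterval → B} {θ : unitInterval → M → M}

theorem IsC1DiffeoFamilyOn.mono {Q : Type*} [TopologicalSpace Q] {U V : Set Q} {t : Q → F → F}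
    (ht : IsC1DiffeoFamilyOn IF U t) (h : V ⊆ U) : IsC1DiffeoFamilyOn IF V t :=
  ⟨ht.1.mono h, fun q hq => ht.2 q (h hq)⟩

theorem IsC1DiffeoFamilyOn.congr {Q : Type*} [TopologicalSpace Q] {U : Set Q} {t t' : Q → F → F}
    (ht : IsC1DiffeoFamilyOn IF U t) (h : ∀ q ∈ U, t' q = t q) : IsC1DiffeoFamilyOn IF U t' :=
  ⟨ht.1.congr h, fun q hq => by rw [h q hq]; exact ht.2 q hq⟩

theorem IsC1DiffeoFamilyOn.reparam {Q Q' : Type*} [TopologicalSpace Q] [TopologicalSpace Q']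
    {U' : Set Q'} {t : Q' → F → F} (ht : IsC1DiffeoFamilyOn IF U' t) {U : Set Q} {a : Q → Q'}
    (ha : ContinuousOn a U) (hm : MapsTo a U U') : IsC1DiffeoFamilyOn IF U (fun q => t (a q)) :=
  ⟨ht.1.reparam ha hm, fun _ hq => ht.2 _ (hm hq)⟩

theorem isC1DiffeoFamilyOn_id {Q : Type*} [TopologicalSpace Q] {U : Set Q} :
    IsC1DiffeoFamilyOn IF U (fun _ : Q => (id : F → F)) :=
  ⟨isC1FamilyOn_id, fun _ _ => ⟨bijective_id, fun y => by rw [mfderiv_id]; exact injective_id⟩⟩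

variable (F IF IM) in
/-- A continuous path of maps `θ t : M → M` over `c (·, t) : B → B` whose restrictions to the fibers
are `C^1` diffeomorphisms of fibers, with derivatives that vary continuously. -/
def IsFiberIsoPath (proj : M → B) (c : B × unitInterval → B) (θ : unitInterval → M → M) : Prop :=
  (∀ t x, proj (θ t x) = c (proj x, t)) ∧
    ∀ q₀ : B × unitInterval, ∃ e e' : Trivialization F proj,
      IsC1Trivialization IF IM e ∧ IsC1Trivialization IF IM e' ∧
      ∃ V ∈ 𝓝 q₀, (∀ q ∈ V, q.1 ∈ e.baseSet ∧ c q ∈ e'.baseSet) ∧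
        IsC1DiffeoFamilyOn IF V (fun q y => (e' (θ q.2 (fiberParam e q.1 y))).2)

theorem IsFiberIsoPath.proj_apply (h : IsFiberIsoPath F IF IM proj c θ) {e : Trivialization F proj}
    {q : B × unitInterval} (hq : q.1 ∈ e.baseSet) (y : F) :
    proj (θ q.2 (fiberParam e q.1 y)) = c q := by
  rw [h.1, proj_fiberParam e hq]

theorem isFiberIsoPath_id (hM : IsC1FiberedBundle F IF IM proj) (hc : ∀ q, c q = q.1) :
    IsFiberIsoPath F IF IM proj c (fun _ x => x) := by
  refine ⟨fun t x => (hc (proj x, t)).symm, fun q₀ => ?_⟩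
  obtain ⟨e, hu, he⟩ := hM q₀.1
  refine ⟨e, e, he, he, Prod.fst ⁻¹' e.baseSet, (e.open_baseSet.preimage continuous_fst).mem_nhds hu,
    fun q hq => ⟨hq, by rw [hc]; exact hq⟩, ?_⟩
  exact isC1DiffeoFamilyOn_id.congr fun q hq => funext fun y =>
    congrArg Prod.snd (apply_fiberParam e hq y)

/-- Local representatives of a path of fiber isomorphisms with respect to a given trivialization of
the target. -/
theorem IsFiberIsoPath.exists_rep (h : IsFiberIsoPath F IF IM proj c θ) (hc : Continuous c)
    {e' : Trivialization F proj} (he' : IsC1Trivialization IF IM e') {q₀ : B × unitInterval}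
    (hq₀ : c q₀ ∈ e'.baseSet) :
    ∃ e : Trivialization F proj, IsC1Trivialization IF IM e ∧
      ∃ V ∈ 𝓝 q₀, (∀ q ∈ V, q.1 ∈ e.baseSet ∧ c q ∈ e'.baseSet) ∧
        IsC1DiffeoFamilyOn IF V (fun q y => (e' (θ q.2 (fiberParam e q.1 y))).2) := by
  obtain ⟨e, e₁, he, he₁, V, hV, hVe, hrep⟩ := h.2 q₀
  refine ⟨e, he, V ∩ c ⁻¹' e'.baseSet, inter_mem hV ((e'.open_baseSet.preimage hc).mem_nhds hq₀),
    fun q hq => ⟨(hVe q hq.1).1, hq.2⟩, ?_⟩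
  have h1 : IsC1DiffeoFamilyOn IF (V ∩ c ⁻¹' e'.baseSet) (fun q => e₁.coordChange e' (c q)) :=
    (he₁.coordChange he').reparam hc.continuousOn fun q hq => ⟨(hVe q hq.1).2, hq.2⟩
  refine (h1.comp (hrep.mono inter_subset_left)).congr fun q hq => funext fun y => ?_
  have h2 := h.proj_apply (hVe q hq.1).1 y
  have h3 : proj (θ q.2 (fiberParam e q.1 y)) ∈ e₁.baseSet := h2.symm ▸ (hVe q hq.1).2
  rw [← h2, e₁.coordChange_apply_snd e' h3]

theorem IsFiberIsoPath.isUniformlyC1 (h : IsFiberIsoPath F IF IM proj c θ) (hc : Continuous c) :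
    IsUniformlyC1PathAlongFibers F IF IM IM proj θ := by
  refine isUniformlyC1PathAlongFibers_of_local fun u t => ?_
  obtain ⟨e, e', he, he', V, hV, hVe, hrep⟩ := h.2 (u, t)
  refine ⟨e, (hVe _ (mem_of_mem_nhds hV)).1, he, V, hV, ?_⟩
  refine (he'.1.comp hc.continuousOn (fun q hq => (hVe q hq).2) hrep.1).congr fun q hq =>
    funext fun y => ?_
  exact (fiberParam_of_proj_eq e' (hVe q hq).2 (h.proj_apply (hVe q hq).1 y)).symm

theorem IsFiberIsoPath.injective_mfderiv (h : IsFiberIsoPath F IF IM proj c θ)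
    (t : unitInterval) {e : Trivialization F proj} (he : IsC1Trivialization IF IM e) {u : B}
    (hu : u ∈ e.baseSet) (y : F) : Injective (mfderiv IF IM (fun z => θ t (fiberParam e u z)) y) := by
  obtain ⟨e₁, e', he₁, he', V, hV, hVe, hrep⟩ := h.2 (u, t)
  have hq := mem_of_mem_nhds hV
  obtain ⟨hu₁, hu'⟩ := hVe _ hq
  have h1 : (fun z => θ t (fiberParam e u z)) = fiberParam e' (c (u, t)) ∘
      ((fun y => (e' (θ t (fiberParam e₁ u y))).2) ∘ e.coordChange e₁ u) := funext fun z => by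
    simp only [comp_apply]
    rw [fiberParam_coordChange e e₁ hu hu₁, fiberParam_of_proj_eq e' hu' (h.proj_apply (q := (u, t)) hu z)]
  have h2 := (he.coordChange he₁)
  have hd1 := h2.1.mdifferentiable ⟨hu, hu₁⟩ y
  have hd2 := hrep.1.mdifferentiable hq (e.coordChange e₁ u y)
  have h3 := mfderiv_comp y hd2 hd1
  have h4 := mfderiv_comp y (he'.1.mdifferentiable hu' _) (hd2.comp y hd1)
  rw [h1, h4, h3]
  exact (he'.2 _ hu' _).comp (((hrep.2 _ hq).2 _).comp ((h2.2 u ⟨hu, hu₁⟩).2 y))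

theorem IsFiberIsoPath.bijective (h : IsFiberIsoPath F IF IM proj c θ) {t : unitInterval}
    (hc : Bijective fun u => c (u, t)) : Bijective (θ t) := by
  constructor
  · intro x x' hxx'
    have hp : proj x = proj x' := hc.1 (((h.1 t x).symm.trans (congrArg proj hxx')).trans (h.1 t x'))
    obtain ⟨e, e', he, he', V, hV, hVe, hrep⟩ := h.2 (proj x, t)
    have hq := mem_of_mem_nhds hV
    have hx := fiberParam_proj e (hVe _ hq).1
    have hx' := fiberParam_of_proj_eq e (hVe _ hq).1 hp.symm
    have h1 : (e x).2 = (e x').2 := (hrep.2 _ hq).1.1 (by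
      change (e' (θ t (fiberParam e (proj x) (e x).2))).2 =
        (e' (θ t (fiberParam e (proj x) (e x').2))).2
      rw [hx, hx', hxx'])
    rw [← hx, ← hx', h1]
  · intro z
    obtain ⟨u, hu⟩ := hc.2 (proj z)
    obtain ⟨e, e', he, he', V, hV, hVe, hrep⟩ := h.2 (u, t)
    have hq := mem_of_mem_nhds hV
    obtain ⟨y, hy⟩ := (hrep.2 _ hq).1.2 (e' z).2
    refine ⟨fiberParam e u y, ?_⟩
    rw [← fiberParam_of_proj_eq e' (hVe _ hq).2 (h.proj_apply (q := (u, t)) (hVe _ hq).1 y),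
      ← fiberParam_of_proj_eq e' (hVe _ hq).2 hu.symm]
    exact congrArg _ hy

/-- A path of fiber isomorphisms over `c` can be changed to one over `c'` if `c` and `c'` only differ
where both of them take values in the domain of the same trivialization. -/
theorem IsFiberIsoPath.exists_change (h : IsFiberIsoPath F IF IM proj c θ) (hc : Continuous c)
    (hc' : Continuous c') {e : Trivialization F proj} (he : IsC1Trivialization IF IM e)
    (hcc' : ∀ q ∈ closure {q | c q ≠ c' q}, c q ∈ e.baseSet ∧ c' q ∈ e.baseSet) :
    ∃ θ', IsFiberIsoPath F IF IM proj c' θ' ∧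
      ∀ t x, c (proj x, t) = c' (proj x, t) → θ' t x = θ t x := by
  classical
  let O : Set (B × unitInterval) := c ⁻¹' e.baseSet ∩ c' ⁻¹' e.baseSet
  have hO : IsOpen O := (e.open_baseSet.preimage hc).inter (e.open_baseSet.preimage hc')
  -- Over `O`, the value moves from the fiber over `c` to the one over `c'` with its coordinate in
  -- `e` unchanged.
  let θ' : unitInterval → M → M := fun t x =>
    if (proj x, t) ∈ O then fiberParam e (c' (proj x, t)) (e (θ t x)).2 else θ t x
  have hθ'O : ∀ t x, (proj x, t) ∈ O → θ' t x = fiberParam e (c' (proj x, t)) (e (θ t x)).2 :=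
    fun t x hx => if_pos hx
  have hsame : ∀ t x, c (proj x, t) = c' (proj x, t) → θ' t x = θ t x := fun t x hx => by
    by_cases hO' : (proj x, t) ∈ O
    · rw [hθ'O t x hO', fiberParam_of_proj_eq e hO'.2 ((h.1 t x).trans hx)]
    · exact if_neg hO'
  have heq : ∀ q, q ∉ O → c q = c' q := fun q hq => by
    by_contra hne
    exact hq (hcc' q (subset_closure hne))
  refine ⟨θ', ⟨fun t x => ?_, fun q₀ => ?_⟩, hsame⟩
  · by_cases hO' : (proj x, t) ∈ O
    · rw [hθ'O t x hO', proj_fiberParam e hO'.2]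
    · rw [hsame t x (heq _ hO'), h.1, heq _ hO']
  · by_cases hq₀ : q₀ ∈ O
    · obtain ⟨e₁, he₁, V, hV, hVe, hrep⟩ := h.exists_rep hc he hq₀.1
      refine ⟨e₁, e, he₁, he, V ∩ O, inter_mem hV (hO.mem_nhds hq₀),
        fun q hq => ⟨(hVe q hq.1).1, hq.2.2⟩, ?_⟩
      refine (hrep.mono inter_subset_left).congr fun q hq => funext fun y => ?_
      have hp := proj_fiberParam e₁ (hVe q hq.1).1 y
      rw [hθ'O _ _ (by rw [hp]; exact hq.2), hp]
      have := congrArg Prod.snd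
        (apply_fiberParam e hq.2.2 (e (θ q.2 (fiberParam e₁ q.1 y))).2)
      exact this
    · obtain ⟨e₁, e₂, he₁, he₂, V, hV, hVe, hrep⟩ := h.2 q₀
      have hcl : q₀ ∉ closure {q | c q ≠ c' q} := fun hq => hq₀ (hcc' q₀ hq)
      have heq' : ∀ q ∈ (closure {q | c q ≠ c' q})ᶜ, c q = c' q := fun q hq => by
        by_contra hne
        exact hq (subset_closure hne)
      refine ⟨e₁, e₂, he₁, he₂, V ∩ (closure {q | c q ≠ c' q})ᶜ,
        inter_mem hV (isClosed_closure.isOpen_compl.mem_nhds hcl),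
        fun q hq => ⟨(hVe q hq.1).1, heq' q hq.2 ▸ (hVe q hq.1).2⟩, ?_⟩
      refine (hrep.mono inter_subset_left).congr fun q hq => funext fun y => ?_
      rw [hsame]
      rw [proj_fiberParam e₁ (hVe q hq.1).1]
      exact heq' q hq.2

/-- Deformation of `H (·, min t s)` to `H (·, min t s')`. -/
theorem IsFiberIsoPath.exists_extend [CompactSpace B] [T2Space B] {H : B × ℝ → B}
    (hH : Continuous H) {s s' : ℝ} (hss' : s ≤ s')
    {ι : Type*} [Finite ι] {W : ι → Set B} (hW : ∀ i, IsOpen (W i)) (hcov : ⋃ i, W i = univ)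
    {e : ι → Trivialization F proj} (he : ∀ i, IsC1Trivialization IF IM (e i))
    (hWe : ∀ i, ∀ u ∈ W i, ∀ r ∈ Icc s s', H (u, r) ∈ (e i).baseSet)
    (h : IsFiberIsoPath F IF IM proj (fun q => H (q.1, min (q.2 : ℝ) s)) θ) :
    ∃ θ', IsFiberIsoPath F IF IM proj (fun q => H (q.1, min (q.2 : ℝ) s')) θ' ∧
      ∀ (t : unitInterval) x, (t : ℝ) ≤ s → θ' t x = θ t x := by
  classical
  cases nonempty_fintype ι
  obtain ⟨χ, hχ⟩ := PartitionOfUnity.exists_isSubordinate isClosed_univ W hW hcov.ge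
  -- The stopping time `τ R` grows from `s` to `s'` as `R` grows from `∅` to all indices. Adding `i`
  -- affects only points over `tsupport (χ i)` at times `≥ s`, where both homotopies stay in the
  -- base set of `e i`, so `IsFiberIsoPath.exists_change` applies.
  let τ : Finset ι → B → ℝ := fun R u => s + (∑ i ∈ R, χ i u) * (s' - s)
  have hτc : ∀ R, Continuous (τ R) := fun R =>
    continuous_const.add ((continuous_finsetSum _ fun i _ => (χ i).continuous).mul continuous_const)
  have hsum : ∀ u, ∑ i, χ i u = 1 := fun u => by
    rw [← finsum_eq_sum_of_fintype]; exact χ.sum_eq_one (mem_univ u)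
  have hτI : ∀ R u, τ R u ∈ Icc s s' := fun R u => by
    have h0 : 0 ≤ ∑ i ∈ R, χ i u := Finset.sum_nonneg fun i _ => χ.nonneg i u
    have h1 : ∑ i ∈ R, χ i u ≤ 1 := by
      rw [← hsum u]
      exact Finset.sum_le_sum_of_subset_of_nonneg (Finset.subset_univ R) fun i _ _ => χ.nonneg i u
    constructor
    · simp only [τ]; nlinarith
    · simp only [τ]; nlinarith
  let cR : Finset ι → B × unitInterval → B := fun R q => H (q.1, min (q.2 : ℝ) (τ R q.1))
  have hcR : ∀ R, Continuous (cR R) := fun R => hH.comp (continuous_fst.prodMk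
    ((continuous_subtype_val.comp continuous_snd).min ((hτc R).comp continuous_fst)))
  have hmain : ∀ R : Finset ι, ∃ θ', IsFiberIsoPath F IF IM proj (cR R) θ' ∧
      ∀ (t : unitInterval) x, (t : ℝ) ≤ s → θ' t x = θ t x := by
    intro R
    induction R using Finset.induction_on with
    | empty =>
      refine ⟨θ, ?_, fun _ _ _ => rfl⟩
      have : cR ∅ = fun q => H (q.1, min (q.2 : ℝ) s) := funext fun q => by simp [cR, τ]
      rwa [this]
    | insert i R hi ih =>
      obtain ⟨θ₁, hθ₁, hθ₁s⟩ := ih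
      have hmin : ∀ (R : Finset ι) (u : B) (t : unitInterval), (t : ℝ) ≤ s →
          min (t : ℝ) (τ R u) = t := fun R u t ht => min_eq_left (ht.trans (hτI R u).1)
      have hcl : closure {q | cR R q ≠ cR (insert i R) q} ⊆
          {q | q.1 ∈ tsupport (χ i) ∧ s ≤ (q.2 : ℝ)} := by
        refine closure_minimal (fun q hq => ⟨subset_tsupport _ fun h0 => hq ?_, ?_⟩) ?_
        · have : τ R q.1 = τ (insert i R) q.1 := by
            simp only [τ, Finset.sum_insert hi, h0, zero_add]
          simp only [cR, this]
        · by_contra hlt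
          refine hq ?_
          simp only [cR]
          rw [hmin R _ _ (not_le.1 hlt).le, hmin _ _ _ (not_le.1 hlt).le]
        · exact ((isClosed_tsupport _).preimage continuous_fst).inter
            (isClosed_le continuous_const (continuous_subtype_val.comp continuous_snd))
      obtain ⟨θ₂, hθ₂, hθ₂s⟩ := hθ₁.exists_change (hcR R) (hcR (insert i R)) (he i) fun q hq => by
        obtain ⟨hq1, hq2⟩ := hcl hq
        have hm : ∀ R : Finset ι, min (q.2 : ℝ) (τ R q.1) ∈ Icc s s' := fun R =>
          ⟨le_min hq2 (hτI R _).1, (min_le_right _ _).trans (hτI R _).2⟩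
        exact ⟨hWe i _ (hχ i hq1) _ (hm R), hWe i _ (hχ i hq1) _ (hm _)⟩
      refine ⟨θ₂, hθ₂, fun t x ht => ?_⟩
      rw [hθ₂s, hθ₁s t x ht]
      simp only [cR]
      rw [hmin R _ _ ht, hmin _ _ _ ht]
  obtain ⟨θ', hθ', hθ's⟩ := hmain Finset.univ
  refine ⟨θ', ?_, hθ's⟩
  have : cR Finset.univ = fun q => H (q.1, min (q.2 : ℝ) s') := funext fun q => by
    simp [cR, τ, hsum]
  rwa [← this]

/-- The covering homotopy theorem for bundles with `C^1` fibers. -/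
theorem IsC1FiberedBundle.exists_covering_homotopy [CompactSpace B] [T2Space B]
    (hM : IsC1FiberedBundle F IF IM proj) {H : unitInterval × B → B} (hH : Continuous H)
    (hH0 : ∀ u, H (0, u) = u) :
    ∃ θ : unitInterval → M → M, IsFiberIsoPath F IF IM proj (fun q => H (q.2, q.1)) θ ∧
      ∀ x, θ 0 x = x := by
  -- Extended by constants to real times, to match the stopped homotopies of `exists_extend`.
  let H' : B × ℝ → B := fun p => H (projIcc 0 1 zero_le_one p.2, p.1)
  have hH' : Continuous H' := hH.comp ((continuous_projIcc.comp continuous_snd).prodMk continuous_fst)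
  -- By compactness of `B`, for times near `s₀` a finite cover of `B` can be chosen whose members
  -- are carried by `H` into base sets of trivializations, independently of the time. A Lebesgue
  -- subdivision of `[0,1]` then gives finitely many stages.
  have hloc : ∀ s₀ : unitInterval, ∃ J : Set unitInterval, IsOpen J ∧ s₀ ∈ J ∧
      ∃ (T : Finset B) (W : T → Set B) (e : T → Trivialization F proj), (∀ i, IsOpen (W i)) ∧
        ⋃ i, W i = univ ∧ (∀ i, IsC1Trivialization IF IM (e i)) ∧
        ∀ i, ∀ u ∈ W i, ∀ r ∈ J, H (r, u) ∈ (e i).baseSet := by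
    intro s₀
    choose e hue he using fun u => hM (H (s₀, u))
    have hbox : ∀ u, ∃ J W, IsOpen J ∧ IsOpen W ∧ s₀ ∈ J ∧ u ∈ W ∧
        J ×ˢ W ⊆ H ⁻¹' (e u).baseSet := fun u =>
      isOpen_prod_iff.1 ((e u).open_baseSet.preimage hH) s₀ u (hue u)
    choose J W hJ hW hsJ huW hJW using hbox
    obtain ⟨T, hT⟩ := isCompact_univ.elim_finite_subcover W hW fun u _ => mem_iUnion.2 ⟨u, huW u⟩
    refine ⟨⋂ i ∈ T, J i, isOpen_biInter_finset fun i _ => hJ i, mem_iInter₂.2 fun i _ => hsJ i,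
      T, fun i => W i, fun i => e i, fun i => hW i, ?_, fun i => he i, fun i u hu r hr =>
      hJW i ⟨mem_iInter₂.1 hr i i.2, hu⟩⟩
    refine eq_univ_of_forall fun u => ?_
    obtain ⟨i, hi, hu⟩ := mem_iUnion₂.1 (hT (mem_univ u))
    exact mem_iUnion.2 ⟨⟨i, hi⟩, hu⟩
  choose J hJ hsJ T W e hW hcov he hWe using hloc
  obtain ⟨t, ht0, htm, ⟨N, hN⟩, ht⟩ := exists_monotone_Icc_subset_open_cover_unitInterval hJ
    (fun s _ => mem_iUnion.2 ⟨s, hsJ s⟩)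
  have hind : ∀ n, ∃ θ : unitInterval → M → M,
      IsFiberIsoPath F IF IM proj (fun q => H' (q.1, min (q.2 : ℝ) (t n))) θ ∧ ∀ x, θ 0 x = x := by
    intro n
    induction n with
    | zero =>
      refine ⟨fun _ x => x, isFiberIsoPath_id hM fun q => ?_, fun _ => rfl⟩
      have : min (q.2 : ℝ) (t 0) = 0 := by
        rw [ht0]; exact min_eq_right q.2.2.1
      simp only [H', this]
      rw [projIcc_of_le_left _ le_rfl]
      exact hH0 q.1
    | succ n ih =>
      obtain ⟨θ, hθ, hθ0⟩ := ih
      obtain ⟨s, hs⟩ := ht n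
      obtain ⟨θ', hθ', hθ's⟩ := hθ.exists_extend hH' (htm n.le_succ) (hW s) (hcov s) (he s)
        fun i u hu r hr => by
          have hrI : r ∈ Icc (0 : ℝ) 1 := ⟨(t n).2.1.trans hr.1, hr.2.trans (t (n + 1)).2.2⟩
          have := hWe s i u hu ⟨r, hrI⟩ (hs ⟨hr.1, hr.2⟩)
          simp only [H']
          rwa [projIcc_of_mem _ hrI]
      exact ⟨θ', hθ', fun x => by rw [hθ's 0 x (t n).2.1, hθ0]⟩
  obtain ⟨θ, hθ, hθ0⟩ := hind N
  refine ⟨θ, ?_, hθ0⟩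
  have : (fun q : B × unitInterval => H' (q.1, min (q.2 : ℝ) (t N))) = fun q => H (q.2, q.1) :=
    funext fun q => by
      have : min (q.2 : ℝ) (t N) = q.2 := by
        rw [hN N le_rfl]; exact min_eq_left q.2.2.2
      simp only [H', this]
      rw [projIcc_of_mem _ q.2.2]
  rwa [← this]

end CoveringHomotopy

/-! ### Scalar products on finite-dimensional spaces. -/

section BilinearForms

open Function Filter

set_option synthInstance.maxHeartbeats 200000

variable {E E' : Type*} [NormedAddCommGroup E] [NormedSpace ℝ E] [FiniteDimensional ℝ E]
  [NormedAddCommGroup E'] [InnerProductSpace ℝ E'] [FiniteDimensional ℝ E']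

theorem exists_pos_mul_sq_norm_le {γ : E →L[ℝ] E →L[ℝ] ℝ} (hγ : ∀ w, w ≠ 0 → 0 < γ w w) :
    ∃ m > 0, ∀ w, m * ‖w‖ ^ 2 ≤ γ w w := by
  have hc : Continuous fun w => γ w w := γ.continuous.clm_apply continuous_id
  rcases subsingleton_or_nontrivial E with hE | hE
  · exact ⟨1, one_pos, fun w => by simp [Subsingleton.elim w 0]⟩
  obtain ⟨w₀, hw₀, hmin⟩ := (isCompact_sphere (0 : E) 1).exists_isMinOn
    (NormedSpace.sphere_nonempty.2 zero_le_one) hc.continuousOn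
  have hw₀' : w₀ ≠ 0 := by
    rintro rfl
    simp at hw₀
  refine ⟨γ w₀ w₀, hγ w₀ hw₀', fun w => ?_⟩
  by_cases hw : w = 0
  · simp [hw]
  have hn : ‖w‖ ≠ 0 := norm_ne_zero_iff.2 hw
  have h1 : γ w₀ w₀ ≤ γ (‖w‖⁻¹ • w) (‖w‖⁻¹ • w) := hmin (by simp [norm_smul, hn])
  have h2 : γ w w = ‖w‖ ^ 2 * γ (‖w‖⁻¹ • w) (‖w‖⁻¹ • w) := by
    simp only [map_smul, smul_apply, smul_eq_mul]
    field_simp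
  rw [h2, mul_comm]
  gcongr

/-- Positive definiteness of a continuous family of quadratic functions is an open condition. -/
theorem eventually_forall_nonneg_of_continuousAt {X : Type*} [TopologicalSpace X] {x₀ : X}
    {q : X → E → ℝ} (hq : ∀ x (c : ℝ) w, q x (c • w) = c ^ 2 * q x w)
    (hc : ∀ w, ContinuousAt (uncurry q) (x₀, w)) (hpos : ∀ w, w ≠ 0 → 0 < q x₀ w) :
    ∀ᶠ x in 𝓝 x₀, ∀ w, 0 ≤ q x w := by
  have h1 : ∀ᶠ x in 𝓝 x₀, ∀ w ∈ Metric.sphere (0 : E) 1, 0 < q x w :=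
    (isCompact_sphere (0 : E) 1).eventually_forall_of_forall_eventually fun w hw =>
      (hc w).eventually_const_lt (hpos w (by rintro rfl; simp at hw))
  filter_upwards [h1] with x hx w
  by_cases hw : w = 0
  · have := hq x 0 w
    rw [zero_smul] at this
    rw [hw, this]
    simp
  have hn : ‖w‖ ≠ 0 := norm_ne_zero_iff.2 hw
  have h2 : w = ‖w‖ • (‖w‖⁻¹ • w) := by rw [smul_smul, mul_inv_cancel₀ hn, one_smul]
  rw [h2, hq]
  have := hx (‖w‖⁻¹ • w) (by simp [norm_smul, hn])
  positivity

/-- A scalar product on a subspace extends to the whole space. -/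
theorem exists_scalarProduct_extension {γ : E →L[ℝ] E →L[ℝ] ℝ} (hsymm : ∀ v w, γ v w = γ w v)
    (hpos : ∀ w, w ≠ 0 → 0 < γ w w) {ι : E →L[ℝ] E'} (hι : Injective ι) :
    ∃ φ : E' →L[ℝ] E' →L[ℝ] ℝ, (∀ v w, φ v w = φ w v) ∧ (∀ w, w ≠ 0 → 0 < φ w w) ∧
      ∀ v w, φ (ι v) (ι w) = γ v w := by
  obtain ⟨P, hP⟩ := exists_continuousLinearMap_leftInverse ι hι
  have hP' : ∀ v, P (ι v) = v := fun v => congrArg (fun L => L v) hP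
  -- The projection to a complement of the range of `ι`; the extended form is `γ` on the range plus
  -- the given inner product on the complement.
  let Q : E' →L[ℝ] E' := .id ℝ E' - ι ∘L P
  have hQ : ∀ a, Q a = a - ι (P a) := fun a => rfl
  let β : E' →L[ℝ] E' →L[ℝ] ℝ := innerSL ℝ
  have hβ : ∀ a b, β a b = inner ℝ a b := fun a b => rfl
  refine ⟨γ.bilinearComp P P + β.bilinearComp Q Q, fun v w => ?_, fun w hw => ?_,
    fun v w => ?_⟩
  · simp [hsymm (P v) (P w), hβ, real_inner_comm]
  · simp only [add_apply, ContinuousLinearMap.bilinearComp_apply,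
      hβ, real_inner_self_eq_norm_sq]
    by_cases hPw : P w = 0
    · have : Q w = w := by rw [hQ, hPw, map_zero, sub_zero]
      rw [hPw, this, map_zero, zero_add]
      have := norm_pos_iff.2 hw
      positivity
    · have := hpos _ hPw
      positivity
  · simp [hQ, hP']

end BilinearForms

/-! ### Smooth Riemannian metrics from local data. -/

section RiemannianMetrics

open Function Filter

set_option synthInstance.maxHeartbeats 400000

set_option linter.unusedSectionVars false

variable {E H M : Type*} [NormedAddCommGroup E] [NormedSpace ℝ E] [FiniteDimensional ℝ E]
  [TopologicalSpace H] {I : ModelWithCorners ℝ E H} [TopologicalSpace M] [ChartedSpace H M]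
  [IsManifold I ∞ M]

/-- In the trivialization at `x₀` the metric has the constant value `φ`. -/
theorem contMDiffOn_metric_of_trivialization (x₀ : M) (φ : E →L[ℝ] E →L[ℝ] ℝ)
    {s : (x : M) → TangentSpace I x →L[ℝ] TangentSpace I x →L[ℝ] ℝ}
    (hs : ∀ x ∈ (chartAt H x₀).source, ∀ v w, s x v w =
      φ ((trivializationAt E (TangentSpace I) x₀).continuousLinearMapAt ℝ x v)
        ((trivializationAt E (TangentSpace I) x₀).continuousLinearMapAt ℝ x w)) :
    ContMDiffOn I (I.prod 𝓘(ℝ, E →L[ℝ] E →L[ℝ] ℝ)) ∞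
      (fun x => TotalSpace.mk' (E →L[ℝ] E →L[ℝ] ℝ)
        (E := fun x => TangentSpace I x →L[ℝ] TangentSpace I x →L[ℝ] ℝ) x (s x))
      (chartAt H x₀).source := by
  have hbase : ∀ x ∈ (chartAt H x₀).source, x ∈ (trivializationAt (E →L[ℝ] E →L[ℝ] ℝ)
      (fun x : M => TangentSpace I x →L[ℝ] TangentSpace I x →L[ℝ] ℝ) x₀).baseSet := by
    intro x hx
    rw [hom_trivializationAt_baseSet, hom_trivializationAt_baseSet]
    have hb := mem_baseSet_trivializationAt_of_mem_source (IF := I) hx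
    exact ⟨hb, hb, mem_univ _⟩
  intro x₁ hx₁
  refine ContMDiffAt.contMDiffWithinAt ?_
  rw [Trivialization.contMDiffAt_section_iff (trivializationAt (E →L[ℝ] E →L[ℝ] ℝ)
    (fun x : M => TangentSpace I x →L[ℝ] TangentSpace I x →L[ℝ] ℝ) x₀) (hbase x₁ hx₁)]
  refine (contMDiffAt_const (c := φ)).congr_of_eventuallyEq ?_
  filter_upwards [(chartAt H x₀).open_source.mem_nhds hx₁] with x hx
  have hb := mem_baseSet_trivializationAt_of_mem_source (IF := I) hx
  rw [hom_trivializationAt_apply]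
  ext v w
  change ContinuousLinearMap.inCoordinates E (TangentSpace I) (E →L[ℝ] ℝ)
    (fun x => TangentSpace I x →L[ℝ] ℝ) x₀ x x₀ x (s x) v w = φ v w
  rw [inCoordinates_apply_eq₂ hb hb (mem_univ _), hs x hx]
  have h1 : ∀ v : E, (trivializationAt E (TangentSpace I) x₀).continuousLinearMapAt ℝ x
      ((trivializationAt E (TangentSpace I) x₀).symm x v) = v := fun v => by
    rw [← Trivialization.symmL_apply (R := ℝ) _ hb]
    exact (trivializationAt E (TangentSpace I) x₀).continuousLinearMapAt_symmL (R := ℝ) hb v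
  simp [h1]

theorem isVonNBounded_of_pos {φ : E →L[ℝ] E →L[ℝ] ℝ} (hφ : ∀ w, w ≠ 0 → 0 < φ w w) :
    Bornology.IsVonNBounded ℝ {v : E | φ v v < 1} := by
  obtain ⟨m, hm, hmw⟩ := exists_pos_mul_sq_norm_le hφ
  rw [NormedSpace.isVonNBounded_iff']
  refine ⟨1 + 1 / m, fun v hv => ?_⟩
  have h1 : m * ‖v‖ ^ 2 < 1 := (hmw v).trans_lt hv
  have h2 : ‖v‖ ^ 2 < 1 / m := by rwa [lt_div_iff₀ hm, mul_comm]
  nlinarith [norm_nonneg v, sq_nonneg (‖v‖ - 1)]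

set_option maxHeartbeats 2000000 in
/-- A smooth Riemannian metric with prescribed bounds on the lengths of certain tangent vectors
exists if it exists locally. -/
theorem exists_riemannianMetric_of_local [SigmaCompactSpace M] [T2Space M]
    {R : (x : M) → TangentSpace I x → ℝ → Prop} {c₁ c₂ : ℝ}
    (hloc : ∀ x₀ : M, ∃ φ : E →L[ℝ] E →L[ℝ] ℝ, (∀ v w, φ v w = φ w v) ∧
      (∀ w, w ≠ 0 → 0 < φ w w) ∧ ∀ᶠ x in 𝓝 x₀, ∀ (v : TangentSpace I x) (γ : ℝ), R x v γ →
        c₁ * γ ≤ φ ((trivializationAt E (TangentSpace I) x₀).continuousLinearMapAt ℝ x v)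
            ((trivializationAt E (TangentSpace I) x₀).continuousLinearMapAt ℝ x v) ∧
          φ ((trivializationAt E (TangentSpace I) x₀).continuousLinearMapAt ℝ x v)
            ((trivializationAt E (TangentSpace I) x₀).continuousLinearMapAt ℝ x v) ≤ c₂ * γ) :
    ∃ G : ContMDiffRiemannianMetric I ∞ E (fun x : M => TangentSpace I x),
      ∀ (x : M) (v : TangentSpace I x) (γ : ℝ), R x v γ →
        c₁ * γ ≤ G.inner x v v ∧ G.inner x v v ≤ c₂ * γ := by
  -- All the conditions are affine in the form, so they cut out a convex set in each fiber and local
  -- solutions can be averaged by a partition of unity.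
  let t : ∀ x, Set (TangentSpace I x →L[ℝ] TangentSpace I x →L[ℝ] ℝ) := fun x =>
    {φ | (∀ v w, φ v w = φ w v) ∧ (∀ w, w ≠ 0 → 0 < φ w w) ∧
      ∀ v γ, R x v γ → c₁ * γ ≤ φ v v ∧ φ v v ≤ c₂ * γ}
  have ht : ∀ x, Convex ℝ (t x) := by
    intro x φ hφ ψ hψ a b ha hb hab
    have happ : ∀ v w, (a • φ + b • ψ) v w = a * φ v w + b * ψ v w := fun v w => rfl
    refine ⟨fun v w => ?_, fun w hw => ?_, fun v γ hv => ?_⟩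
    · rw [happ, happ, hφ.1, hψ.1]
    · rw [happ]
      have h1 := hφ.2.1 w hw
      have h2 := hψ.2.1 w hw
      rcases ha.eq_or_lt with rfl | ha'
      · have : b = 1 := by linarith
        simpa [this] using h2
      · have := mul_pos ha' h1
        have := mul_nonneg hb h2.le
        linarith
    · rw [happ]
      obtain ⟨h1, h2⟩ := hφ.2.2 v γ hv
      obtain ⟨h3, h4⟩ := hψ.2.2 v γ hv
      have e1 : b = 1 - a := by linarith
      subst e1
      constructor <;> nlinarith
  obtain ⟨s, hs⟩ := exists_contMDiffSection_forall_mem_convex_of_local (n := (⊤ : ℕ∞))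
    (I := I) (F_fiber := E →L[ℝ] E →L[ℝ] ℝ)
    (fun x => TangentSpace I x →L[ℝ] TangentSpace I x →L[ℝ] ℝ) t ht (by
      intro x₀
      obtain ⟨φ, hsymm, hpos, hb⟩ := hloc x₀
      obtain ⟨U, hU, hUo, hx₀⟩ := mem_nhds_iff.1 hb
      let ε : (x : M) → E →L[ℝ] E := fun x =>
        (trivializationAt E (TangentSpace I) x₀).continuousLinearMapAt ℝ x
      let s : (x : M) → TangentSpace I x →L[ℝ] TangentSpace I x →L[ℝ] ℝ := fun x =>
        (φ.bilinearComp (ε x) (ε x) : E →L[ℝ] E →L[ℝ] ℝ)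
      have h1 := contMDiffOn_metric_of_trivialization (I := I) x₀ φ (s := s) fun _ _ _ _ => rfl
      refine ⟨U ∩ (chartAt H x₀).source, inter_mem (hUo.mem_nhds hx₀)
        ((chartAt H x₀).open_source.mem_nhds (mem_chart_source H x₀)), s,
        h1.mono inter_subset_right, fun x hx => ⟨?_, ?_, ?_⟩⟩
      · exact fun v w => hsymm _ _
      · intro w hw
        refine hpos _ fun h0 => hw ?_
        exact (injective_iff_map_eq_zero _).1
          (injective_continuousLinearMapAt_trivializationAt (IN := I) hx.2) w h0
      · exact fun v γ hv => hU hx.1 v γ hv)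
  refine ⟨⟨fun x => s x, fun x => (hs x).1, fun x v hv => (hs x).2.1 v hv, fun x => ?_,
    s.contMDiff⟩, fun x v γ hv => (hs x).2.2 v γ hv⟩
  exact isVonNBounded_of_pos (E := E) (hs x).2.1

end RiemannianMetrics

/-! ### Smooth metrics close to a push-forward along the fibers. -/

section FiberwiseQuasiIsometries

open Function Filter

set_option synthInstance.maxHeartbeats 400000

set_option linter.unusedSectionVars false

variable {B F M N : Type*} [TopologicalSpace B]
  {EF HF : Type*} [NormedAddCommGroup EF] [NormedSpace ℝ EF] [FiniteDimensional ℝ EF]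
  [TopologicalSpace HF]
  {IF : ModelWithCorners ℝ EF HF} [IF.Boundaryless]
  [TopologicalSpace F] [ChartedSpace HF F] [IsManifold IF ∞ F]
  {EM HM : Type*} [NormedAddCommGroup EM] [NormedSpace ℝ EM] [FiniteDimensional ℝ EM]
  [TopologicalSpace HM]
  {IM : ModelWithCorners ℝ EM HM}
  [TopologicalSpace M] [ChartedSpace HM M] [IsManifold IM ∞ M]
  {EN HN : Type*} [NormedAddCommGroup EN] [InnerProductSpace ℝ EN] [FiniteDimensional ℝ EN]
  [TopologicalSpace HN]
  {IN : ModelWithCorners ℝ EN HN}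
  [TopologicalSpace N] [ChartedSpace HN N] [IsManifold IN ∞ N]
  {proj : M → B}

/-- The square of the length of a tangent vector in a Riemannian metric. -/
def sqLength (G : ContMDiffRiemannianMetric IM ∞ EM (fun x : M => TangentSpace IM x))
    (p : TangentBundle IM M) : ℝ :=
  G.inner p.1 p.2 p.2

theorem continuous_sqLength
    (G : ContMDiffRiemannianMetric IM ∞ EM (fun x : M => TangentSpace IM x)) :
    Continuous (sqLength G) := by
  have h1 : Continuous (fun p : TangentBundle IM M =>
      TotalSpace.mk' (EM →L[ℝ] EM →L[ℝ] ℝ)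
        (E := fun x : M => TangentSpace IM x →L[ℝ] TangentSpace IM x →L[ℝ] ℝ) p.1
          (G.inner p.1)) :=
    G.contMDiff.continuous.comp (FiberBundle.continuous_proj EM (TangentSpace IM (M := M)))
  have h2 : Continuous (fun p : TangentBundle IM M =>
      TotalSpace.mk' EM (E := fun x : M => TangentSpace IM x) p.1 p.2) := continuous_id
  have h3 := Continuous.clm_bundle_apply₂ (E₃ := fun _ : M => ℝ) h1 h2 h2
  have h4 := (Trivial.homeomorphProd M ℝ).continuous.comp h3
  exact continuous_snd.comp h4

/-- Transfers estimates on vectors tangent to the fibers from one trivialization to all others. -/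
theorem tangentMap_fiberParam_coordChange {Z : Type*} {EZ HZ : Type*} [NormedAddCommGroup EZ]
    [NormedSpace ℝ EZ] [TopologicalSpace HZ] {IZ : ModelWithCorners ℝ EZ HZ} [TopologicalSpace Z]
    [ChartedSpace HZ Z] {g : M → Z} {e e' : Trivialization F proj}
    (he : IsC1Trivialization IF IM e) (he' : IsC1Trivialization IF IM e') {u : B}
    (hu : u ∈ e.baseSet) (hu' : u ∈ e'.baseSet)
    (hg : MDifferentiable IF IZ (fun y => g (fiberParam e' u y))) (p : TangentBundle IF F) :
    tangentMap IF IZ (fun y => g (fiberParam e' u y))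
        (tangentMap IF IF (e.coordChange e' u) p) =
      tangentMap IF IZ (fun y => g (fiberParam e u y)) p := by
  have h1 : (fun y => g (fiberParam e u y)) =
      (fun y => g (fiberParam e' u y)) ∘ (e.coordChange e' u) :=
    funext fun y => congrArg g (fiberParam_coordChange e e' hu hu' y).symm
  rw [h1, tangentMap_comp_at p (hg _)
    ((he.coordChange he').1.mdifferentiable ⟨hu, hu'⟩ _)]

/-- A metric at a point of `N` whose restriction to the image of the fibers of `proj` under `Ψ` is
nearly the image of a given metric on `M`, near this point. -/
theorem exists_scalarProduct_of_fiberwise_immersion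
    (G : ContMDiffRiemannianMetric IM ∞ EM (fun x : M => TangentSpace IM x))
    {e : Trivialization F proj} (he : IsC1Trivialization IF IM e) {Ψ : M → N}
    (hΨ : IsC1FamilyOn IF IN e.baseSet (fun u y => Ψ (fiberParam e u y)))
    (hinj : ∀ u ∈ e.baseSet, ∀ y, Injective (mfderiv IF IN (fun y => Ψ (fiberParam e u y)) y))
    {c₁ c₂ : ℝ} (h₁ : c₁ < 1) (h₂ : 1 < c₂) {u₀ : B} (hu₀ : u₀ ∈ e.baseSet) (y₀ : F) :
    ∃ φ : EN →L[ℝ] EN →L[ℝ] ℝ, (∀ v w, φ v w = φ w v) ∧ (∀ w, w ≠ 0 → 0 < φ w w) ∧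
      ∀ᶠ q : B × F in 𝓝 (u₀, y₀), ∀ v : TangentSpace IF q.2,
        c₁ * sqLength G (tangentMap IF IM (fiberParam e q.1) ⟨q.2, v⟩) ≤
          φ ((trivializationAt EN (TangentSpace IN) (Ψ (fiberParam e u₀ y₀))).continuousLinearMapAt
              ℝ (Ψ (fiberParam e q.1 q.2))
              (mfderiv IF IN (fun y => Ψ (fiberParam e q.1 y)) q.2 v))
            ((trivializationAt EN (TangentSpace IN) (Ψ (fiberParam e u₀ y₀))).continuousLinearMapAt
              ℝ (Ψ (fiberParam e q.1 q.2))
              (mfderiv IF IN (fun y => Ψ (fiberParam e q.1 y)) q.2 v)) ∧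
        φ ((trivializationAt EN (TangentSpace IN) (Ψ (fiberParam e u₀ y₀))).continuousLinearMapAt
              ℝ (Ψ (fiberParam e q.1 q.2))
              (mfderiv IF IN (fun y => Ψ (fiberParam e q.1 y)) q.2 v))
            ((trivializationAt EN (TangentSpace IN) (Ψ (fiberParam e u₀ y₀))).continuousLinearMapAt
              ℝ (Ψ (fiberParam e q.1 q.2))
              (mfderiv IF IN (fun y => Ψ (fiberParam e q.1 y)) q.2 v)) ≤
          c₂ * sqLength G (tangentMap IF IM (fiberParam e q.1) ⟨q.2, v⟩) := by
  set x₀ := Ψ (fiberParam e u₀ y₀) with hx₀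
  let D : B × F → EF →L[ℝ] EN := fun q =>
    derivInCoord IF IN y₀ x₀ (fun y => Ψ (fiberParam e q.1 y)) q.2
  let σ : (q : B × F) → EF →L[ℝ] TangentSpace IF q.2 := fun q =>
    (trivializationAt EF (TangentSpace IF) y₀).symmL ℝ q.2
  let τ : B × F → EF → ℝ := fun q w => sqLength G (tangentMap IF IM (fiberParam e q.1) ⟨q.2, σ q w⟩)
  let A : EF →L[ℝ] EM := (mfderiv IF IM (fiberParam e u₀) y₀) ∘L σ (u₀, y₀)
  let Γ : EM →L[ℝ] EM →L[ℝ] ℝ := G.inner (fiberParam e u₀ y₀)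
  have hy₀ := mem_chart_source HF y₀
  have hD₀ : Injective (D (u₀, y₀)) :=
    injective_derivInCoord hy₀ (mem_chart_source HN x₀) (hinj u₀ hu₀ y₀)
  have hA : Injective A := (he.2 u₀ hu₀ y₀).comp (injective_symmL_trivializationAt hy₀)
  have hτ₀ : ∀ w, τ (u₀, y₀) w = Γ.bilinearComp A A w w := fun w => rfl
  have hpos : ∀ w, w ≠ 0 → 0 < Γ.bilinearComp A A w w := fun w hw =>
    G.pos (fiberParam e u₀ y₀) (A w) fun h0 => hw ((injective_iff_map_eq_zero A).1 hA w h0)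
  -- At the center `φ` restricts exactly to the given metric of the fiber. As `c₁ < 1 < c₂`, the two
  -- bounds are strict there on nonzero vectors, and persist nearby by compactness of the unit
  -- sphere.
  obtain ⟨φ, hsymm, hφ, hext⟩ := exists_scalarProduct_extension (γ := Γ.bilinearComp A A)
    (fun v w => G.symm _ (A v) (A w)) hpos hD₀
  refine ⟨φ, hsymm, hφ, ?_⟩
  have hsource : ∀ᶠ q : B × F in 𝓝 (u₀, y₀), q.1 ∈ e.baseSet ∧ q.2 ∈ (chartAt HF y₀).source :=
    ((e.open_baseSet.preimage continuous_fst).inter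
      ((chartAt HF y₀).open_source.preimage continuous_snd)).mem_nhds ⟨hu₀, hy₀⟩
  have hcont : ContinuousAt (fun q : B × F => Ψ (fiberParam e q.1 q.2)) (u₀, y₀) :=
    hΨ.continuousOn.continuousAt ((e.open_baseSet.prod isOpen_univ).mem_nhds ⟨hu₀, trivial⟩)
  have hDc : ContinuousAt D (u₀, y₀) := by
    refine (hΨ.continuousOn_derivInCoord y₀ x₀).continuousAt ?_
    filter_upwards [hsource, hcont ((chartAt HN x₀).open_source.mem_nhds (mem_chart_source HN x₀))]
      with q hq hq'
    exact ⟨hq.1, hq.2, hq'⟩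
  have hφc : ∀ w : EF, ContinuousAt (fun r : (B × F) × EF => φ (D r.1 r.2) (D r.1 r.2))
      ((u₀, y₀), w) := by
    intro w
    have h0 : ContinuousAt (fun r : (B × F) × EF => D r.1) ((u₀, y₀), w) :=
      ContinuousAt.comp (x := ((u₀, y₀), w)) (f := Prod.fst) (g := D) hDc continuousAt_fst
    have h1 : ContinuousAt (fun r : (B × F) × EF => D r.1 r.2) ((u₀, y₀), w) :=
      h0.clm_apply continuousAt_snd
    have h2 : Continuous fun v : EN => φ v v := φ.continuous.clm_apply continuous_id
    exact h2.continuousAt.comp h1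
  have hτc : ∀ w : EF, ContinuousAt (fun r : (B × F) × EF => τ r.1 r.2) ((u₀, y₀), w) := by
    intro w
    have h1 : ContinuousOn (fun r : (B × F) × EF =>
        (⟨r.1.2, σ r.1 r.2⟩ : TangentBundle IF F)) {r | r.1.2 ∈ (chartAt HF y₀).source} := by
      have h2 := (trivializationAt EF (TangentSpace IF) y₀).toOpenPartialHomeomorph.continuousOn_symm
      have h3 : ContinuousOn (fun r : (B × F) × EF => (r.1.2, r.2))
        {r | r.1.2 ∈ (chartAt HF y₀).source} := by fun_prop
      refine (h2.comp h3 fun r hr => ?_).congr fun r hr => ?_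
      · exact (trivializationAt EF (TangentSpace IF) y₀).mem_target.2
          (mem_baseSet_trivializationAt_of_mem_source hr)
      · have hb := mem_baseSet_trivializationAt_of_mem_source (IF := IF) hr
        change (⟨r.1.2, (trivializationAt EF (TangentSpace IF) y₀).symmL ℝ r.1.2 r.2⟩ :
          TangentBundle IF F) = _
        rw [Trivialization.symmL_apply (R := ℝ) _ hb]
        exact (trivializationAt EF (TangentSpace IF) y₀).mk_symm hb r.2
    have h4 : ContinuousAt (fun r : (B × F) × EF => (r.1.1, (⟨r.1.2, σ r.1 r.2⟩ :
        TangentBundle IF F))) ((u₀, y₀), w) :=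
      (continuous_fst.comp continuous_fst).continuousAt.prodMk (h1.continuousAt
        (((chartAt HF y₀).open_source.preimage
          (continuous_snd.comp continuous_fst)).mem_nhds hy₀))
    have h5 : ContinuousAt (fun p : B × TangentBundle IF F =>
        tangentMap IF IM (fiberParam e p.1) p.2) (u₀, ⟨y₀, σ (u₀, y₀) w⟩) :=
      he.1.2.continuousAt ((e.open_baseSet.prod isOpen_univ).mem_nhds ⟨hu₀, trivial⟩)
    exact (continuous_sqLength G).continuousAt.comp
      (ContinuousAt.comp (x := ((u₀, y₀), w)) (f := fun r : (B × F) × EF =>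
        (r.1.1, (⟨r.1.2, σ r.1 r.2⟩ : TangentBundle IF F))) h5 h4)
  have hφs : ∀ (q : B × F) (c : ℝ) (w : EF),
      φ (D q (c • w)) (D q (c • w)) = c ^ 2 * φ (D q w) (D q w) := by
    intro q c w
    simp only [map_smul, smul_apply, smul_eq_mul]
    ring
  have hτs : ∀ (q : B × F) (c : ℝ) (w : EF), τ q (c • w) = c ^ 2 * τ q w := by
    intro q c w
    let Γ' : EM →L[ℝ] EM →L[ℝ] ℝ := G.inner (fiberParam e q.1 q.2)
    let A' : EF →L[ℝ] EM := (mfderiv IF IM (fiberParam e q.1) q.2) ∘L σ q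
    change Γ' (A' (c • w)) (A' (c • w)) = c ^ 2 * Γ' (A' w) (A' w)
    simp only [map_smul, smul_apply, smul_eq_mul]
    ring
  have hlower := eventually_forall_nonneg_of_continuousAt (x₀ := (u₀, y₀))
    (q := fun q w => φ (D q w) (D q w) - c₁ * τ q w)
    (fun q c w => by rw [hφs, hτs]; ring)
    (fun w => (hφc w).sub ((hτc w).const_mul c₁))
    (fun w hw => by
      have := hpos w hw
      rw [hext, hτ₀]
      nlinarith)
  have hupper := eventually_forall_nonneg_of_continuousAt (x₀ := (u₀, y₀))
    (q := fun q w => c₂ * τ q w - φ (D q w) (D q w))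
    (fun q c w => by rw [hφs, hτs]; ring)
    (fun w => ((hτc w).const_mul c₂).sub (hφc w))
    (fun w hw => by
      have := hpos w hw
      rw [hext, hτ₀]
      nlinarith)
  filter_upwards [hlower, hupper, hsource] with q hl hu hq v
  have hb := mem_baseSet_trivializationAt_of_mem_source (IF := IF) hq.2
  obtain ⟨w, rfl⟩ : ∃ w : EF, σ q w = v := ⟨_, (trivializationAt EF
    (TangentSpace IF) y₀).symmL_continuousLinearMapAt (R := ℝ) hb v⟩
  exact ⟨sub_nonneg.1 (hl w), sub_nonneg.1 (hu w)⟩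

/-- If `Ψ` restricts to `C^1` embeddings of the fibers of `proj : M → B`, a Riemannian metric on
`M` is nearly isometric, along the fibers, to some smooth Riemannian metric. -/
theorem exists_riemannianMetric_near_pushforward [SigmaCompactSpace N] [T2Space N]
    (hM : IsC1FiberedBundle F IF IM proj)
    (G : ContMDiffRiemannianMetric IM ∞ EM (fun x : M => TangentSpace IM x)) (Ψ : M ≃ₜ N)
    (hΨ : IsUniformlyC1AlongFibers F IF IM IN proj Ψ)
    (hinj : ∀ e : Trivialization F proj, IsC1Trivialization IF IM e → ∀ u ∈ e.baseSet, ∀ y,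
      Injective (mfderiv IF IN (fun y => Ψ (fiberParam e u y)) y))
    {c₁ c₂ : ℝ} (h₁ : c₁ < 1) (h₂ : 1 < c₂) :
    ∃ G' : ContMDiffRiemannianMetric IN ∞ EN (fun x : N => TangentSpace IN x),
      ∀ e : Trivialization F proj, IsC1Trivialization IF IM e → ∀ u ∈ e.baseSet,
        ∀ p : TangentBundle IF F,
          c₁ * sqLength G (tangentMap IF IM (fiberParam e u) p) ≤
            sqLength G' (tangentMap IF IN (fun y => Ψ (fiberParam e u y)) p) ∧
          sqLength G' (tangentMap IF IN (fun y => Ψ (fiberParam e u y)) p) ≤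
            c₂ * sqLength G (tangentMap IF IM (fiberParam e u) p) := by
  obtain ⟨G', hG'⟩ := exists_riemannianMetric_of_local (M := N) (I := IN) (c₁ := c₁) (c₂ := c₂)
    -- The relation constrains only vectors tangent to the images of the fibers, `γ` being the
    -- squared length of the preimage; other directions are free.
    (R := fun x v γ => ∃ e : Trivialization F proj, IsC1Trivialization IF IM e ∧
      ∃ u ∈ e.baseSet, ∃ p : TangentBundle IF F,
        tangentMap IF IN (fun y => Ψ (fiberParam e u y)) p = ⟨x, v⟩ ∧
        γ = sqLength G (tangentMap IF IM (fiberParam e u) p)) (by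
    intro x₀
    obtain ⟨e₀, hu₀, he₀⟩ := hM (proj (Ψ.symm x₀))
    obtain ⟨φ, hsymm, hφ, hev⟩ := exists_scalarProduct_of_fiberwise_immersion G he₀ (hΨ e₀ he₀)
      (hinj e₀ he₀) h₁ h₂ hu₀ (e₀ (Ψ.symm x₀)).2
    rw [fiberParam_proj e₀ hu₀, Ψ.apply_symm_apply] at hev
    refine ⟨φ, hsymm, hφ, ?_⟩
    have hs₀ : Ψ.symm x₀ ∈ e₀.source := e₀.mem_source.2 hu₀
    have hsrc : ∀ᶠ x in 𝓝 x₀, Ψ.symm x ∈ e₀.source :=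
      (e₀.open_source.preimage Ψ.symm.continuous).mem_nhds hs₀
    have hc : ContinuousAt (fun x => e₀ (Ψ.symm x)) x₀ :=
      ContinuousAt.comp (f := Ψ.symm) (g := e₀)
        (e₀.toOpenPartialHomeomorph.continuousOn.continuousAt (e₀.open_source.mem_nhds hs₀))
        Ψ.symm.continuous.continuousAt
    have he : e₀ (Ψ.symm x₀) = (proj (Ψ.symm x₀), (e₀ (Ψ.symm x₀)).2) :=
      Prod.ext (e₀.coe_fst hs₀) rfl
    have hc' : Tendsto (fun x => e₀ (Ψ.symm x)) (𝓝 x₀)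
      (𝓝 (proj (Ψ.symm x₀), (e₀ (Ψ.symm x₀)).2)) := he ▸ hc
    filter_upwards [hsrc, hc'.eventually hev] with x hx hxe v γ
    rintro ⟨e, heC, u, hu, p, hp, rfl⟩
    have hx1 : Ψ (fiberParam e u p.1) = x := congrArg TotalSpace.proj hp
    have hx2 : Ψ.symm x = fiberParam e u p.1 := by rw [← hx1, Ψ.symm_apply_apply]
    have hu' : u ∈ e₀.baseSet := by
      have := e₀.mem_source.1 hx
      rwa [hx2, proj_fiberParam e hu] at this
    have hex : e₀ (Ψ.symm x) = (u, e.coordChange e₀ u p.1) := by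
      rw [hx2, ← fiberParam_coordChange e e₀ hu hu', apply_fiberParam e₀ hu']
    rw [hex] at hxe
    rw [← tangentMap_fiberParam_coordChange heC he₀ hu hu'
      ((hΨ e₀ he₀).mdifferentiable hu')] at hp
    have h3 := tangentMap_fiberParam_coordChange (g := id) heC he₀ hu hu'
      (he₀.1.mdifferentiable hu') p
    rw [show tangentMap IF IM (fiberParam e u) p = _ from h3.symm]
    have h4 := hxe (tangentMap IF IF (e.coordChange e₀ u) p).2
    have key : ∀ q : TangentBundle IN N, q = ⟨x, v⟩ →
        φ ((trivializationAt EN (TangentSpace IN) x₀).continuousLinearMapAt ℝ x v)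
          ((trivializationAt EN (TangentSpace IN) x₀).continuousLinearMapAt ℝ x v) =
        φ ((trivializationAt EN (TangentSpace IN) x₀).continuousLinearMapAt ℝ q.1 q.2)
          ((trivializationAt EN (TangentSpace IN) x₀).continuousLinearMapAt ℝ q.1 q.2) := by
      rintro q rfl
      rfl
    rw [key _ hp]
    exact h4)
  exact ⟨G', fun e he u hu p => hG' _ _ _ ⟨e, he, u, hu, p, rfl, rfl⟩⟩

end FiberwiseQuasiIsometries

/-! ### Distortion under conjugation. -/

section Distortion

open Function Filter

set_option linter.unusedSectionVars false

variable {B F M N : Type*} [TopologicalSpace B]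
  {EF HF : Type*} [NormedAddCommGroup EF] [NormedSpace ℝ EF] [FiniteDimensional ℝ EF]
  [TopologicalSpace HF]
  {IF : ModelWithCorners ℝ EF HF} [IF.Boundaryless]
  [TopologicalSpace F] [ChartedSpace HF F] [IsManifold IF ∞ F]
  {EM HM : Type*} [NormedAddCommGroup EM] [NormedSpace ℝ EM] [FiniteDimensional ℝ EM]
  [TopologicalSpace HM]
  {IM : ModelWithCorners ℝ EM HM}
  [TopologicalSpace M] [ChartedSpace HM M] [IsManifold IM ∞ M]
  {EN HN : Type*} [NormedAddCommGroup EN] [NormedSpace ℝ EN] [FiniteDimensional ℝ EN]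
  [TopologicalSpace HN]
  {IN : ModelWithCorners ℝ EN HN}
  [TopologicalSpace N] [ChartedSpace HN N] [IsManifold IN ∞ N]
  {proj : M → B} {proj' : N → B}

theorem IsC1FiberedBundle.continuous (hM : IsC1FiberedBundle F IF IM proj) : Continuous proj := by
  refine continuous_iff_continuousAt.2 fun x => ?_
  obtain ⟨e, hu, -⟩ := hM (proj x)
  exact e.continuousAt_proj (e.mem_source.2 hu)

theorem IsC1FiberedBundle.surjective [Nonempty F] (hM : IsC1FiberedBundle F IF IM proj) :
    Surjective proj := fun u => by
  obtain ⟨e, hu, -⟩ := hM u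
  exact ⟨_, proj_fiberParam e hu (Classical.arbitrary F)⟩

theorem IsUniformlyC1PathAlongFibers.continuous (hM : IsC1FiberedBundle F IF IM proj)
    {Γ : unitInterval → M → N} (hΓ : IsUniformlyC1PathAlongFibers F IF IM IN proj Γ) :
    Continuous (uncurry Γ) := by
  refine continuous_iff_continuousAt.2 fun ⟨t₀, x₀⟩ => ?_
  obtain ⟨e, hu, he⟩ := hM (proj x₀)
  have hs : x₀ ∈ e.source := e.mem_source.2 hu
  have h1 : ContinuousAt (fun p : unitInterval × M => e p.2) (t₀, x₀) :=
    ContinuousAt.comp (f := Prod.snd) (g := e) (x := (t₀, x₀))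
      (e.toOpenPartialHomeomorph.continuousOn.continuousAt (e.open_source.mem_nhds hs))
      continuousAt_snd
  have h2 : ContinuousAt (fun p : unitInterval × M => ((proj p.2, p.1), (e p.2).2)) (t₀, x₀) :=
    ((hM.continuous.comp continuous_snd).continuousAt.prodMk continuousAt_fst).prodMk h1.snd
  have h3 : ContinuousAt (uncurry fun (q : B × unitInterval) y => Γ q.2 (fiberParam e q.1 y))
      ((proj x₀, t₀), (e x₀).2) :=
    (hΓ e he).continuousOn.continuousAt
      (((e.open_baseSet.prod isOpen_univ).prod isOpen_univ).mem_nhds ⟨⟨hu, trivial⟩, trivial⟩)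
  refine (ContinuousAt.comp (x := (t₀, x₀)) (f := fun p : unitInterval × M =>
    ((proj p.2, p.1), (e p.2).2)) h3 h2).congr ?_
  filter_upwards [(e.open_source.preimage continuous_snd).mem_nhds hs] with p hp
  exact congrArg (Γ p.1) (fiberParam_proj e (e.mem_source.1 hp))

theorem sqLength_nonneg
    (G : ContMDiffRiemannianMetric IM ∞ EM (fun x : M => TangentSpace IM x))
    (p : TangentBundle IM M) : 0 ≤ sqLength G p := by
  by_cases h : p.2 = 0
  · rw [sqLength, h, map_zero]
  · exact (G.pos _ _ h).le

theorem sqrt_div_sqrt_le_of_bounds {a b a' b' C : ℝ} (hC : 0 < C) (hb : 0 ≤ b)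
    (ha' : a' ≤ C * a) (hb1 : C⁻¹ * b ≤ b') (hb2 : b' ≤ C * b) :
    √a' / √b' ≤ C * (√a / √b) := by
  -- For `b = 0`, which occurs for the zero vector, both quotients are `0` by the convention on
  -- division.
  rcases hb.eq_or_lt with rfl | hb
  · rw [mul_zero] at hb2
    rw [Real.sqrt_eq_zero_of_nonpos hb2]
    simp
  · have h1 : √a' ≤ √C * √a := by
      rw [← Real.sqrt_mul hC.le]
      exact Real.sqrt_le_sqrt ha'
    have h2 : (√C)⁻¹ * √b ≤ √b' := by
      rw [← Real.sqrt_inv, ← Real.sqrt_mul (inv_nonneg.2 hC.le)]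
      exact Real.sqrt_le_sqrt hb1
    have hC' := Real.sqrt_pos.2 hC
    have hb' := Real.sqrt_pos.2 hb
    calc √a' / √b' ≤ (√C * √a) / ((√C)⁻¹ * √b) := by gcongr
      _ = (√C * √C) * (√a / √b) := by field_simp
      _ = C * (√a / √b) := by rw [Real.mul_self_sqrt hC.le]

theorem le_fiberDerivNorm {G : ContMDiffRiemannianMetric IM ∞ EM (fun x : M => TangentSpace IM x)}
    {a : M → M} {e : Trivialization F proj} (he : IsC1Trivialization IF IM e) {u : B}
    (hu : u ∈ e.baseSet) (p : TangentBundle IF F) :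
    ENNReal.ofReal (√(sqLength G (tangentMap IF IM (fun z => a (fiberParam e u z)) p)) /
      √(sqLength G (tangentMap IF IM (fiberParam e u) p))) ≤ fiberDerivNorm F IF IM G proj a := by
  refine le_trans ?_ (le_iSup₂_of_le e he (le_iSup₂_of_le u hu (le_iSup _ p.1)))
  rw [fiberDerivNormAt]
  split_ifs
  · exact le_iSup (fun v : TangentSpace IF p.1 => ENNReal.ofReal
      (riemannianLength IM G (a (fiberParam e u p.1))
          (mfderiv IF IM (fun z => a (fiberParam e u z)) p.1 v) /
        riemannianLength IM G (fiberParam e u p.1) (mfderiv IF IM (fiberParam e u) p.1 v))) p.2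
  · exact le_top

/-- A conjugacy that changes the lengths of tangent vectors of the fibers by a bounded factor
changes the norms of derivatives along the fibers by a bounded factor. -/
theorem fiberDerivNorm_le_of_conj
    {G : ContMDiffRiemannianMetric IM ∞ EM (fun x : M => TangentSpace IM x)}
    {G' : ContMDiffRiemannianMetric IN ∞ EN (fun x : N => TangentSpace IN x)}
    (hM : IsC1FiberedBundle F IF IM proj) {Ψ : M ≃ₜ N} {h : B ≃ₜ B}
    (hΨp : ∀ x, proj' (Ψ x) = h (proj x)) (hΨ : IsUniformlyC1AlongFibers F IF IM IN proj Ψ)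
    (hΨs : IsUniformlyC1AlongFibers F IF IN IM proj' Ψ.symm) {C : ℝ} (hC : 0 < C)
    (hG : ∀ e : Trivialization F proj, IsC1Trivialization IF IM e → ∀ u ∈ e.baseSet,
      ∀ p : TangentBundle IF F,
        C⁻¹ * sqLength G (tangentMap IF IM (fiberParam e u) p) ≤
          sqLength G' (tangentMap IF IN (fun y => Ψ (fiberParam e u y)) p) ∧
        sqLength G' (tangentMap IF IN (fun y => Ψ (fiberParam e u y)) p) ≤
          C * sqLength G (tangentMap IF IM (fiberParam e u) p))
    {a : M → M} {abar : B → B} (hap : ∀ x, proj (a x) = abar (proj x)) (habar : Continuous abar)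
    (ha : IsUniformlyC1AlongFibers F IF IM IM proj a) {g : N → N} (hg : ∀ x, g (Ψ x) = Ψ (a x)) :
    fiberDerivNorm F IF IN G' proj' g ≤ ENNReal.ofReal C * fiberDerivNorm F IF IM G proj a := by
  refine iSup₂_le fun e' he' => iSup₂_le fun u' hu' => iSup_le fun y => ?_
  obtain ⟨e, hu, he⟩ := hM (h.symm u')
  obtain ⟨e₁, hu₁, he₁⟩ := hM (abar (h.symm u'))
  set u := h.symm u' with hu_def
  have hΨsp : ∀ x, proj (Ψ.symm x) = h.symm (proj' x) := fun x => by
    rw [h.eq_symm_apply, ← hΨp, Ψ.apply_symm_apply]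
  -- With `η` and `η₁` the coordinate expressions of `Ψ⁻¹` and `a`, both the fiber over `u'` and its
  -- image under `g` are seen through `Ψ`. Numerator and denominator of the quotient can then be
  -- compared with lengths in `G`.
  set η : F → F := fun z => (e (Ψ.symm (fiberParam e' u' z))).2
  have hη : MDifferentiable IF IF η :=
    (hΨs.lift hΨsp h.symm.continuous he' he).mdifferentiable ⟨hu', hu⟩
  set η₁ : F → F := fun z => (e₁ (a (fiberParam e u z))).2
  have hη₁ : MDifferentiable IF IF η₁ :=
    (ha.lift hap habar he he₁).mdifferentiable ⟨hu, hu₁⟩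
  have hη_eq : ∀ z, fiberParam e u (η z) = Ψ.symm (fiberParam e' u' z) := fun z =>
    fiberParam_of_proj_eq e hu (by rw [hΨsp, proj_fiberParam e' hu'])
  have hη₁_eq : ∀ z, fiberParam e₁ (abar u) (η₁ z) = a (fiberParam e u z) := fun z =>
    fiberParam_of_proj_eq e₁ hu₁ (by rw [hap, proj_fiberParam e hu])
  have h1 : fiberParam e' u' = (fun z => Ψ (fiberParam e u z)) ∘ η := funext fun z => by
    rw [comp_apply, hη_eq, Ψ.apply_symm_apply]
  have h2 : (fun z => a (fiberParam e u z)) = fiberParam e₁ (abar u) ∘ η₁ := funext fun z =>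
    (hη₁_eq z).symm
  have h3 : (fun z => g (fiberParam e' u' z)) =
      (fun z => Ψ (fiberParam e₁ (abar u) z)) ∘ (η₁ ∘ η) := funext fun z => by
    rw [comp_apply, comp_apply, hη₁_eq, hη_eq, ← hg, Ψ.apply_symm_apply]
  have hd1 := (hΨ e he).mdifferentiable hu
  have hd3 := (hΨ e₁ he₁).mdifferentiable hu₁
  have hd : MDifferentiable IF IN (fun z => g (fiberParam e' u' z)) :=
    h3 ▸ hd3.comp (hη₁.comp hη)
  rw [fiberDerivNormAt, if_pos (hd y)]
  refine iSup_le fun v => ?_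
  have hden : tangentMap IF IN (fiberParam e' u') ⟨y, v⟩ =
      tangentMap IF IN (fun z => Ψ (fiberParam e u z)) (tangentMap IF IF η ⟨y, v⟩) := by
    rw [h1, tangentMap_comp_at _ (hd1 _) (hη _)]
  have hnum : tangentMap IF IN (fun z => g (fiberParam e' u' z)) ⟨y, v⟩ =
      tangentMap IF IN (fun z => Ψ (fiberParam e₁ (abar u) z))
        (tangentMap IF IF η₁ (tangentMap IF IF η ⟨y, v⟩)) := by
    rw [h3, tangentMap_comp_at _ (hd3 _) ((hη₁.comp hη) _), tangentMap_comp_at _ (hη₁ _) (hη _)]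
  have hnum' : tangentMap IF IM (fun z => a (fiberParam e u z)) (tangentMap IF IF η ⟨y, v⟩) =
      tangentMap IF IM (fiberParam e₁ (abar u))
        (tangentMap IF IF η₁ (tangentMap IF IF η ⟨y, v⟩)) := by
    rw [h2, tangentMap_comp_at _ (he₁.1.mdifferentiable hu₁ _) (hη₁ _)]
  have hb := hG e he u hu (tangentMap IF IF η ⟨y, v⟩)
  have hb₁ := (hG e₁ he₁ _ hu₁ (tangentMap IF IF η₁ (tangentMap IF IF η ⟨y, v⟩))).2
  rw [← hden] at hb
  rw [← hnum, ← hnum'] at hb₁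
  have h4 := sqrt_div_sqrt_le_of_bounds hC (sqLength_nonneg G _) hb₁ hb.1 hb.2
  refine (ENNReal.ofReal_le_ofReal h4).trans ?_
  rw [ENNReal.ofReal_mul hC.le]
  gcongr
  exact le_fiberDerivNorm he hu _

end Distortion

/-! ### The conjugate map and the homotopy. -/

section Conjugation

open Function Filter

set_option linter.unusedSectionVars false

variable {B F M N : Type*} [TopologicalSpace B]
  {EF HF : Type*} [NormedAddCommGroup EF] [NormedSpace ℝ EF] [FiniteDimensional ℝ EF]
  [TopologicalSpace HF]
  {IF : ModelWithCorners ℝ EF HF} [IF.Boundaryless]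
  [TopologicalSpace F] [ChartedSpace HF F] [IsManifold IF ∞ F]
  {EM HM : Type*} [NormedAddCommGroup EM] [NormedSpace ℝ EM] [FiniteDimensional ℝ EM]
  [TopologicalSpace HM]
  {IM : ModelWithCorners ℝ EM HM}
  [TopologicalSpace M] [ChartedSpace HM M] [IsManifold IM ∞ M]
  {EN HN : Type*} [NormedAddCommGroup EN] [InnerProductSpace ℝ EN] [FiniteDimensional ℝ EN]
  [TopologicalSpace HN]
  {IN : ModelWithCorners ℝ EN HN}
  [TopologicalSpace N] [ChartedSpace HN N] [IsManifold IN ∞ N]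
  {proj : M → B} {proj' : N → B}

theorem exists_mul_lt {d lam : ℝ} (hd : 0 ≤ d) (h : d < lam) : ∃ C : ℝ, 1 < C ∧ C * d < lam := by
  have h0 : 0 < lam + d := by linarith
  -- Both inequalities amount to `d < lam`.
  refine ⟨2 * lam / (lam + d), by rw [lt_div_iff₀ h0]; linarith, ?_⟩
  rw [div_mul_eq_mul_div, div_lt_iff₀ h0]
  nlinarith

/-- Lifting the homotopy from the identity to `h` gives `T` over `h`; then `Ψ = Φ ∘ T` and `g = Ψ ∘
f ∘ Ψ⁻¹`. The metric `G'` is nearly the push-forward of `G` under `Ψ` along the fibers, so `g` has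
nearly the distortion of `f`. -/
theorem exists_conj_of_homotopic_id [CompactSpace B] [T2Space B] [CompactSpace M] [T2Space M]
    (hM : IsC1FiberedBundle F IF IM proj) (hN : IsC1FiberedBundle F IF IN proj')
    (Φ : M ≃ₜ N) (hΦp : ∀ x, proj' (Φ x) = proj x)
    (hΦ : IsUniformlyC1AlongFibers F IF IM IN proj Φ)
    (hΦs : IsUniformlyC1AlongFibers F IF IN IM proj' Φ.symm)
    (G : ContMDiffRiemannianMetric IM ∞ EM (fun x : M => TangentSpace IM x))
    (f : M ≃ₜ M) (fbar : B ≃ₜ B) (hfp : ∀ x, proj (f x) = fbar (proj x))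
    (hf : IsUniformlyC1AlongFibers F IF IM IM proj f) {lam : ℝ}
    (hdist : fiberDistortion F IF IM G proj f < ENNReal.ofReal lam) (gbar h : B ≃ₜ B)
    (hconj : ∀ x, h (fbar x) = gbar (h x))
    (hid : ContinuousMap.Homotopic (h : C(B, B)) (ContinuousMap.id B)) :
    ∃ (Ψ : M ≃ₜ N) (g : N ≃ₜ N)
      (G' : ContMDiffRiemannianMetric IN ∞ EN (fun x : N => TangentSpace IN x)),
      (∀ x, proj' (g x) = gbar (proj' x)) ∧
      IsUniformlyC1AlongFibers F IF IN IN proj' g ∧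
      IsUniformlyC1AlongFibers F IF IN IN proj' g.symm ∧
      fiberDistortion F IF IN G' proj' g < ENNReal.ofReal lam ∧
      (∀ x, proj' (Ψ x) = h (proj x)) ∧
      IsUniformlyC1AlongFibers F IF IM IN proj Ψ ∧
      IsUniformlyC1AlongFibers F IF IN IM proj' Ψ.symm ∧
      (∀ x, g (Ψ x) = Ψ (f x)) ∧
      IsUniformlyC1AlongFibers F IF IM IM proj f.symm ∧
      ∃ K : C(unitInterval × M, M),
        (∀ x, K (0, x) = f x) ∧
        (∀ x, K (1, x) = Φ.symm (g (Φ x))) ∧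
        (∀ t : unitInterval, ∃ κ : C(B, B), ∀ x, proj (K (t, x)) = κ (proj x)) ∧
        IsUniformlyC1PathAlongFibers F IF IM IM proj (fun t x => K (t, x)) := by
  obtain ⟨H⟩ := hid.symm
  have H0 : ∀ u, H (0, u) = u := H.apply_zero
  have H1 : ∀ u, H (1, u) = h u := H.apply_one
  have hH : Continuous H := H.continuous
  obtain ⟨θ, hθ, hθ0⟩ := hM.exists_covering_homotopy hH H0
  have hθC := hθ.isUniformlyC1 (hH.comp (continuous_snd.prodMk continuous_fst))
  have hθc : Continuous (uncurry θ) := hθC.continuous hM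
  have hbij : Bijective (θ 1) := hθ.bijective (by
    change Bijective fun u => H (1, u)
    simp only [H1]
    exact h.bijective)
  let T : M ≃ₜ M := Continuous.homeoOfEquivCompactToT2 (f := Equiv.ofBijective (θ 1) hbij)
    (hθc.comp (continuous_const.prodMk continuous_id))
  have hTp : ∀ x, proj (T x) = h (proj x) := fun x => (hθ.1 1 x).trans (H1 _)
  have hT : IsUniformlyC1AlongFibers F IF IM IM proj T := hθC.apply 1
  have hTs : IsUniformlyC1AlongFibers F IF IM IM proj T.symm :=
    hT.symm hM hTp fun e he u hu y => hθ.injective_mfderiv 1 he hu y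
  have hTsp : ∀ x, proj (T.symm x) = h.symm (proj x) := fun x => by
    rw [h.eq_symm_apply, ← hTp, T.apply_symm_apply]
  have hfs := hf.symm_of_fiberDistortion_ne_top hM hfp hdist.ne_top
  have hfsp : ∀ x, proj (f.symm x) = fbar.symm (proj x) := fun x => by
    rw [fbar.eq_symm_apply, ← hfp, f.apply_symm_apply]
  have hΦsp : ∀ x, proj (Φ.symm x) = proj' x := fun x => by rw [← hΦp, Φ.apply_symm_apply]
  let Ψ : M ≃ₜ N := T.trans Φ
  have hΨp : ∀ x, proj' (Ψ x) = h (proj x) := fun x => (hΦp _).trans (hTp x)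
  have hΨ : IsUniformlyC1AlongFibers F IF IM IN proj Ψ := hΦ.comp hM hT hTp h.continuous
  have hΨs : IsUniformlyC1AlongFibers F IF IN IM proj' Ψ.symm :=
    hTs.comp hM hΦs (abar := id) hΦsp continuous_id
  have hΨsp : ∀ x, proj (Ψ.symm x) = h.symm (proj' x) := fun x => by
    rw [h.eq_symm_apply, ← hΨp, Ψ.apply_symm_apply]
  let g : N ≃ₜ N := Ψ.symm.trans (f.trans Ψ)
  have hgΨ : ∀ x, g (Ψ x) = Ψ (f x) := fun x => congrArg (fun z => Ψ (f z)) (Ψ.symm_apply_apply x)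
  have hgsΨ : ∀ x, g.symm (Ψ x) = Ψ (f.symm x) := fun x =>
    congrArg (fun z => Ψ (f.symm z)) (Ψ.symm_apply_apply x)
  have hg : IsUniformlyC1AlongFibers F IF IN IN proj' g :=
    hΨ.comp hM (hf.comp hM hΨs hΨsp h.symm.continuous) (abar := fun u => fbar (h.symm u))
      (fun x => (hfp _).trans (congrArg fbar (hΨsp x))) (fbar.continuous.comp h.symm.continuous)
  have hgs : IsUniformlyC1AlongFibers F IF IN IN proj' g.symm :=
    hΨ.comp hM (hfs.comp hM hΨs hΨsp h.symm.continuous) (abar := fun u => fbar.symm (h.symm u))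
      (fun x => (hfsp _).trans (congrArg fbar.symm (hΨsp x))) (fbar.symm.continuous.comp h.symm.continuous)
  have hlam : 0 ≤ lam := by
    by_contra hneg
    rw [ENNReal.ofReal_of_nonpos (not_le.1 hneg).le] at hdist
    exact not_lt_zero hdist
  obtain ⟨C, hC1, hC⟩ := exists_mul_lt ENNReal.toReal_nonneg
    ((ENNReal.lt_ofReal_iff_toReal_lt hdist.ne_top).1 hdist)
  have hC0 : 0 < C := one_pos.trans hC1
  have : CompactSpace N := Φ.compactSpace
  have : T2Space N := Φ.t2Space
  obtain ⟨G', hG'⟩ := exists_riemannianMetric_near_pushforward hM G Ψ hΨ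
    (fun e he u hu y => hΨ.injective_mfderiv_of_leftInverse hN hΨp h.continuous
      Ψ.symm_apply_apply (fun e' he' u hu y => (hΨs e' he').mdifferentiable hu y) he hu y)
    (inv_lt_one_of_one_lt₀ hC1) hC1
  have hd1 := fiberDerivNorm_le_of_conj hM hΨp hΨ hΨs hC0 hG' hfp fbar.continuous hf hgΨ
  have hd2 := fiberDerivNorm_le_of_conj hM hΨp hΨ hΨs hC0 hG' hfsp fbar.symm.continuous hfs hgsΨ
  have hdg : fiberDistortion F IF IN G' proj' g < ENNReal.ofReal lam := by
    have h1 : fiberDistortion F IF IN G' proj' g ≤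
        ENNReal.ofReal C * fiberDistortion F IF IM G proj f :=
      max_le (hd1.trans (by gcongr; exact le_max_left _ _))
        (hd2.trans (by gcongr; exact le_max_right _ _))
    refine h1.trans_lt ?_
    rw [← ENNReal.ofReal_toReal hdist.ne_top, ← ENNReal.ofReal_mul hC0.le]
    exact (ENNReal.ofReal_lt_ofReal_iff_of_nonneg (by positivity)).2 hC
  have hin : IsUniformlyC1PathAlongFibers F IF IM IM proj
      (fun t x => θ (unitInterval.symm t) x) := hθC.reparam unitInterval.continuous_symm
  have hfT : IsUniformlyC1AlongFibers F IF IM IM proj (fun x => f (T.symm x)) :=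
    hf.comp hM hTs hTsp h.symm.continuous
  have hmid : IsUniformlyC1PathAlongFibers F IF IM IM proj
      (fun t x => f (T.symm (θ (unitInterval.symm t) x))) :=
    hfT.const_path.comp hM hin (abar := fun t u => H (unitInterval.symm t, u))
      (fun t x => hθ.1 _ x) (by fun_prop)
  have hmidp : ∀ t x, proj (f (T.symm (θ (unitInterval.symm t) x))) =
      fbar (h.symm (H (unitInterval.symm t, proj x))) := fun t x => by
    rw [hfp, hTsp, hθ.1]
  -- At time `0` the factor `θ 1 = T` on the right cancels `T⁻¹`; at time `1` it has become the
  -- identity, and the left factor is `T`. Only `T` is ever inverted, since `θ t` need not be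
  -- invertible in between.
  have hK : IsUniformlyC1PathAlongFibers F IF IM IM proj
      (fun t x => θ t (f (T.symm (θ (unitInterval.symm t) x)))) :=
    hθC.comp hM hmid (abar := fun t u => fbar (h.symm (H (unitInterval.symm t, u))))
      hmidp (by fun_prop)
  refine ⟨Ψ, g, G', fun x => ?_, hg, hgs, hdg, hΨp, hΨ, hΨs, hgΨ, hfs,
    ⟨⟨_, hK.continuous hM⟩, fun x => ?_, fun x => ?_, fun t => ?_, hK⟩⟩
  · obtain ⟨z, rfl⟩ := Ψ.surjective x
    rw [hgΨ, hΨp, hfp, hconj, hΨp]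
  · change θ 0 (f (T.symm (θ (unitInterval.symm 0) x))) = f x
    rw [hθ0, unitInterval.symm_zero]
    exact congrArg f (T.symm_apply_apply x)
  · change θ 1 (f (T.symm (θ (unitInterval.symm 1) x))) = Φ.symm (g (Φ x))
    rw [unitInterval.symm_one, hθ0]
    change T (f (T.symm x)) = Φ.symm (Φ (T (f (T.symm (Φ.symm (Φ x))))))
    rw [Φ.symm_apply_apply, Φ.symm_apply_apply]
  · refine ⟨⟨fun u => H (t, fbar (h.symm (H (unitInterval.symm t, u)))), by fun_prop⟩, fun x => ?_⟩
    exact (hθ.1 t _).trans (congrArg (fun u => H (t, u)) (hmidp t x))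

end Conjugation

/-! ### Empty fibers. -/

section IsEmpty

variable {E H M : Type*} [NormedAddCommGroup E] [NormedSpace ℝ E] [TopologicalSpace H]
  {I : ModelWithCorners ℝ E H} [TopologicalSpace M] [ChartedSpace H M]

theorem isManifold_of_isEmpty [IsEmpty M] : IsManifold I ∞ M :=
  isManifold_of_contDiffOn I ∞ M fun e _ _ _ => by
    rintro x ⟨⟨hx, -⟩, -⟩
    exact isEmptyElim (e.symm (I.symm x))

/-- The Riemannian metric of the empty manifold. -/
def riemannianMetricOfIsEmpty [IsManifold I ∞ M] [IsEmpty M] :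
    ContMDiffRiemannianMetric I ∞ E (fun x : M => TangentSpace I x) where
  inner := isEmptyElim
  symm := isEmptyElim
  pos := isEmptyElim
  isVonNBounded := isEmptyElim
  contMDiff := isEmptyElim

theorem IsC1FiberedBundle.isEmpty {B F EF HF : Type*} [TopologicalSpace B] [NormedAddCommGroup EF]
    [NormedSpace ℝ EF] [TopologicalSpace HF] {IF : ModelWithCorners ℝ EF HF} [TopologicalSpace F]
    [ChartedSpace HF F] [IsManifold IF ∞ F] [IsManifold I ∞ M] {proj : M → B} [IsEmpty F]
    (h : IsC1FiberedBundle F IF I proj) : IsEmpty M :=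
  ⟨fun x => isEmptyElim ((h (proj x)).choose x).2⟩

end IsEmpty

end

/-! ### The main theorem. -/

theorem mainTheorem7 {m k b : ℕ} {M : Type u} {B : Type v} {F : Type w}
    [TopologicalSpace M] [ChartedSpace (EuclideanSpace ℝ (Fin m)) M] [IsManifold (𝓡 m) ∞ M]
    [CompactSpace M] [T2Space M]
    [TopologicalSpace F] [ChartedSpace (EuclideanSpace ℝ (Fin k)) F] [IsManifold (𝓡 k) ∞ F]
    [CompactSpace F] [T2Space F]
    [TopologicalSpace B] [ChartedSpace (EuclideanSpace ℝ (Fin b)) B] [IsManifold (𝓡 b) ∞ B]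
    [T2Space B]
    (G : ContMDiffRiemannianMetric (𝓡 m) ∞ (EuclideanSpace ℝ (Fin m))
      (fun x : M => TangentSpace (𝓡 m) x))
    (proj : M → B) (hproj : IsC1FiberedBundle F (𝓡 k) (𝓡 m) proj)
    (f : M ≃ₜ M) (fbar : B ≃ₜ B) (hfbar : ∀ x, proj (f x) = fbar (proj x))
    (hf : IsUniformlyC1AlongFibers F (𝓡 k) (𝓡 m) (𝓡 m) proj f)
    (lam : ℝ) (hlam : 1 < lam)
    (hdist : fiberDistortion F (𝓡 k) (𝓡 m) G proj f < ENNReal.ofReal lam)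
    (gbar : B ≃ₘ^∞⟮𝓡 b, 𝓡 b⟯ B)
    (h : B ≃ₜ B) (hconj : ∀ x, h (fbar x) = gbar (h x))
    (hid : ContinuousMap.Homotopic (h : C(B, B)) (ContinuousMap.id B)) :
    ∃ (M' : Type u) (_ : TopologicalSpace M')
      (_ : ChartedSpace (EuclideanSpace ℝ (Fin (b + k))) M') (_ : IsManifold (𝓡 (b + k)) ∞ M')
      (proj' : M' → B) (Φ Ψ : M ≃ₜ M') (g : M' ≃ₜ M')
      (G' : ContMDiffRiemannianMetric (𝓡 (b + k)) ∞ (EuclideanSpace ℝ (Fin (b + k)))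
        (fun x : M' => TangentSpace (𝓡 (b + k)) x)),
      -- a smooth bundle
      IsSmoothFiberBundle F (𝓡 k) (𝓡 (b + k)) (𝓡 b) proj' ∧
      -- isomorphic, over the identity of the base, to the given one through `Φ`
      (∀ x, proj' (Φ x) = proj x) ∧
      IsUniformlyC1AlongFibers F (𝓡 k) (𝓡 m) (𝓡 (b + k)) proj Φ ∧
      IsUniformlyC1AlongFibers F (𝓡 k) (𝓡 (b + k)) (𝓡 m) proj' Φ.symm ∧
      -- a fibered homeomorphism over `gbar`, uniformly `C^1` along the fibers
      (∀ x, proj' (g x) = gbar (proj' x)) ∧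
      IsUniformlyC1AlongFibers F (𝓡 k) (𝓡 (b + k)) (𝓡 (b + k)) proj' g ∧
      IsUniformlyC1AlongFibers F (𝓡 k) (𝓡 (b + k)) (𝓡 (b + k)) proj' g.symm ∧
      -- of distortion less than `lam`
      fiberDistortion F (𝓡 k) (𝓡 (b + k)) G' proj' g < ENNReal.ofReal lam ∧
      -- the identification `Ψ` of `M` with `M'` covers the conjugacy `h`
      (∀ x, proj' (Ψ x) = h (proj x)) ∧
      IsUniformlyC1AlongFibers F (𝓡 k) (𝓡 m) (𝓡 (b + k)) proj Ψ ∧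
      IsUniformlyC1AlongFibers F (𝓡 k) (𝓡 (b + k)) (𝓡 m) proj' Ψ.symm ∧
      -- under `Ψ`, `f` is deformed to `g` through fibered homeomorphisms
      (∃ Γ : M × unitInterval ≃ₜ M × unitInterval,
        (∀ p, (Γ p).2 = p.2) ∧
        (∀ x, (Γ (x, 0)).1 = f x) ∧
        (∀ x, (Γ (x, 1)).1 = Ψ.symm (g (Ψ x))) ∧
        (∀ t : unitInterval, ∃ κ : B ≃ₜ B, ∀ x, proj (Γ (x, t)).1 = κ (proj x)) ∧
        IsUniformlyC1PathAlongFibers F (𝓡 k) (𝓡 m) (𝓡 m) proj (fun t x => (Γ (x, t)).1) ∧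
        IsUniformlyC1PathAlongFibers F (𝓡 k) (𝓡 m) (𝓡 m) proj (fun t x => (Γ.symm (x, t)).1)) ∧
      -- under `Φ`, `f` is homotopic to `g` through fibered maps
      (∃ K : C(unitInterval × M, M),
        (∀ x, K (0, x) = f x) ∧
        (∀ x, K (1, x) = Φ.symm (g (Φ x))) ∧
        (∀ t : unitInterval, ∃ κ : C(B, B), ∀ x, proj (K (t, x)) = κ (proj x)) ∧
        IsUniformlyC1PathAlongFibers F (𝓡 k) (𝓡 m) (𝓡 m) proj (fun t x => K (t, x))) := by
  -- If `F` is empty, so is `M`, and the base need not be compact. Otherwise the base is compact as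
  -- the image of `M`, which the construction of the smooth bundle requires.
  rcases isEmpty_or_nonempty F with hF | hF
  · have : IsEmpty M := hproj.isEmpty
    let cs : ChartedSpace (EuclideanSpace ℝ (Fin (b + k))) M := ChartedSpace.empty _ M
    have hcs : IsManifold (𝓡 (b + k)) ∞ M := isManifold_of_isEmpty
    refine ⟨M, inferInstance, cs, hcs, proj, .refl M, .refl M, .refl M, riemannianMetricOfIsEmpty,
      fun u => ?_,
      isEmptyElim, fun _ _ => isC1FamilyOn_of_isEmpty, fun _ _ => isC1FamilyOn_of_isEmpty,
      isEmptyElim, fun _ _ => isC1FamilyOn_of_isEmpty, fun _ _ => isC1FamilyOn_of_isEmpty, ?_,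
      isEmptyElim, fun _ _ => isC1FamilyOn_of_isEmpty, fun _ _ => isC1FamilyOn_of_isEmpty,
      ⟨.refl _, fun _ => rfl, isEmptyElim, isEmptyElim, fun _ => ⟨.refl B, isEmptyElim⟩,
        fun _ _ => isC1FamilyOn_of_isEmpty, fun _ _ => isC1FamilyOn_of_isEmpty⟩,
      ⟨⟨Prod.snd, continuous_snd⟩, isEmptyElim, isEmptyElim, fun _ => ⟨.id B, isEmptyElim⟩,
        fun _ _ => isC1FamilyOn_of_isEmpty⟩⟩
    · obtain ⟨e, hu, -⟩ := hproj u
      exact ⟨e, hu, isEmptyElim, fun p => isEmptyElim p.2⟩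
    -- The supremum over the empty fiber is `0`, so positivity of `lam` is enough.
    · have : (0 : ENNReal) < ENNReal.ofReal lam := ENNReal.ofReal_pos.2 (one_pos.trans hlam)
      simpa [fiberDistortion, fiberDerivNorm] using this
  · have : CompactSpace B := hproj.surjective.compactSpace hproj.continuous
    let L : (EuclideanSpace ℝ (Fin b) × EuclideanSpace ℝ (Fin k)) ≃L[ℝ]
      EuclideanSpace ℝ (Fin (b + k)) := ContinuousLinearEquiv.ofFinrankEq (by simp)
    obtain ⟨cs, hcs, hsm⟩ := hproj.exists_smooth_bundle (𝓡 b) L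
    have hsm' : ∀ u, ∃ e : Trivialization F proj, u ∈ e.baseSet ∧
        IsC1Trivialization (𝓡 k) (𝓡 m) e ∧ IsC1Trivialization (𝓡 k) (𝓡 (b + k)) e := fun u => by
      obtain ⟨e, hu, he, h1, h2⟩ := hsm u
      exact ⟨e, hu, he, isC1Trivialization_of_contMDiffOn h1 h2⟩
    have hN : IsC1FiberedBundle F (𝓡 k) (𝓡 (b + k)) proj := fun u => by
      obtain ⟨e, hu, -, he⟩ := hsm' u
      exact ⟨e, hu, he⟩
    have hΦ : IsUniformlyC1AlongFibers F (𝓡 k) (𝓡 m) (𝓡 (b + k)) proj (Homeomorph.refl M) :=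
      isUniformlyC1AlongFibers_of_cover fun u => by
        obtain ⟨e, hu, he, he'⟩ := hsm' u
        exact ⟨e, hu, he, he'.1⟩
    have hΦs : IsUniformlyC1AlongFibers F (𝓡 k) (𝓡 (b + k)) (𝓡 m) proj
        (Homeomorph.refl M).symm :=
      isUniformlyC1AlongFibers_of_cover fun u => by
        obtain ⟨e, hu, he, he'⟩ := hsm' u
        exact ⟨e, hu, he', he.1⟩
    obtain ⟨Ψ, g, G', hgp, hg, hgs, hdg, hΨp, hΨ, hΨs, hgΨ, hfs, K, hK0, hK1, hKp, hK⟩ :=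
      exists_conj_of_homotopic_id hproj hN (Homeomorph.refl M) (fun _ => rfl) hΦ hΦs G f fbar hfbar hf
        hdist gbar.toHomeomorph h hconj hid
    exact ⟨M, inferInstance, cs, hcs, proj, .refl M, Ψ, g, G',
      fun u => (hsm u).imp fun e he => ⟨he.1, he.2.2⟩, fun _ => rfl, hΦ, hΦs, hgp, hg, hgs, hdg, hΨp,
      -- As `g` is conjugate to `f` by `Ψ`, the deformation is constant in time.
      hΨ, hΨs, ⟨f.prodCongr (.refl _), fun _ => rfl, fun _ => rfl,
        fun x => ((congrArg Ψ.symm (hgΨ x)).trans (Ψ.symm_apply_apply _)).symm,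
        fun _ => ⟨fbar, hfbar⟩, hf.const_path, hfs.const_path⟩, K, hK0, hK1, hKp, hK⟩
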